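/- **Lemma.** $\mathrm{succETR} \le_p \mathrm{succQUAD}$. Furthermore, the reduction only creates quadratic polynomials with at most four monomials and coefficients $\pm 1$. That is, there is a function $f$, computable in polynomial time by a Turing machine, which maps Boolean circuits to instances of $\mathrm{succQUAD}$, such that $C \in \mathrm{succETR} \iff f(C) \in \mathrm{succQUAD}$ for every Boolean circuit $C$, and such that for every $C$ the instance $f(C)$ is well-formed and each of its polynomials has degree at most two and at most four monomials, all with coefficient $1$ or $-1$ (both for the given list of monomials, ignoring entries with coefficient $0$ that only pad the list, and for the polynomial that is their sum). Here the problems are defined as follows. *succETR.* Consider sentences $\exists x_1 \dots \exists x_n\, \varphi(x_1,\dots,x_n)$, interpreted over the real numbers, where $\varphi$ is a quantifier-free formula built with $\vee, \wedge$ from comparisons $s = t$ and $s < t$ of terms that are built from variables and the constants $0,1$ with $+$ and $\cdot$. (As is assumed throughout for inputs of this problem, negations have been pushed to the comparisons and absorbed there, and $\le$ has been eliminated.) The formula $\varphi$ is viewed as a binary tree whose leaves are labeled with variables or constants and whose inner nodes are labeled with $+,\cdot,=,<,\wedge,\vee$. A Boolean circuit $C$ computing a function $\{0,1\}^N \to \{0,1\}^M$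 encodes such a sentence if, for each $v \in \{0,1\}^N$, the string $C(v)$ is the fixed-format encoding (with $M = 4N+7$) either of the mark "unused" or of the label, the parent (or "none") and the left and right child (or "none") of the node $v$, and if the nodes that are not marked as unused are exactly the nodes of the tree of a formula $\varphi$ whose variables are indexed by $\{0,1\}^N$. $\mathrm{succETR}$ is the set of all Boolean circuits that encode a true sentence; circuits that do not encode a sentence are no-instances. *succQUAD.* An instance is a Boolean circuit $C$ computing a function $\{0,1\}^K \times \{0,1\}^N \to \{0,1\}^M$, given together with $K$, $N$ and the widths of the fields of its output. It is well-formed if $C$ has $K+N$ inputs, the length $M$ is the total width of the fields, and for all $x$ and $y$ the string $C(x,y)$ encodes a monomial: a coefficient, given as a quotient of two binary integers with nonzero denominator, and two factors, each of which is a variable (named by a bit string) or $1$. This is the $y$-th monomial of the $x$-th equation; monomials may be repeated, and the $x$-th polynomial is the sum of all monomials in its list. $\mathrm{succQUAD}$ is the set of all well-formed instances for which the polynomials, $x \in \{0,1\}^K$, have a common real root. -/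

import Mathlib

namespace SuccReals

/-! ### Boolean circuits -/

/-- Gates of a Boolean circuit, presented as a straight-line program. A wire is referred to by the
number of wires created after it: `0` is the most recently created wire. -/
inductive Gate where
  | const (b : Bool)
  | not (i : ℕ)
  | and (i j : ℕ)
  | or (i j : ℕ)

namespace Gate

/-- All references of the gate point to one of the `n` already existing wires. -/
def WellFormed (n : ℕ) : Gate → Prop
  | const _ => True
  | not i => i < n
  | and i j => i < n ∧ j < n
  | or i j => i < n ∧ j < n

/-- The value of a gate, given the values `w` of the existing wires, most recent wire first. -/
def eval (w : List Bool) : Gate → Bool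
  | const b => b
  | not i => !(w.getD i false)
  | and i j => w.getD i false && w.getD j false
  | or i j => w.getD i false || w.getD j false

end Gate

/-- Every gate of the program only refers to wires that exist before it; `n` is the number
of wires at the start. -/
def GatesWellFormed : ℕ → List Gate → Prop
  | _, [] => True
  | n, g :: gs => g.WellFormed n ∧ GatesWellFormed (n + 1) gs

/-- The values of all wires, most recent wire first, after running the program on the wires `w`. -/
def runGates : List Bool → List Gate → List Bool
  | w, [] => w
  | w, g :: gs => runGates (g.eval w :: w) gs

/-- A Boolean circuit computing a function `{0,1}^numInputs → {0,1}^outputs.length`. The initial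
wires are the inputs, the `i`-th input being wire `i`; then the gates are executed in order;
finally the outputs are references into the list of all wires. -/
@[ext]
structure Circuit where
  numInputs : ℕ
  gates : List Gate
  outputs : List ℕ
  gates_wf : GatesWellFormed numInputs gates
  outputs_wf : ∀ i ∈ outputs, i < numInputs + gates.length

/-- The output string of the circuit on the input string `x` (of length `numInputs`). -/
def Circuit.eval (C : Circuit) (x : List Bool) : List Bool :=
  C.outputs.map fun i => (runGates x C.gates).getD i false

/-! ### Reading fields of an output string -/

/-- The bits `o, o + 1, …, o + n - 1` of a string. -/
def bitsAt (w : List Bool) (o n : ℕ) : Fin n → Bool :=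
  fun i => w.getD (o + i) false

/-- A string of `n` bits or nothing, stored in `n + 1` bits: a presence flag and then the string. -/
def optBitsAt (w : List Bool) (o n : ℕ) : Option (Fin n → Bool) :=
  if w.getD o false then some (bitsAt w (o + 1) n) else none

/-- An integer, stored in `n + 1` bits: a sign bit and then the absolute value in binary, least
significant bit first. -/
def intAt (w : List Bool) (o n : ℕ) : ℤ :=
  (if w.getD o false then -1 else 1) * (Nat.ofBits (bitsAt w (o + 1) n) : ℤ)

/-! ### The existential theory of the reals -/

/-- Arithmetic terms with variables indexed by `V`. -/
inductive Term (V : Type) where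
  | var (x : V)
  | zero
  | one
  | add (s t : Term V)
  | mul (s t : Term V)

/-- Quantifier-free formulas with variables indexed by `V`. -/
inductive Formula (V : Type) where
  | eq (s t : Term V)
  | lt (s t : Term V)
  | le (s t : Term V)
  | and (φ ψ : Formula V)
  | or (φ ψ : Formula V)
  | not (φ : Formula V)

/-- The value of a term over the reals. -/
def Term.eval {V : Type} (ξ : V → ℝ) : Term V → ℝ
  | var x => ξ x
  | zero => 0
  | one => 1
  | add s t => s.eval ξ + t.eval ξ
  | mul s t => s.eval ξ * t.eval ξ

namespace Formula

/-- Truth of a formula over the reals. -/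
def Holds {V : Type} (ξ : V → ℝ) : Formula V → Prop
  | eq s t => s.eval ξ = t.eval ξ
  | lt s t => s.eval ξ < t.eval ξ
  | le s t => s.eval ξ ≤ t.eval ξ
  | and φ ψ => φ.Holds ξ ∧ ψ.Holds ξ
  | or φ ψ => φ.Holds ξ ∨ ψ.Holds ξ
  | not φ => ¬ φ.Holds ξ

/-- The normal form assumed of all inputs: negations have been absorbed into the comparisons and
`≤` has been eliminated, so that neither `¬` nor `≤` occurs. -/
def IsNormal {V : Type} : Formula V → Prop
  | eq _ _ => True
  | lt _ _ => True
  | le _ _ => False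
  | and φ ψ => φ.IsNormal ∧ ψ.IsNormal
  | or φ ψ => φ.IsNormal ∧ ψ.IsNormal
  | not _ => False

end Formula

/-! ### Succinct formulas -/

/-- Labels of the nodes of a formula tree; `unused` marks an element of the node set
that is not a node of the tree. -/
inductive Label (V : Type) where
  | unused
  | zero
  | one
  | var (x : V)
  | add
  | mul
  | eq
  | lt
  | le
  | and
  | or
  | not

/-- The description of a node: its label (`none` for an invalid label code), its parent
(`none` for the root) and its children (`none` where there is no child). -/
structure Node (V : Type) where
  label : Option (Label V)
  parent : Option V
  left : Option V
  right : Option V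

/-- The label with a given code; the second argument is the variable of a variable label. -/
def decodeLabel {V : Type} (code : ℕ) (x : V) : Option (Label V) :=
  match code with
  | 0 => some .unused
  | 1 => some .zero
  | 2 => some .one
  | 3 => some (.var x)
  | 4 => some .add
  | 5 => some .mul
  | 6 => some .eq
  | 7 => some .lt
  | 8 => some .le
  | 9 => some .and
  | 10 => some .or
  | 11 => some .not
  | _ => none

/-- The node description stored in a string of `4 * n + 7` bits, for nodes and variables named by
strings of `n` bits: four bits for the kind of label, `n` bits for the variable, and `n + 1` bits
for each of the parent, the left child and the right child. -/
def decodeNode (n : ℕ) (w : List Bool) : Node (Fin n → Bool) where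
  label := decodeLabel (Nat.ofBits (bitsAt w 0 4)) (bitsAt w 4 n)
  parent := optBitsAt w (n + 4) n
  left := optBitsAt w (2 * n + 5) n
  right := optBitsAt w (3 * n + 6) n

/-- In the node table `d`, the node `v` with parent `p` is the root of a subtree representing the
given term. -/
def Term.IsAt {V : Type} (d : V → Node V) : Option V → V → Term V → Prop
  | p, v, var x => d v = ⟨some (.var x), p, none, none⟩
  | p, v, zero => d v = ⟨some .zero, p, none, none⟩
  | p, v, one => d v = ⟨some .one, p, none, none⟩
  | p, v, add s t => ∃ l r, l ≠ r ∧ d v = ⟨some .add, p, some l, some r⟩ ∧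
      s.IsAt d (some v) l ∧ t.IsAt d (some v) r
  | p, v, mul s t => ∃ l r, l ≠ r ∧ d v = ⟨some .mul, p, some l, some r⟩ ∧
      s.IsAt d (some v) l ∧ t.IsAt d (some v) r

/-- In the node table `d`, the node `v` with parent `p` is the root of a subtree representing the
given formula. -/
def Formula.IsAt {V : Type} (d : V → Node V) : Option V → V → Formula V → Prop
  | p, v, eq s t => ∃ l r, l ≠ r ∧ d v = ⟨some .eq, p, some l, some r⟩ ∧
      s.IsAt d (some v) l ∧ t.IsAt d (some v) r
  | p, v, lt s t => ∃ l r, l ≠ r ∧ d v = ⟨some .lt, p, some l, some r⟩ ∧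
      s.IsAt d (some v) l ∧ t.IsAt d (some v) r
  | p, v, le s t => ∃ l r, l ≠ r ∧ d v = ⟨some .le, p, some l, some r⟩ ∧
      s.IsAt d (some v) l ∧ t.IsAt d (some v) r
  | p, v, and φ ψ => ∃ l r, l ≠ r ∧ d v = ⟨some .and, p, some l, some r⟩ ∧
      φ.IsAt d (some v) l ∧ ψ.IsAt d (some v) r
  | p, v, or φ ψ => ∃ l r, l ≠ r ∧ d v = ⟨some .or, p, some l, some r⟩ ∧
      φ.IsAt d (some v) l ∧ ψ.IsAt d (some v) r
  | p, v, not φ => ∃ l, d v = ⟨some .not, p, some l, none⟩ ∧ φ.IsAt d (some v) l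

/-- The node table `d` describes the tree of the formula `φ`, and every node outside this tree is
marked as unused. (Two occurrences of a subformula or subterm are never the same node: siblings
are distinct, every node of the tree names its parent, and only the root has no parent.) -/
def Represents {V : Type} (d : V → Node V) (φ : Formula V) : Prop :=
  ∃ root, φ.IsAt d none root ∧
    ∀ v, (d v).label ≠ some .unused →
      Relation.ReflTransGen (fun a b => (d a).left = some b ∨ (d a).right = some b) root v

/-- The node table given by a circuit: the node set is `{0,1}^N` with `N = C.numInputs`, and the
variables are indexed by `{0,1}^N` as well. -/
def Circuit.nodeTable (C : Circuit) (v : Fin C.numInputs → Bool) :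
    Node (Fin C.numInputs → Bool) :=
  decodeNode C.numInputs (C.eval (List.ofFn v))

/-- `succETR`: the circuits that encode a true sentence `∃ x, φ(x)` (with `φ` in normal form). -/
def SuccETR : Set Circuit :=
  {C | C.outputs.length = 4 * C.numInputs + 7 ∧
    ∃ φ : Formula (Fin C.numInputs → Bool),
      Represents C.nodeTable φ ∧ φ.IsNormal ∧ ∃ ξ : (Fin C.numInputs → Bool) → ℝ, φ.Holds ξ}

/-! ### Succinct systems of quadratic equations -/

/-- An instance of `succQUAD`: a circuit computing a function `{0,1}^K × {0,1}^N → {0,1}^M`,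
together with `K = eqBits`, `N = monBits`, and the lengths of the fields of its output:
`coeffBits` for the absolute value of an integer and `varBits` for the name of a variable. -/
@[ext]
structure QuadInstance where
  eqBits : ℕ
  monBits : ℕ
  coeffBits : ℕ
  varBits : ℕ
  circuit : Circuit

namespace QuadInstance

variable (I : QuadInstance)

/-- The encoding of the `y`-th monomial of the `x`-th equation. -/
def out (x : Fin I.eqBits → Bool) (y : Fin I.monBits → Bool) : List Bool :=
  I.circuit.eval (List.ofFn x ++ List.ofFn y)

/-- Numerator of the coefficient of the `y`-th monomial of the `x`-th equation. -/
def num (x : Fin I.eqBits → Bool) (y : Fin I.monBits → Bool) : ℤ :=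
  intAt (I.out x y) 0 I.coeffBits

/-- Denominator of the coefficient of the `y`-th monomial of the `x`-th equation. -/
def den (x : Fin I.eqBits → Bool) (y : Fin I.monBits → Bool) : ℤ :=
  intAt (I.out x y) (I.coeffBits + 1) I.coeffBits

/-- The coefficient of the `y`-th monomial of the `x`-th equation. The list of monomials is padded
to length `2 ^ monBits` with entries whose coefficient is `0`. -/
def coeff (x : Fin I.eqBits → Bool) (y : Fin I.monBits → Bool) : ℚ :=
  (I.num x y : ℚ) / (I.den x y : ℚ)

/-- A factor of a monomial: a variable, or `1` if the degree is lower. -/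
noncomputable def factor {n : ℕ} : Option (Fin n → Bool) → MvPolynomial (Fin n → Bool) ℚ
  | some v => MvPolynomial.X v
  | none => 1

/-- The `y`-th monomial of the `x`-th equation: a coefficient and two optional variables. -/
noncomputable def monomial (x : Fin I.eqBits → Bool) (y : Fin I.monBits → Bool) :
    MvPolynomial (Fin I.varBits → Bool) ℚ :=
  MvPolynomial.C (I.coeff x y) *
    factor (optBitsAt (I.out x y) (2 * I.coeffBits + 2) I.varBits) *
    factor (optBitsAt (I.out x y) (2 * I.coeffBits + I.varBits + 3) I.varBits)

/-- The `x`-th polynomial: the sum of all monomials in its list. -/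
noncomputable def poly (x : Fin I.eqBits → Bool) : MvPolynomial (Fin I.varBits → Bool) ℚ :=
  ∑ y, I.monomial x y

/-- The circuit has inputs and outputs of the right format and no denominator is zero. -/
def WellFormed : Prop :=
  I.circuit.numInputs = I.eqBits + I.monBits ∧
  I.circuit.outputs.length = 2 * (I.coeffBits + 1) + 2 * (I.varBits + 1) ∧
  ∀ x y, I.den x y ≠ 0

/-- Each polynomial is of degree at most two and has at most four monomials, with coefficients
`1` or `-1`, both as a list of (nonzero) monomials and as a polynomial. -/
def FourMonomialsUnitCoeffs : Prop :=
  ∀ x,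
    (Finset.univ.filter fun y => I.coeff x y ≠ 0).card ≤ 4 ∧
    (∀ y, I.coeff x y ≠ 0 → I.coeff x y = 1 ∨ I.coeff x y = -1) ∧
    (I.poly x).totalDegree ≤ 2 ∧
    (I.poly x).support.card ≤ 4 ∧
    ∀ m ∈ (I.poly x).support,
      MvPolynomial.coeff m (I.poly x) = 1 ∨ MvPolynomial.coeff m (I.poly x) = -1

end QuadInstance

/-- `succQUAD`: the instances whose polynomials have a common real root. -/
def SuccQUAD : Set QuadInstance :=
  {I | I.WellFormed ∧
    ∃ z : (Fin I.varBits → Bool) → ℝ, ∀ x, MvPolynomial.aeval z (I.poly x) = 0}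

/-! ### Encodings as strings over a finite alphabet -/

/-- The alphabet for encodings of circuits. -/
inductive Sym where
  | tick
  | sep
  | tru
  | fls
  | not
  | and
  | or
  | fin
  deriving DecidableEq

instance : Fintype Sym where
  elems := {.tick, .sep, .tru, .fls, .not, .and, .or, .fin}
  complete s := by cases s <;> decide

/-- Unary encoding of a natural number. -/
def encodeNat (n : ℕ) : List Sym := List.replicate n .tick ++ [.sep]

/-- Encoding of a gate. -/
def encodeGate : Gate → List Sym
  | .const true => [.tru]
  | .const false => [.fls]
  | .not i => .not :: encodeNat i
  | .and i j => .and :: (encodeNat i ++ encodeNat j)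
  | .or i j => .or :: (encodeNat i ++ encodeNat j)

/-- Encoding of a circuit. Its length is polynomially related to the numbers of inputs, gates
and outputs. -/
def encodeCircuit (C : Circuit) : List Sym :=
  encodeNat C.numInputs ++ (C.gates.flatMap encodeGate ++ (.fin ::
    (C.outputs.flatMap encodeNat ++ [.fin])))

/-- Encoding of an instance of `succQUAD`. -/
def encodeQuad (I : QuadInstance) : List Sym :=
  encodeNat I.eqBits ++ (encodeNat I.monBits ++ (encodeNat I.coeffBits ++
    (encodeNat I.varBits ++ encodeCircuit I.circuit)))

theorem encodeNat_append_inj {m n : ℕ} {l l' : List Sym}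
    (h : encodeNat m ++ l = encodeNat n ++ l') : m = n ∧ l = l' := by
  induction m generalizing n with
  | zero => cases n <;> simp_all [encodeNat, List.replicate_succ]
  | succ m ih =>
    cases n with
    | zero => simp [encodeNat, List.replicate_succ] at h
    | succ n =>
      have h' : encodeNat m ++ l = encodeNat n ++ l' := by
        simpa [encodeNat, List.replicate_succ] using h
      simpa using ih h'

theorem encodeGate_append_inj {g g' : Gate} {l l' : List Sym}
    (h : encodeGate g ++ l = encodeGate g' ++ l') : g = g' ∧ l = l' := by
  rcases g with (_ | _) | i | ⟨i, j⟩ | ⟨i, j⟩ <;> rcases g' with (_ | _) | i' | ⟨i', j'⟩ | ⟨i', j'⟩ <;>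
    simp [encodeGate] at h ⊢
  all_goals first
    | exact h
    | exact encodeNat_append_inj h
    | (obtain ⟨h1, h2⟩ := encodeNat_append_inj h
       obtain ⟨h3, h4⟩ := encodeNat_append_inj h2
       exact ⟨⟨h1, h3⟩, h4⟩)

theorem encodeGates_append_inj {gs gs' : List Gate} {l l' : List Sym}
    (h : gs.flatMap encodeGate ++ Sym.fin :: l = gs'.flatMap encodeGate ++ Sym.fin :: l') :
    gs = gs' ∧ l = l' := by
  induction gs generalizing gs' with
  | nil =>
    cases gs' with
    | nil => simpa using h
    | cons g' gs' => rcases g' with (_ | _) | _ | _ | _ <;> simp [encodeGate] at h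
  | cons g gs ih =>
    cases gs' with
    | nil => rcases g with (_ | _) | _ | _ | _ <;> simp [encodeGate] at h
    | cons g' gs' =>
      simp only [List.flatMap_cons, List.append_assoc] at h
      obtain ⟨h1, h2⟩ := encodeGate_append_inj h
      obtain ⟨h3, h4⟩ := ih h2
      exact ⟨by rw [h1, h3], h4⟩

theorem encodeNats_append_inj {ns ns' : List ℕ} {l l' : List Sym}
    (h : ns.flatMap encodeNat ++ Sym.fin :: l = ns'.flatMap encodeNat ++ Sym.fin :: l') :
    ns = ns' ∧ l = l' := by
  induction ns generalizing ns' with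
  | nil =>
    cases ns' with
    | nil => simpa using h
    | cons n' ns' => cases n' <;> simp [encodeNat, List.replicate_succ] at h
  | cons n ns ih =>
    cases ns' with
    | nil => cases n <;> simp [encodeNat, List.replicate_succ] at h
    | cons n' ns' =>
      simp only [List.flatMap_cons, List.append_assoc] at h
      obtain ⟨h1, h2⟩ := encodeNat_append_inj h
      obtain ⟨h3, h4⟩ := ih h2
      exact ⟨by rw [h1, h3], h4⟩

theorem encodeCircuit_injective : Function.Injective encodeCircuit := by
  intro C C' h
  obtain ⟨h1, h2⟩ := encodeNat_append_inj h
  obtain ⟨h3, h4⟩ := encodeGates_append_inj h2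
  obtain ⟨h5, -⟩ := encodeNats_append_inj h4
  exact Circuit.ext h1 h3 h5

theorem encodeQuad_injective : Function.Injective encodeQuad := by
  intro I I' h
  obtain ⟨h1, h⟩ := encodeNat_append_inj h
  obtain ⟨h2, h⟩ := encodeNat_append_inj h
  obtain ⟨h3, h⟩ := encodeNat_append_inj h
  obtain ⟨h4, h⟩ := encodeNat_append_inj h
  exact QuadInstance.ext h1 h2 h3 h4 (encodeCircuit_injective h)

open Classical in
/-- An injective encoding function yields an encoding. -/
noncomputable def encodingOfInjective {α Γ : Type} (enc : α → List Γ)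
    (h : Function.Injective enc) : Computability.Encoding α Γ where
  encode := enc
  decode w := if hw : ∃ a, enc a = w then some hw.choose else none
  decode_encode a := by
    have hw : ∃ b, enc b = enc a := ⟨a, rfl⟩
    simp only [dif_pos hw]
    exact congrArg some (h hw.choose_spec)

/-- The string encoding of circuits. -/
noncomputable def circuitEncoding : Computability.Encoding Circuit Sym :=
  encodingOfInjective encodeCircuit encodeCircuit_injective

/-- The string encoding of instances of `succQUAD`. -/
noncomputable def quadEncoding : Computability.Encoding QuadInstance Sym :=
  encodingOfInjective encodeQuad encodeQuad_injective

/-! ### Polynomial-time reductions -/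

/-- `f` is a polynomial-time many-one reduction from the problem `A` to the problem `B`, for
instances encoded as strings over finite alphabets: `f` is computed by a multi-stack Turing machine
in time polynomial in the length of the encoding of the instance. -/
def IsPolyTimeReduction {α β Γ Δ : Type} [Fintype Γ] [Fintype Δ]
    (ea : Computability.Encoding α Γ) (eb : Computability.Encoding β Δ)
    (A : Set α) (B : Set β) (f : α → β) : Prop :=
  Nonempty (Turing.TM2ComputableInPolyTime ea.encode eb.encode f) ∧ ∀ a, a ∈ A ↔ f a ∈ B

end SuccReals

/-! The instance attaches sixteen real variables to every node `u` of the table and at most 32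
equations, numbered by a tag of five bits. The equations evaluate the formula and also check that
the table describes a formula at all, because circuits that encode nothing must become unsolvable
instances.

Evaluation. The variable `X` of a term node is its value; at a formula node `X = 0` implies truth.
The rules are `L - R` for `=`, `(R - L) * Y - 1` with `Y = Z²` for `<`, `L² + R²` for `∧` and `L *
R` for `∨`; the root gets `X = 0`. Every node has some value, true or not, so a false disjunct does
no harm.

Tree structure. A cyclic binary successor runs through all nodes. The variables `E`, reset to `0` at
the carry and otherwise growing by one, are forced to be the binary values of the nodes, so that
equality of nodes becomes equality of reals. The value `-1` stands for "no node". Then `P` and `E`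
check parent pointers, `(EL - ER) * W = 1` separates siblings, and `A * B = 0` says that a node is
one of the two children of its parent. Depths `H` grow by one along edges and exclude cycles; `T`
separates terms from formulas. Finally `S (succ u) - S u` is the indicator of a root minus the
indicator of the carry; summing over the cycle leaves exactly one root. The theorem
`exists_solves_iff` combines both directions. From a solution, a tree is built by induction on depth
(`System.exists_isAt`) and shown to contain all used nodes (`System.reachable`); from a true
sentence, `solution` gives the natural values.

Succinctness. A monomial only involves variables at one node: `u`, its successor, or a node named in
the description of `u`. Hence one evaluation of the given circuit suffices, and auxiliary families
such as `P`, `EL`, `ER` make data of a neighbour available one pointer further on. Each equation has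
at most four signed monomials, and two of equal sign never involve the same families
(`nodup_key_eqn`), so no coefficient can become `2` even if pointers coincide.

The new circuit consists of the old gates, a fixed control circuit that looks up the monomial, one
fixed block per bit position that selects a bit of the node and propagates the carry, and a fixed
output circuit. Wires are numbered backwards from the most recent one, so the old gates can be
copied symbol by symbol, and all new references are linear in a few counters.

Computability. Structured programs with counters are compiled to a multi-stack machine with exact
step counts (`Cmd.runs_code`). Every phase uses counters linear in the input length and quadratic
time (`Fast`). The fixed circuits are constants of the machine, so it is irrelevant how they are
chosen. -/

namespace SuccReals
open Turing

/-! ### A structured language for multi-stack machines -/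

/-- Structured programs over stacks of symbols. -/
inductive Cmd (K : Type) where
  | skip
  | push (k : K) (a : Sym)
  | pop (k : K)
  | move (k k' : K)
  | seq (c d : Cmd K)
  | ite (k : K) (p : Option Sym → Bool) (c d : Cmd K)
  | loop (k : K) (p : Option Sym → Bool) (c : Cmd K)

namespace Cmd

variable {K : Type} [DecidableEq K]

/-- `c.Runs S S' t`: the program `c` transforms the stacks `S` into `S'` in `t` steps. -/
inductive Runs : Cmd K → (K → List Sym) → (K → List Sym) → ℕ → Prop
  | skip (S) : Runs .skip S S 1
  | push (k a S) : Runs (.push k a) S (Function.update S k (a :: S k)) 1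
  | pop (k S) : Runs (.pop k) S (Function.update S k (S k).tail) 1
  | move (k k' S a l) (h : S k = a :: l) :
      Runs (.move k k') S
        (Function.update (Function.update S k l) k' (a :: Function.update S k l k')) 1
  | seq {c d S S' S'' t t'} (h : Runs c S S' t) (h' : Runs d S' S'' t') :
      Runs (.seq c d) S S'' (t + t')
  | iteTrue {k p c d S S' t} (hp : p (S k).head? = true) (h : Runs c S S' t) :
      Runs (.ite k p c d) S S' (t + 1)
  | iteFalse {k p c d S S' t} (hp : p (S k).head? = false) (h : Runs d S S' t) :
      Runs (.ite k p c d) S S' (t + 1)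
  | loopEnd {k p c S} (hp : p (S k).head? = false) : Runs (.loop k p c) S S 1
  | loopStep {k p c S S' S'' t t'} (hp : p (S k).head? = true) (h : Runs c S S' t)
      (h' : Runs (.loop k p c) S' S'' t') : Runs (.loop k p c) S S'' (t' + t + 1)

/-- The program points of a program. -/
def Pos : Cmd K → Type
  | skip | push _ _ | pop _ | move _ _ => Unit
  | seq c d => c.Pos ⊕ d.Pos
  | ite _ _ c d => Option (c.Pos ⊕ d.Pos)
  | loop _ _ c => Option c.Pos

/-- There are finitely many program points. -/
@[reducible]
def posFintype : (c : Cmd K) → Fintype c.Pos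
  | skip | push _ _ | pop _ | move _ _ => inferInstanceAs (Fintype Unit)
  | seq c d =>
    letI := c.posFintype
    letI := d.posFintype
    inferInstanceAs (Fintype (c.Pos ⊕ d.Pos))
  | ite _ _ c d =>
    letI := c.posFintype
    letI := d.posFintype
    inferInstanceAs (Fintype (Option (c.Pos ⊕ d.Pos)))
  | loop _ _ c =>
    letI := c.posFintype
    inferInstanceAs (Fintype (Option c.Pos))

/-- The program point at which the execution of a program starts. -/
def start : (c : Cmd K) → c.Pos
  | skip | push _ _ | pop _ | move _ _ => ()
  | seq c _ => Sum.inl c.start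
  | ite _ _ _ _ => none
  | loop _ _ _ => none

/-- The statements of machines over stacks of symbols that remember the last symbol read. -/
abbrev MStmt (K Λ : Type) : Type := TM2.Stmt (fun _ : K => Sym) Λ (Option Sym)

/-- The machine code of a program whose program points are embedded into the labels by `e` and
which continues with the statement `x`. -/
def code {Λ : Type} : (c : Cmd K) → (c.Pos → Λ) → MStmt K Λ → c.Pos → MStmt K Λ
  | skip, _, x => fun _ => x
  | push k a, _, x => fun _ => .push k (fun _ => a) x
  | pop k, _, x => fun _ => .pop k (fun v _ => v) x
  | move k k', _, x => fun _ => .pop k (fun _ s => s) (.push k' (fun v => v.getD .tick) x)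
  | seq c d, e, x =>
    Sum.elim (c.code (fun q => e (Sum.inl q)) (.goto fun _ => e (Sum.inr d.start)))
      (d.code (fun q => e (Sum.inr q)) x)
  | ite k p c d, e, x => fun q => match q with
    | none => .peek k (fun _ s => s) (.branch p (.goto fun _ => e (some (Sum.inl c.start)))
        (.goto fun _ => e (some (Sum.inr d.start))))
    | some (Sum.inl q) => c.code (fun q => e (some (Sum.inl q))) x q
    | some (Sum.inr q) => d.code (fun q => e (some (Sum.inr q))) x q
  | loop k p c, e, x => fun q => match q with
    | none => .peek k (fun _ s => s) (.branch p (.goto fun _ => e (some c.start)) x)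
    | some q => c.code (fun q => e (some q)) (.goto fun _ => e none) q

/-- The continuation `x` is executed inside the last machine step of the program, so sequencing
costs no additional step and the count `t` is exact. The register value is left open, because every
test reads its stack afresh. -/
theorem runs_code {Λ : Type} (m : Λ → MStmt K Λ) {c : Cmd K} {S S' : K → List Sym} {t : ℕ}
    (h : Runs c S S' t) (e : c.Pos → Λ) (x : MStmt K Λ) (hm : ∀ q, m (e q) = c.code e x q)
    (v : Option Sym) :
    ∃ v', (flip bind (TM2.step m))^[t] (some ⟨some (e c.start), v, S⟩) =
      some (TM2.stepAux x v' S') := by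
  induction h generalizing x v with
  | skip S => exact ⟨v, by simp [flip, hm, code]⟩
  | push k a S => exact ⟨v, by simp [flip, hm, code]⟩
  | pop k S => exact ⟨v, by simp [flip, hm, code]⟩
  | move k k' S a l h => exact ⟨some a, by simp [flip, hm, code, h]⟩
  | @seq c d S S' S'' t t' h h' ih ih' =>
    obtain ⟨v1, h1⟩ := ih (fun q => e (Sum.inl q)) (.goto fun _ => e (Sum.inr d.start))
      (fun q => hm (Sum.inl q)) v
    obtain ⟨v2, h2⟩ := ih' (fun q => e (Sum.inr q)) x (fun q => hm (Sum.inr q)) v1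
    refine ⟨v2, ?_⟩
    -- Iteration of a sum applies the second summand first, so the steps of `c` have to stand there.
    rw [add_comm, Function.iterate_add_apply]
    simp only [start]
    rw [h1]
    exact h2
  | @iteTrue k p c d S S' t hp h ih =>
    obtain ⟨v1, h1⟩ := ih (fun q => e (some (Sum.inl q))) x (fun q => hm (some (Sum.inl q)))
      (S k).head?
    refine ⟨v1, ?_⟩
    rw [Function.iterate_add_apply, ← h1]
    have := hm none
    simp only [code] at this
    simp [flip, start, this, hp]
  | @iteFalse k p c d S S' t hp h ih =>
    obtain ⟨v1, h1⟩ := ih (fun q => e (some (Sum.inr q))) x (fun q => hm (some (Sum.inr q)))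
      (S k).head?
    refine ⟨v1, ?_⟩
    rw [Function.iterate_add_apply, ← h1]
    have := hm none
    simp only [code] at this
    simp [flip, start, this, hp]
  | @loopEnd k p c S hp =>
    refine ⟨(S k).head?, ?_⟩
    have := hm none
    simp only [code] at this
    simp [flip, start, this, hp]
  | @loopStep k p c S S' S'' t t' hp h h' ih ih' =>
    obtain ⟨v1, h1⟩ := ih (fun q => e (some q)) (.goto fun _ => e none) (fun q => hm (some q))
      (S k).head?
    obtain ⟨v2, h2⟩ := ih' e x hm v1
    refine ⟨v2, ?_⟩
    rw [add_assoc, Function.iterate_add_apply, ← h2, Function.iterate_add_apply]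
    have := hm none
    simp only [code] at this
    congr 1
    rw [start.eq_7]
    simp only [Function.iterate_one, flip, Option.bind_eq_bind, Option.bind_some, TM2.step, this,
      TM2.stepAux, hp, cond_true] at h1 ⊢
    exact h1

/-- The machine that runs a program and halts. -/
def machine [Fintype K] (c : Cmd K) (i o : K) : FinTM2 where
  K := K
  k₀ := i
  k₁ := o
  Γ _ := Sym
  Λ := c.Pos
  main := c.start
  ΛFin := c.posFintype
  σ := Option Sym
  initialState := none
  Γk₀Fin := inferInstanceAs (Fintype Sym)
  m := c.code id (.load (fun _ => none) .halt)

/-- A stack assignment with a single nonempty stack. -/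
def single (k : K) (w : List Sym) : K → List Sym := fun k' => if k' = k then w else []

theorem machine_outputs [Fintype K] (c : Cmd K) (i o : K) {w w' : List Sym} {t T : ℕ} (hT : t ≤ T)
    (h : Runs c (single i w) (single o w') t) :
    Nonempty (TM2OutputsInTime (c.machine i o) w (some w') T) := by
  -- The final `load` resets the register, since `haltList` demands the initial register value.
  obtain ⟨v, hv⟩ := runs_code (c.code id (.load (fun _ => none) .halt)) h id _ (fun _ => rfl) none
  have h1 : initList (c.machine i o) w = ⟨some c.start, none, single i w⟩ := by
    unfold initList
    congr 1
  have h2 : haltList (c.machine i o) w' = ⟨none, none, single o w'⟩ := by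
    unfold haltList
    congr 1
  refine ⟨⟨⟨t, ?_⟩, hT⟩⟩
  rw [h1]
  exact hv.trans (congrArg some h2.symm)

/-- A problem transformation computed by a program in polynomial time. -/
theorem computableInPolyTime [Fintype K] (c : Cmd K) (i o : K) {α β : Type} {ea : α → List Sym}
    {eb : β → List Sym} {f : α → β} (p : Polynomial ℕ)
    (h : ∀ a, ∃ t ≤ p.eval (ea a).length, Runs c (single i (ea a)) (single o (eb (f a))) t) :
    Nonempty (TM2ComputableInPolyTime ea eb f) := by
  have e : ∀ w : List Sym, List.map (Equiv.refl Sym).invFun w = w := fun w => List.map_id w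
  have h' : ∀ a, ∀ w w' : List Sym, w = ea a → w' = eb (f a) →
      Nonempty (TM2OutputsInTime (c.machine i o) w (some w') (p.eval (ea a).length)) := by
    rintro a _ _ rfl rfl
    obtain ⟨_, hT, hr⟩ := h a
    exact machine_outputs c i o hT hr
  exact ⟨{ tm := c.machine i o
           inputAlphabet := Equiv.refl Sym
           outputAlphabet := Equiv.refl Sym
           time := p
           outputsFun := fun a => (h' a _ _ (e _) (e _)).some }⟩

/-! ### Running times up to an upper bound -/

/-- `c.Within S S' T`: the program `c` transforms the stacks `S` into `S'` in at most `T` steps. -/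
def Within (c : Cmd K) (S S' : K → List Sym) (T : ℕ) : Prop := ∃ t ≤ T, Runs c S S' t

theorem Within.mono {c : Cmd K} {S S' : K → List Sym} {T T' : ℕ} (h : Within c S S' T)
    (hT : T ≤ T') : Within c S S' T' :=
  let ⟨t, ht, hr⟩ := h
  ⟨t, ht.trans hT, hr⟩

theorem Within.seq {c d : Cmd K} {S S' S'' : K → List Sym} {T T' : ℕ} (h : Within c S S' T)
    (h' : Within d S' S'' T') : Within (c.seq d) S S'' (T + T') :=
  let ⟨_, ht, hr⟩ := h
  let ⟨_, ht', hr'⟩ := h'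
  ⟨_, add_le_add ht ht', hr.seq hr'⟩

theorem Within.iteTrue {k : K} {p : Option Sym → Bool} {c d : Cmd K} {S S' : K → List Sym} {T : ℕ}
    (hp : p (S k).head? = true) (h : Within c S S' T) : Within (.ite k p c d) S S' (T + 1) :=
  let ⟨_, ht, hr⟩ := h
  ⟨_, Nat.succ_le_succ ht, hr.iteTrue hp⟩

theorem Within.iteFalse {k : K} {p : Option Sym → Bool} {c d : Cmd K} {S S' : K → List Sym} {T : ℕ}
    (hp : p (S k).head? = false) (h : Within d S S' T) : Within (.ite k p c d) S S' (T + 1) :=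
  let ⟨_, ht, hr⟩ := h
  ⟨_, Nat.succ_le_succ ht, hr.iteFalse hp⟩

/-- The invariant of the loop is a sequence of complete configurations; each round pays one step for
its test, and the failing test pays the last one. -/
theorem Within.loop {k : K} {p : Option Sym → Bool} {c : Cmd K} (n : ℕ) (S : ℕ → K → List Sym)
    {B : ℕ} (hp : ∀ i < n, p (S i k).head? = true) (hn : p (S n k).head? = false)
    (h : ∀ i < n, Within c (S i) (S (i + 1)) B) :
    Within (.loop k p c) (S 0) (S n) (n * (B + 1) + 1) := by
  induction n generalizing S with
  | zero => exact ⟨1, by omega, .loopEnd hn⟩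
  | succ n ih =>
    obtain ⟨t, ht, hr⟩ := ih (fun i => S (i + 1)) (fun i hi => hp _ (by omega)) hn
      (fun i hi => h _ (by omega))
    obtain ⟨t', ht', hr'⟩ := h 0 (by omega)
    exact ⟨_, by rw [Nat.succ_mul]; omega, .loopStep (hp 0 (by omega)) hr' hr⟩

end Cmd
end SuccReals

namespace SuccReals

/-! ### Running straight-line programs -/

/-- The value of a wire. -/
def look (w : List Bool) (i : ℕ) : Bool := w.getD i false

@[simp] theorem look_cons_zero (b : Bool) (w : List Bool) : look (b :: w) 0 = b := rfl

@[simp] theorem look_cons_succ (b : Bool) (w : List Bool) (i : ℕ) :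
    look (b :: w) (i + 1) = look w i := rfl

theorem runGates_append (w : List Bool) (gs hs : List Gate) :
    runGates w (gs ++ hs) = runGates (runGates w gs) hs := by
  induction gs generalizing w with
  | nil => rfl
  | cons g gs ih => exact ih _

/-- With backward numbering, a program merely shifts all older wires by its length. All later
address computations rest on this. -/
theorem look_runGates_add (w : List Bool) (gs : List Gate) (i : ℕ) :
    look (runGates w gs) (gs.length + i) = look w i := by
  induction gs generalizing w i with
  | nil => simp [runGates]
  | cons g gs ih =>
    have := ih (g.eval w :: w) (i + 1)
    rw [List.length_cons, show gs.length + 1 + i = gs.length + (i + 1) by omega]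
    exact this

theorem length_runGates (w : List Bool) (gs : List Gate) :
    (runGates w gs).length = w.length + gs.length := by
  induction gs generalizing w with
  | nil => rfl
  | cons g gs ih =>
    rw [runGates, ih, List.length_cons, List.length_cons]
    omega

theorem gatesWellFormed_append (n : ℕ) (gs hs : List Gate) :
    GatesWellFormed n (gs ++ hs) ↔
      GatesWellFormed n gs ∧ GatesWellFormed (n + gs.length) hs := by
  induction gs generalizing n with
  | nil => simp [GatesWellFormed]
  | cons g gs ih =>
    simp only [List.cons_append, GatesWellFormed, ih, List.length_cons, and_assoc,
      show n + 1 + gs.length = n + (gs.length + 1) by omega]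

theorem Gate.WellFormed.mono {g : Gate} {n m : ℕ} (h : g.WellFormed n) (hnm : n ≤ m) :
    g.WellFormed m := by
  cases g with
  | const => trivial
  | not i => exact lt_of_lt_of_le h hnm
  | and i j => exact ⟨h.1.trans_le hnm, h.2.trans_le hnm⟩
  | or i j => exact ⟨h.1.trans_le hnm, h.2.trans_le hnm⟩

theorem GatesWellFormed.mono {gs : List Gate} {n m : ℕ} (h : GatesWellFormed n gs) (hnm : n ≤ m) :
    GatesWellFormed m gs := by
  induction gs generalizing n m with
  | nil => trivial
  | cons g gs ih => exact ⟨h.1.mono hnm, ih h.2 (by omega)⟩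

/-- Additional wires below do not influence a well-formed program. -/
theorem runGates_append_left {gs : List Gate} {w : List Bool} (h : GatesWellFormed w.length gs)
    (z : List Bool) : runGates (w ++ z) gs = runGates w gs ++ z := by
  induction gs generalizing w with
  | nil => rfl
  | cons g gs ih =>
    have hg : g.eval (w ++ z) = g.eval w := by
      have key : ∀ i < w.length, (w ++ z).getD i false = w.getD i false := fun i hi => by
        rw [List.getD_append _ _ _ _ hi]
      cases g with
      | const b => rfl
      | not i => simp only [Gate.eval, key i h.1]
      | and i j => simp only [Gate.eval, key i h.1.1, key j h.1.2]
      | or i j => simp only [Gate.eval, key i h.1.1, key j h.1.2]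
    rw [runGates, hg]
    exact ih (w := g.eval w :: w) h.2

/-! ### Synthesis of straight-line programs -/

/-- Boolean expressions. -/
inductive BExp where
  | var (i : ℕ)
  | const (b : Bool)
  | not (e : BExp)
  | and (e f : BExp)
  | or (e f : BExp)

namespace BExp

/-- The value of an expression. -/
def eval (s : ℕ → Bool) : BExp → Bool
  | var i => s i
  | const b => b
  | not e => !e.eval s
  | and e f => e.eval s && f.eval s
  | or e f => e.eval s || f.eval s

/-- All variables of the expression are among the first `n`. -/
def Bounded (n : ℕ) : BExp → Prop
  | var i => i < n
  | const _ => True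
  | not e => e.Bounded n
  | and e f => e.Bounded n ∧ f.Bounded n
  | or e f => e.Bounded n ∧ f.Bounded n

/-- The number of gates of an expression. -/
def size : BExp → ℕ
  | var _ => 1
  | const _ => 1
  | not e => e.size + 1
  | and e f => e.size + f.size + 1
  | or e f => e.size + f.size + 1

/-- Gates computing an expression whose variable `i` is the wire `off + i`. -/
def gates : BExp → ℕ → List Gate
  | var i, off => [.or (off + i) (off + i)]
  | const b, _ => [.const b]
  | not e, off => e.gates off ++ [.not 0]
  | and e f, off => e.gates off ++ (f.gates (off + e.size) ++ [.and 0 f.size])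
  | or e f, off => e.gates off ++ (f.gates (off + e.size) ++ [.or 0 f.size])

theorem size_pos (e : BExp) : 0 < e.size := by cases e <;> simp [size]

@[simp] theorem length_gates (e : BExp) (off : ℕ) : (e.gates off).length = e.size := by
  induction e generalizing off <;> simp [gates, size, *] <;> omega

theorem look_gates (e : BExp) (off : ℕ) (w : List Bool) :
    look (runGates w (e.gates off)) 0 = e.eval fun i => look w (off + i) := by
  induction e generalizing off w with
  | var i => simp [gates, runGates, Gate.eval, eval, look]
  | const b => simp [gates, runGates, Gate.eval, eval]
  | not e ih => 
    rw [gates, runGates_append, eval, ← ih]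
    rfl
  | and e f ihe ihf =>
    have h1 : ∀ i, look (runGates w (e.gates off)) (off + e.size + i) = look w (off + i) := by
      intro i
      rw [show off + e.size + i = (e.gates off).length + (off + i) by rw [length_gates]; omega,
        look_runGates_add]
    -- The result of `e` was the most recent wire and now lies below the gates of `f`, hence the
    -- reference `f.size` in the last gate.
    have h2 : look (runGates (runGates w (e.gates off)) (f.gates (off + e.size))) f.size =
        look (runGates w (e.gates off)) 0 := by
      rw [← look_runGates_add (runGates w (e.gates off)) (f.gates (off + e.size)) 0,
        length_gates, add_zero]
    have h3 := ihf (off + e.size) (runGates w (e.gates off))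
    simp only [h1] at h3
    rw [gates, runGates_append, runGates_append, eval, ← ihe, ← h3, ← h2, Bool.and_comm]
    rfl
  | or e f ihe ihf =>
    have h1 : ∀ i, look (runGates w (e.gates off)) (off + e.size + i) = look w (off + i) := by
      intro i
      rw [show off + e.size + i = (e.gates off).length + (off + i) by rw [length_gates]; omega,
        look_runGates_add]
    have h2 : look (runGates (runGates w (e.gates off)) (f.gates (off + e.size))) f.size =
        look (runGates w (e.gates off)) 0 := by
      rw [← look_runGates_add (runGates w (e.gates off)) (f.gates (off + e.size)) 0,
        length_gates, add_zero]
    have h3 := ihf (off + e.size) (runGates w (e.gates off))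
    simp only [h1] at h3
    rw [gates, runGates_append, runGates_append, eval, ← ihe, ← h3, ← h2, Bool.or_comm]
    rfl

theorem gates_wf {e : BExp} {n : ℕ} (he : e.Bounded n) {off m : ℕ} (hm : off + n ≤ m) :
    GatesWellFormed m (e.gates off) := by
  induction e generalizing off m with
  | var i =>
    have : i < n := he
    exact ⟨⟨by omega, by omega⟩, trivial⟩
  | const b => exact ⟨trivial, trivial⟩
  | not e ih =>
    have := e.size_pos
    exact (gatesWellFormed_append _ _ _).2 ⟨ih he hm, by rw [length_gates]; change 0 < _; omega,
      trivial⟩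
  | and e f ihe ihf =>
    have := e.size_pos
    refine (gatesWellFormed_append _ _ _).2 ⟨ihe he.1 hm, (gatesWellFormed_append _ _ _).2
      ⟨ihf he.2 (by rw [length_gates]; omega), ⟨?_, ?_⟩, trivial⟩⟩ <;> simp only [length_gates] <;>
      omega
  | or e f ihe ihf =>
    have := e.size_pos
    refine (gatesWellFormed_append _ _ _).2 ⟨ihe he.1 hm, (gatesWellFormed_append _ _ _).2
      ⟨ihf he.2 (by rw [length_gates]; omega), ⟨?_, ?_⟩, trivial⟩⟩ <;> simp only [length_gates] <;>
      omega

/-- An expression for a given Boolean function of the variables `i, …, i + n - 1`. -/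
def ofFun : (n : ℕ) → ((Fin n → Bool) → Bool) → ℕ → BExp
  | 0, f, _ => const (f Fin.elim0)
  | n + 1, f, i =>
    or (and (var i) (ofFun n (fun v => f (Fin.cons true v)) (i + 1)))
      (and (not (var i)) (ofFun n (fun v => f (Fin.cons false v)) (i + 1)))

/-- Shannon expansion with respect to the first variable. The exponential size does not matter, as
only fixed functions of at most 23 bits are synthesized. -/
theorem eval_ofFun (n : ℕ) (f : (Fin n → Bool) → Bool) (i : ℕ) (s : ℕ → Bool) :
    (ofFun n f i).eval s = f fun j => s (i + j) := by
  induction n generalizing i with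
  | zero => exact congrArg f (funext fun j => j.elim0)
  | succ n ih =>
    have h : (fun j : Fin (n + 1) => s (i + j)) =
        (Fin.cons (s i) fun j : Fin n => s (i + 1 + j) : Fin (n + 1) → Bool) := by
      funext j
      refine Fin.cases ?_ (fun j => ?_) j
      · simp
      · simp [show i + (↑j + 1) = i + 1 + j by omega]
    rw [h]
    simp only [ofFun, eval, ih]
    cases s i <;> simp

theorem bounded_ofFun (n : ℕ) (f : (Fin n → Bool) → Bool) (i m : ℕ) (h : i + n ≤ m) :
    (ofFun n f i).Bounded m := by
  induction n generalizing i with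
  | zero => trivial
  | succ n ih =>
    exact ⟨⟨by change i < m; omega, ih _ _ (by omega)⟩, by change i < m; omega, ih _ _ (by omega)⟩

/-- Gates computing several expressions one after the other. -/
def seqGates : List BExp → ℕ → List Gate
  | [], _ => []
  | e :: es, off => e.gates off ++ seqGates es (off + e.size)

/-- The number of gates of several expressions. -/
def sizes (es : List BExp) : ℕ := (es.map size).sum

/-- The wires that carry the values of several expressions, relative to the end of the program. -/
def positions : List BExp → List ℕ
  | [] => []
  | _ :: es => sizes es :: positions es

@[simp] theorem length_positions (es : List BExp) : (positions es).length = es.length := by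
  induction es <;> simp [positions, *]

@[simp] theorem length_seqGates (es : List BExp) (off : ℕ) :
    (seqGates es off).length = sizes es := by
  induction es generalizing off <;> simp [seqGates, sizes, *]

theorem look_seqGates (es : List BExp) (off : ℕ) (w : List Bool) (j : ℕ) (hj : j < es.length) :
    look (runGates w (seqGates es off)) ((positions es).getD j 0) =
      es[j].eval fun i => look w (off + i) := by
  induction es generalizing off w j with
  | nil => simp at hj
  | cons e es ih =>
    rw [seqGates, runGates_append]
    cases j with
    | zero =>
      have := look_runGates_add (runGates w (e.gates off)) (seqGates es (off + e.size)) 0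
      rw [length_seqGates, add_zero, look_gates] at this
      exact this
    | succ j =>
      have := ih (off + e.size) (runGates w (e.gates off)) j (by simpa using hj)
      refine this.trans ?_
      rw [List.getElem_cons_succ]
      congr 1
      funext i
      rw [show off + e.size + i = (e.gates off).length + (off + i) by rw [length_gates]; omega,
        look_runGates_add]

theorem seqGates_wf {es : List BExp} {n : ℕ} (he : ∀ e ∈ es, e.Bounded n) {off m : ℕ}
    (hm : off + n ≤ m) : GatesWellFormed m (seqGates es off) := by
  induction es generalizing off m with
  | nil => trivial
  | cons e es ih =>
    exact (gatesWellFormed_append _ _ _).2 ⟨gates_wf (he e (by simp)) hm,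
      ih (fun e' h => he e' (by simp [h])) (by rw [length_gates]; omega)⟩

theorem positions_lt (es : List BExp) : ∀ q ∈ positions es, q < sizes es := by
  induction es with
  | nil => simp [positions]
  | cons e es ih =>
    have := e.size_pos
    simp only [positions, List.mem_cons, forall_eq_or_imp, sizes, List.map_cons, List.sum_cons]
    exact ⟨by omega, fun q hq => (ih q hq).trans_le (by simp [sizes])⟩

end BExp

/-- Gates copying the given wires. -/
def gather : List ℕ → List Gate
  | [] => []
  | q :: qs => gather qs ++ [.or (q + qs.length) (q + qs.length)]

@[simp] theorem length_gather (qs : List ℕ) : (gather qs).length = qs.length := by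
  induction qs <;> simp [gather, *]

theorem look_gather (qs : List ℕ) (w : List Bool) (j : ℕ) (hj : j < qs.length) :
    look (runGates w (gather qs)) j = look w (qs.getD j 0) := by
  induction qs generalizing j with
  | nil => simp at hj
  | cons q qs ih =>
    rw [gather, runGates_append, runGates, runGates]
    cases j with
    | zero =>
      have := look_runGates_add w (gather qs) q
      rw [length_gather, add_comm] at this
      simp only [look_cons_zero, Gate.eval, Bool.or_self, List.getD_cons_zero]
      exact this
    | succ j => exact ih j (by simpa using hj)

theorem gather_wf {qs : List ℕ} {m : ℕ} (h : ∀ q ∈ qs, q < m) : GatesWellFormed m (gather qs) := by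
  induction qs with
  | nil => trivial
  | cons q qs ih =>
    have := h q (by simp)
    exact (gatesWellFormed_append _ _ _).2 ⟨ih fun q' hq => h q' (by simp [hq]),
      ⟨by rw [length_gather]; omega, by rw [length_gather]; omega⟩, trivial⟩

/-- The outputs are computed one after the other, which scatters the results among intermediate
wires; `gather` then copies them into adjacent positions. -/
theorem exists_synth {a b : ℕ} (F : (Fin a → Bool) → Fin b → Bool) :
    ∃ gs : List Gate, (∀ (w : List Bool) (j : Fin b),
      look (runGates w gs) j = F (fun i => look w i) j) ∧ ∀ m, a ≤ m → GatesWellFormed m gs := by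
  refine ⟨BExp.seqGates (List.ofFn fun j => BExp.ofFun a (fun v => F v j) 0) 0 ++
    gather (BExp.positions (List.ofFn fun j => BExp.ofFun a (fun v => F v j) 0)), fun w j => ?_,
    fun m hm => (gatesWellFormed_append _ _ _).2 ⟨BExp.seqGates_wf (n := a) ?_ (by omega),
      gather_wf fun q hq => ?_⟩⟩
  · rw [runGates_append, look_gather _ _ _ (by simp), BExp.look_seqGates _ _ _ _ (by simp)]
    simp [BExp.eval_ofFun]
  · simp only [List.mem_ofFn, forall_exists_index, forall_apply_eq_imp_iff]
    exact fun j => BExp.bounded_ofFun _ _ _ _ (by omega)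
  · have := BExp.positions_lt _ q hq
    rw [BExp.length_seqGates]
    omega

/-- Gates computing the function `F` of the `a` most recent wires; the `b` results are the most
recent wires afterwards. -/
noncomputable def synth {a b : ℕ} (F : (Fin a → Bool) → Fin b → Bool) : List Gate :=
  (exists_synth F).choose

theorem look_synth {a b : ℕ} (F : (Fin a → Bool) → Fin b → Bool) (w : List Bool) (j : Fin b) :
    look (runGates w (synth F)) j = F (fun i => look w i) j :=
  (exists_synth F).choose_spec.1 w j

theorem synth_wf {a b : ℕ} (F : (Fin a → Bool) → Fin b → Bool) {m : ℕ} (hm : a ≤ m) :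
    GatesWellFormed m (synth F) :=
  (exists_synth F).choose_spec.2 m hm

/-- Gates negating the given wires one after the other; wires are named relative to the start. -/
def nots : List ℕ → ℕ → List Gate
  | [], _ => []
  | q :: qs, r => .not (q + r) :: nots qs (r + 1)

@[simp] theorem length_nots (qs : List ℕ) (r : ℕ) : (nots qs r).length = qs.length := by
  induction qs generalizing r <;> simp [nots, *]

/-- Negation serves as a copying gate with a single reference: a machine can write it while it
consumes that reference from its input. The last gate is the most recent wire, so the list appears
in reverse order. -/
theorem look_nots (qs : List ℕ) (r : ℕ) (w : List Bool) (j : ℕ) (hj : j < qs.length) :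
    look (runGates w (nots qs r)) (qs.length - 1 - j) = !look w (qs.getD j 0 + r) := by
  induction qs generalizing r w j with
  | nil => simp at hj
  | cons q qs ih =>
    cases j with
    | zero =>
      have := look_runGates_add (Gate.eval w (.not (q + r)) :: w) (nots qs (r + 1)) 0
      rw [length_nots] at this
      simpa [Gate.eval, look, nots, runGates] using this
    | succ j =>
      have := ih (r + 1) (Gate.eval w (.not (q + r)) :: w) j (by simpa using hj)
      rw [List.length_cons, show qs.length + 1 - 1 - (j + 1) = qs.length - 1 - j by omega]
      refine this.trans ?_
      rw [← add_assoc, look_cons_succ]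
      rfl

theorem nots_wf {qs : List ℕ} {r m : ℕ} (h : ∀ q ∈ qs, q + r < m) :
    GatesWellFormed m (nots qs r) := by
  induction qs generalizing r m with
  | nil => trivial
  | cons q qs ih =>
    exact ⟨h q (by simp), ih fun q' hq => by have := h q' (by simp [hq]); omega⟩

end SuccReals

namespace SuccReals

/-! ### The equations of the reduction -/

/-- The families of real variables, each indexed by the nodes: variables of the sentence (`V`),
values of nodes and of their children (`X`, `L`, `R`), auxiliary variables for strict inequalities
(`Y`, `Z`), sorts (`T`), an enumeration of the nodes (`E`), partial counts of the roots (`S`), the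
enumeration at the parent (`P`), depths (`H`), the enumeration at the children (`EL`, `ER`),
witnesses for distinct children (`W`) and the distance of a node from the children of its parent
(`A`, `B`). -/
inductive Kind where
  | V | X | L | R | Y | Z | T | E | S | P | H | EL | ER | W | A | B

namespace Kind

/-- The number of a family of variables. -/
def code : Kind → Fin 16
  | V => 0 | X => 1 | L => 2 | R => 3 | Y => 4 | Z => 5 | T => 6 | E => 7 | S => 8 | P => 9
  | H => 10 | EL => 11 | ER => 12 | W => 13 | A => 14 | B => 15

/-- The binary code of a family of variables. -/
def bits (k : Kind) : List Bool :=
  List.ofFn fun i : Fin 4 => (k.code : ℕ).testBit i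

end Kind

/-- The nodes that a variable may be attached to, relative to a given node. -/
inductive Sel where
  | self | succ | var | par | left | right

namespace Sel

/-- The binary code of a selector. -/
def bits : Sel → List Bool
  | self => [false, false, false]
  | succ => [true, false, false]
  | var => [false, true, false]
  | par => [true, true, false]
  | left => [false, false, true]
  | right => [true, false, true]

end Sel

/-- A signed monomial. A guard `some b` means that the monomial is only present at nodes where the
binary successor has a carry (`b = true`) or no carry (`b = false`). -/
structure Entry where
  neg : Bool
  guard : Option Bool
  sel : Sel
  k1 : Option Kind
  k2 : Option Kind

namespace Entry

/-- Whether the monomial is present, depending on the carry. -/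
def present (e : Entry) (c : Bool) : Bool :=
  match e.guard with
  | none => true
  | some b => c == b

/-- A constant. -/
abbrev const (neg : Bool) : Entry := ⟨neg, none, .self, none, none⟩

/-- A variable. -/
abbrev lin (neg : Bool) (k : Kind) (s : Sel) : Entry := ⟨neg, none, s, some k, none⟩

/-- A product of two variables attached to the given node. -/
abbrev quad (neg : Bool) (k k' : Kind) : Entry := ⟨neg, none, .self, some k, some k'⟩

end Entry

/-- The codes of labels without children. -/
def leafCode (c : ℕ) : Bool := c == 1 || c == 2 || c == 3

/-- The codes of labels of formulas in normal form. -/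
def formCode (c : ℕ) : Bool := c == 6 || c == 7 || c == 9 || c == 10

/-- The codes of connectives. -/
def connCode (c : ℕ) : Bool := c == 9 || c == 10

/-- The codes of labels with two children. -/
def binCode (c : ℕ) : Bool := c == 4 || c == 5 || formCode c

/-- The codes of labels of nodes in use. -/
def usedCode (c : ℕ) : Bool := leafCode c || binCode c

/-- Local validity of a node; the last three arguments tell whether there is a parent, a left child
and a right child. -/
def validNode (c : ℕ) (fp fl fr : Bool) : Bool :=
  c == 0 || (leafCode c && fp && !fl && !fr) || (binCode c && fl && fr && (fp || formCode c))

open Entry Kind in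
/-- The equation with the given number at a node with the given label code, where the last three
arguments tell whether there is a parent, a left child and a right child. -/
def eqn (tag c : ℕ) (fp fl fr : Bool) : List Entry :=
  match tag with
  | 0 => if validNode c fp fl fr then [] else [const false]
  | 1 => match c with
    | 1 => [lin false X .self]
    | 2 => [lin false X .self, const true]
    | 3 => [lin false X .self, lin true V .var]
    | 4 => [lin false X .self, lin true L .self, lin true R .self]
    | 5 => [lin false X .self, quad true L R]
    | 6 => [lin false X .self, lin true L .self, lin false R .self]
    | 7 => [lin false X .self, quad true R Y, quad false L Y, const false]
    | 9 => [lin false X .self, quad true L L, quad true R R]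
    | 10 => [lin false X .self, quad true L R]
    | _ => []
  | 2 => [lin false Y .self, quad true Z Z]
  | 3 => if binCode c then [lin false L .self, lin true X .left] else []
  | 4 => if binCode c then [lin false R .self, lin true X .right] else []
  | 5 => if usedCode c && !fp then [lin false X .self] else []
  | 6 => if formCode c then [lin false T .self, const true] else [lin false T .self]
  | 7 => if connCode c then [lin false T .left, const true] else
      if binCode c then [lin false T .left] else []
  | 8 => if connCode c then [lin false T .right, const true] else
      if binCode c then [lin false T .right] else []
  | 9 => [lin false E .succ, ⟨true, some false, .self, some E, none⟩,
      ⟨true, some false, .self, none, none⟩]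
  | 10 => if usedCode c && !fp then
      [lin false S .succ, lin true S .self, const true, ⟨false, some true, .self, none, none⟩] else
      [lin false S .succ, lin true S .self, ⟨false, some true, .self, none, none⟩]
  | 11 => if usedCode c && fp then [lin false P .self, lin true E .par] else
      [lin false P .self, const false]
  | 12 => if binCode c then [lin false P .left, lin true E .self] else []
  | 13 => if binCode c then [lin false P .right, lin true E .self] else []
  | 14 => if usedCode c && fp then [lin false H .self, lin true H .par, const true] else []
  | 15 => if binCode c then [lin false EL .self, lin true E .left] else
      [lin false EL .self, const false]
  | 16 => if binCode c then [lin false ER .self, lin true E .right] else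
      [lin false ER .self, const false]
  | 17 => if binCode c then [quad false EL W, quad true ER W, const true] else []
  | 18 => if usedCode c && fp then [lin false A .self, lin true E .self, lin false EL .par] else []
  | 19 => if usedCode c && fp then [lin false B .self, lin true E .self, lin false ER .par] else []
  | 20 => if usedCode c && fp then [quad false A B] else []
  | _ => []

/-- The contents of a node description, before its decoding. -/
structure Raw (V : Type) where
  code : ℕ
  fp : Bool
  fl : Bool
  fr : Bool
  var : V
  par : V
  left : V
  right : V

/-- The node description of given contents. -/
def Raw.toNode {V : Type} (r : Raw V) : Node V where
  label := decodeLabel r.code r.var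
  parent := if r.fp then some r.par else none
  left := if r.fl then some r.left else none
  right := if r.fr then some r.right else none

/-- The contents of the node description stored in a string. -/
def rawNode (n : ℕ) (s : List Bool) : Raw (Fin n → Bool) where
  code := Nat.ofBits (bitsAt s 0 4)
  fp := look s (n + 4)
  fl := look s (2 * n + 5)
  fr := look s (3 * n + 6)
  var := bitsAt s 4 n
  par := bitsAt s (n + 5) n
  left := bitsAt s (2 * n + 6) n
  right := bitsAt s (3 * n + 7) n

/-- The node selected by a selector at a node `u` with the given contents and successor. -/
def Sel.pick {V : Type} (r : Raw V) (u v : V) : Sel → V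
  | self => u
  | succ => v
  | var => r.var
  | par => r.par
  | left => r.left
  | right => r.right

/-- The carry into position `i` when the binary number `u` is increased by one. -/
def carryAt {n : ℕ} (u : Fin n → Bool) (i : ℕ) : Bool :=
  decide (∀ j : Fin n, (j : ℕ) < i → u j = true)

/-- The binary successor, modulo `2 ^ n`. -/
def succBits {n : ℕ} (u : Fin n → Bool) : Fin n → Bool := fun i => (u i).xor (carryAt u i)

theorem carryAt_zero {n : ℕ} (u : Fin n → Bool) : carryAt u 0 = true := by simp [carryAt]

theorem carryAt_succ {n : ℕ} (u : Fin n → Bool) (i : Fin n) :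
    carryAt u (i + 1) = (carryAt u i && u i) := by
  rw [Bool.eq_iff_iff]
  simp only [carryAt, decide_eq_true_eq, Bool.and_eq_true]
  constructor
  · exact fun h => ⟨fun j hj => h j (by omega), h i (by omega)⟩
  · rintro ⟨h, h'⟩ j hj
    rcases Nat.lt_succ_iff_lt_or_eq.1 hj with hj | hj
    · exact h j hj
    · rwa [Fin.ext hj]

/-! ### The circuit of the reduction -/

/-- The control bits of a monomial: the selector, presence with and without carry, the sign and the
two optional families of variables. -/
def ctrlBits : Option Entry → List Bool
  | none => List.replicate 16 false
  | some e => e.sel.bits ++ (e.present true :: e.present false :: e.neg ::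
      (e.k1.isSome :: (e.k1.getD .V).bits ++ (e.k2.isSome :: (e.k2.getD .V).bits)))

/-- The entry of an equation selected by the inputs of the circuit; the inputs are the (negated)
bits of the number of the equation and of the monomial, the label code and the presence of the
parent and the children. -/
def entryOf (v : Fin 14 → Bool) : Option Entry :=
  (eqn (Nat.ofBits ![!v 0, !v 1, !v 2, !v 3, !v 4]) (Nat.ofBits ![v 7, v 8, v 9, v 10])
    (v 11) (v 12) (v 13))[Nat.ofBits ![!v 5, !v 6]]?

/-- The control logic: a dummy bit, the initial carry and the control bits. -/
def ctrlFun (v : Fin 14 → Bool) (k : Fin 18) : Bool :=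
  look (false :: true :: ctrlBits (entryOf v)) k

/-- The logic for one position of the selected node: the selected bit, the next carry and the
control bits. The inputs are the bits of the right child, the left child, the parent, the variable
and (negated) the node itself, followed by the previous outputs. -/
def scanFun (v : Fin 23 → Bool) (k : Fin 18) : Bool :=
  look ((if v 9 then (if v 7 then v 0 else v 1) else
      if v 8 then (if v 7 then v 2 else v 3) else
      if v 7 then (!v 4).xor (v 6) else !v 4) ::
    (v 6 && !v 4) :: List.ofFn fun j : Fin 16 => v ⟨j + 7, by omega⟩) k

/-- The output logic: coefficient and families of variables. -/
def outFun (v : Fin 18 → Bool) (k : Fin 14) : Bool :=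
  look [v 7, if v 1 then v 5 else v 6, false, true, v 8, v 9, v 10, v 11, v 12,
    v 13, v 14, v 15, v 16, v 17] k

/-- The wires read by the control logic. -/
def ctrlRefs (n U : ℕ) : List ℕ :=
  [n, 2 * n + 1, 3 * n + 2, 4 * n + 3, 4 * n + 4, 4 * n + 5, 4 * n + 6,
    U + n + 6, U + n + 5, U + n + 4, U + n + 3, U + n + 2, U + n + 1, U + n]

/-- The number of gates of the control logic, minus one. -/
noncomputable def ctrlSize : ℕ := 13 + (synth ctrlFun).length

/-- The number of gates for one position, minus one. -/
noncomputable def scanSize : ℕ := 4 + (synth scanFun).length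

/-- The wires read by the logic for position `i`. -/
noncomputable def scanRefs (n U i : ℕ) : List ℕ :=
  [U + i * (scanSize + 2) + (ctrlSize + 1), 4 * n + i * scanSize + (ctrlSize + 3),
    3 * n + i * scanSize + (ctrlSize + 2), 2 * n + i * scanSize + (ctrlSize + 1),
    n + i * scanSize + ctrlSize]

/-- The gates of the control logic. -/
noncomputable def ctrlGates (n U : ℕ) : List Gate := nots (ctrlRefs n U) 0 ++ synth ctrlFun

/-- The gates for position `i`. -/
noncomputable def scanGates (n U i : ℕ) : List Gate := nots (scanRefs n U i) 0 ++ synth scanFun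

/-- The gates for the first `i` positions. -/
noncomputable def scanAll (n U : ℕ) : ℕ → List Gate
  | 0 => []
  | i + 1 => scanAll n U i ++ scanGates n U i

/-- The wires carrying the selected node. -/
noncomputable def nodeWires (n : ℕ) : List ℕ :=
  List.ofFn fun i : Fin n => (n - 1 - i) * (scanSize + 1) + (synth outFun).length

/-- The gates of the reduction. -/
noncomputable def allGates (C : Circuit) : List Gate :=
  C.gates ++ (nots C.outputs 0 ++ (ctrlGates C.numInputs (C.gates.length + C.outputs.length) ++
    (scanAll C.numInputs (C.gates.length + C.outputs.length) C.numInputs ++ synth outFun)))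

/-- The output wires of the reduction. -/
noncomputable def allOutputs (C : Circuit) : List ℕ :=
  [0, 1, 2, 3, 4, 5, 6, 7, 8] ++ (nodeWires C.numInputs ++
    ([9, 10, 11, 12, 13] ++ nodeWires C.numInputs))

theorem length_ctrlGates (n U : ℕ) : (ctrlGates n U).length = ctrlSize + 1 := by
  simp only [ctrlGates, List.length_append, length_nots, ctrlRefs, ctrlSize, List.length_cons,
    List.length_nil]
  omega

theorem length_scanGates (n U i : ℕ) : (scanGates n U i).length = scanSize + 1 := by
  simp only [scanGates, List.length_append, length_nots, scanRefs, scanSize, List.length_cons,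
    List.length_nil]
  omega

theorem length_scanAll (n U i : ℕ) : (scanAll n U i).length = i * (scanSize + 1) := by
  induction i with
  | zero => simp [scanAll]
  | succ i ih => rw [scanAll, List.length_append, ih, length_scanGates, Nat.succ_mul]

theorem scanAll_wf {n U i m : ℕ} (hi : i ≤ n) (hm : 4 * n + ctrlSize + 8 ≤ m)
    (hU : U + n + ctrlSize + 1 ≤ m) (hm' : 18 ≤ m) : GatesWellFormed m (scanAll n U i) := by
  induction i with
  | zero => trivial
  | succ i ih =>
    refine (gatesWellFormed_append _ _ _).2 ⟨ih (by omega), (gatesWellFormed_append _ _ _).2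
      ⟨nots_wf ?_, synth_wf _ ?_⟩⟩
    · rw [length_scanAll]
      have h1 : i * (scanSize + 2) = i * scanSize + 2 * i := by ring
      have h2 : i * (scanSize + 1) = i * scanSize + i := by ring
      simp only [scanRefs, List.mem_cons, List.not_mem_nil, or_false, forall_eq_or_imp, forall_eq,
        h1, h2]
      omega
    · simp only [length_nots, scanRefs, List.length_cons, List.length_nil]
      omega

theorem allGates_wf (C : Circuit) (h : C.outputs.length = 4 * C.numInputs + 7) :
    GatesWellFormed (C.numInputs + 5 + 2) (allGates C) := by
  refine (gatesWellFormed_append _ _ _).2 ⟨C.gates_wf.mono (by omega),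
    (gatesWellFormed_append _ _ _).2 ⟨nots_wf fun q hq => ?_, (gatesWellFormed_append _ _ _).2
      ⟨(gatesWellFormed_append _ _ _).2 ⟨nots_wf ?_, synth_wf _ ?_⟩,
        (gatesWellFormed_append _ _ _).2 ⟨scanAll_wf le_rfl ?_ ?_ ?_, synth_wf _ ?_⟩⟩⟩⟩
  · have := C.outputs_wf q hq
    omega
  · simp only [ctrlRefs, List.mem_cons, List.not_mem_nil, or_false, forall_eq_or_imp, forall_eq,
      length_nots]
    omega
  all_goals simp only [length_nots, ctrlRefs, List.length_cons, List.length_nil, length_ctrlGates]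
  all_goals have : 13 ≤ ctrlSize := by simp [ctrlSize]
  all_goals omega

theorem length_allGates (C : Circuit) : (allGates C).length = C.gates.length + C.outputs.length +
    (ctrlSize + 1) + C.numInputs * (scanSize + 1) + (synth outFun).length := by
  simp only [allGates, List.length_append, length_nots, length_ctrlGates, length_scanAll]
  omega

theorem allOutputs_wf (C : Circuit) :
    ∀ i ∈ allOutputs C, i < C.numInputs + 5 + 2 + (allGates C).length := by
  have h1 : ∀ i ∈ nodeWires C.numInputs, i < C.numInputs + 5 + 2 + (allGates C).length := by
    simp only [nodeWires, List.mem_ofFn, forall_exists_index, forall_apply_eq_imp_iff,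
      length_allGates]
    intro i
    have : (C.numInputs - 1 - i) * (scanSize + 1) ≤ C.numInputs * (scanSize + 1) :=
      Nat.mul_le_mul_right _ (by omega)
    omega
  have h2 : 14 ≤ C.numInputs + 5 + 2 + (allGates C).length := by
    rw [length_allGates]
    have : 13 ≤ ctrlSize := by simp [ctrlSize]
    omega
  intro i hi
  simp only [allOutputs, List.mem_append, List.mem_cons, List.not_mem_nil, or_false] at hi
  rcases hi with hi | hi | hi | hi
  · omega
  · exact h1 i hi
  · omega
  · exact h1 i hi

/-- The instance created from a circuit with outputs of the right length. -/
noncomputable def build (C : Circuit) (h : C.outputs.length = 4 * C.numInputs + 7) : QuadInstance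
    where
  eqBits := C.numInputs + 5
  monBits := 2
  coeffBits := 1
  varBits := C.numInputs + 4
  circuit :=
    { numInputs := C.numInputs + 5 + 2
      gates := allGates C
      outputs := allOutputs C
      gates_wf := allGates_wf C h
      outputs_wf := allOutputs_wf C }

end SuccReals

namespace SuccReals

/-! ### Evaluation of the circuit of the reduction -/

theorem look_ofFn {n : ℕ} (f : Fin n → Bool) (i : Fin n) : look (List.ofFn f) i = f i := by
  simp [look]

theorem look_append_left {l : List Bool} {i : ℕ} (h : i < l.length) (l' : List Bool) :
    look (l ++ l') i = look l i := List.getD_append _ _ _ _ h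

theorem look_append_right (l l' : List Bool) (i : ℕ) : look (l ++ l') (l.length + i) = look l'
    i := by
  simp [look, List.getElem?_append_right]

theorem length_kindBits (k : Kind) : k.bits.length = 4 := by simp [Kind.bits]

/-- The selected bit, given the bits of the candidates. -/
theorem ctrlBits_mux {V : Type} (e : Entry) (r : Raw V) (u v : V) (f : V → Bool) :
    (if look (ctrlBits (some e)) 2 then
        (if look (ctrlBits (some e)) 0 then f r.right else f r.left) else
      if look (ctrlBits (some e)) 1 then
        (if look (ctrlBits (some e)) 0 then f r.par else f r.var) else
      if look (ctrlBits (some e)) 0 then f v else f u) = f (e.sel.pick r u v) := by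
  rcases e with ⟨n, g, s, k, k'⟩
  cases s <;> simp [ctrlBits, Sel.bits, Sel.pick, look]

/-! ### Following the wires through the copied gates, the control logic and the scan. -/

section

variable (C : Circuit) (u : Fin C.numInputs → Bool) (tg : Fin 5 → Bool) (y : Fin 2 → Bool)

/-- The wires after the negated outputs of the given circuit. -/
def startWires : List Bool :=
  runGates (runGates (List.ofFn u ++ (List.ofFn tg ++ List.ofFn y)) C.gates) (nots C.outputs 0)

/-- The bits of the tag and of the monomial lie below the bits of the node, so the copied gates work
as they did in `C`. -/
theorem look_startWires_output (j : ℕ) (hj : j < C.outputs.length) :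
    look (startWires C u tg y) (C.outputs.length - 1 - j) = !look (C.eval (List.ofFn u)) j := by
  have hwf : GatesWellFormed (List.ofFn u).length C.gates := by
    rw [List.length_ofFn]; exact C.gates_wf
  have h1 := C.outputs_wf _ (List.getElem_mem hj)
  rw [startWires, look_nots _ _ _ _ hj, runGates_append_left hwf, add_zero, look_append_left]
  · congr 1
    simp [Circuit.eval, look, hj]
  · rw [length_runGates, List.length_ofFn]
    simpa [hj] using h1

theorem look_startWires_input (k : ℕ) :
    look (startWires C u tg y) (C.gates.length + C.outputs.length + k) =
      look (List.ofFn u ++ (List.ofFn tg ++ List.ofFn y)) k := by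
  have h1 := look_runGates_add (runGates (List.ofFn u ++ (List.ofFn tg ++ List.ofFn y)) C.gates)
    (nots C.outputs 0) (C.gates.length + k)
  rw [length_nots] at h1
  rw [startWires, show C.gates.length + C.outputs.length + k =
    C.outputs.length + (C.gates.length + k) by omega, h1, look_runGates_add]

theorem look_startWires_node (i : Fin C.numInputs) :
    look (startWires C u tg y) (C.gates.length + C.outputs.length + i) = u i := by
  rw [look_startWires_input, look_append_left (by simp), look_ofFn]

theorem look_startWires_tag (i : Fin 5) :
    look (startWires C u tg y) (C.gates.length + C.outputs.length + C.numInputs + i) = tg i := by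
  rw [add_assoc, look_startWires_input]
  have := look_append_right (List.ofFn u) (List.ofFn tg ++ List.ofFn y) i
  rw [List.length_ofFn] at this
  rw [this, look_append_left (by simp), look_ofFn]

theorem look_startWires_mon (i : Fin 2) :
    look (startWires C u tg y) (C.gates.length + C.outputs.length + C.numInputs + (5 + i)) = y
        i := by
  rw [add_assoc, look_startWires_input]
  have := look_append_right (List.ofFn u) (List.ofFn tg ++ List.ofFn y) (5 + i)
  rw [List.length_ofFn] at this
  rw [this]
  have := look_append_right (List.ofFn tg) (List.ofFn y) i
  rw [List.length_ofFn] at this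
  rw [this, look_ofFn]

/-- The contents of the node `u`. -/
def rawAt : Raw (Fin C.numInputs → Bool) := rawNode C.numInputs (C.eval (List.ofFn u))

/-- The `y`-th entry of the equation with number `tg` at the node `u`. -/
def entryAt : Option Entry :=
  (eqn (Nat.ofBits tg) (rawAt C u).code (rawAt C u).fp (rawAt C u).fl (rawAt C u).fr)[Nat.ofBits y]?

variable (h : C.outputs.length = 4 * C.numInputs + 7)
include h

/-- The wires after the control logic. -/
noncomputable def ctrlWires : List Bool :=
  runGates (startWires C u tg y) (ctrlGates C.numInputs (C.gates.length + C.outputs.length))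

omit h in
theorem look_ctrlWires_add (k : ℕ) :
    look (ctrlWires C u tg y) (ctrlSize + 1 + k) = look (startWires C u tg y) k := by
  have := look_runGates_add (startWires C u tg y)
    (ctrlGates C.numInputs (C.gates.length + C.outputs.length)) k
  rwa [length_ctrlGates] at this

/-- Outputs of `C` have been negated twice at this point, inputs of the new circuit only once; this
explains the negations in `entryOf`. -/
theorem entryOf_startWires :
    entryOf (fun i : Fin 14 => look (runGates (startWires C u tg y)
      (nots (ctrlRefs C.numInputs (C.gates.length + C.outputs.length)) 0)) i) =
    entryAt C u tg y := by
  set v : Fin 14 → Bool := fun i => look (runGates (startWires C u tg y)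
    (nots (ctrlRefs C.numInputs (C.gates.length + C.outputs.length)) 0)) i with hv
  have hl : (ctrlRefs C.numInputs (C.gates.length + C.outputs.length)).length = 14 := rfl
  -- Fourteen negation gates put the reference number `r` at wire `13 - r`.
  have hr : ∀ r : Fin 14, v (Fin.rev r) = !look (startWires C u tg y)
      ((ctrlRefs C.numInputs (C.gates.length + C.outputs.length)).getD r 0) := by
    intro r
    have := look_nots (ctrlRefs C.numInputs (C.gates.length + C.outputs.length)) 0
      (startWires C u tg y) r (by rw [hl]; omega)
    rw [hl, add_zero] at this
    rw [hv, ← this]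
    simp only [Fin.val_rev]
    congr 1
    omega
  have ho : ∀ (r : Fin 14) (j : ℕ), j < C.outputs.length →
      (ctrlRefs C.numInputs (C.gates.length + C.outputs.length)).getD r 0 =
        C.outputs.length - 1 - j → v (Fin.rev r) = look (C.eval (List.ofFn u)) j := by
    intro r j hj e
    rw [hr, e, look_startWires_output C u tg y j hj, Bool.not_not]
  have ht : ∀ (r : Fin 14) (j : Fin 5),
      (ctrlRefs C.numInputs (C.gates.length + C.outputs.length)).getD r 0 =
        C.gates.length + C.outputs.length + C.numInputs + j → (!v (Fin.rev r)) = tg j := by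
    intro r j e
    rw [hr, e, look_startWires_tag C u tg y j, Bool.not_not]
  have hy : ∀ (r : Fin 14) (j : Fin 2),
      (ctrlRefs C.numInputs (C.gates.length + C.outputs.length)).getD r 0 =
        C.gates.length + C.outputs.length + C.numInputs + (5 + j) → (!v (Fin.rev r)) = y j := by
    intro r j e
    rw [hr, e, look_startWires_mon C u tg y j, Bool.not_not]
  have e1 : ![!v 0, !v 1, !v 2, !v 3, !v 4] = tg := by
    funext j
    fin_cases j
    · exact ht 13 0 rfl
    · exact ht 12 1 rfl
    · exact ht 11 2 rfl
    · exact ht 10 3 rfl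
    · exact ht 9 4 rfl
  have e2 : ![!v 5, !v 6] = y := by
    funext j
    fin_cases j
    · exact hy 8 0 rfl
    · exact hy 7 1 rfl
  have e3 : ![v 7, v 8, v 9, v 10] = bitsAt (C.eval (List.ofFn u)) 0 4 := by
    funext j
    fin_cases j
    · exact ho 6 0 (by omega) (by rw [h]; rfl)
    · exact ho 5 1 (by omega) (by rw [h]; rfl)
    · exact ho 4 2 (by omega) (by rw [h]; rfl)
    · exact ho 3 3 (by omega) (by rw [h]; rfl)
  have e4 : v 11 = (rawAt C u).fp := ho 2 (C.numInputs + 4) (by omega) (by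
    change 3 * C.numInputs + 2 = _; omega)
  have e5 : v 12 = (rawAt C u).fl := ho 1 (2 * C.numInputs + 5) (by omega) (by
    change 2 * C.numInputs + 1 = _; omega)
  have e6 : v 13 = (rawAt C u).fr := ho 0 (3 * C.numInputs + 6) (by omega) (by
    change C.numInputs = _; omega)
  rw [entryOf, e1, e2, e3, e4, e5, e6]
  rfl

theorem look_ctrlWires (k : Fin 18) :
    look (ctrlWires C u tg y) k = look (false :: true :: ctrlBits (entryAt C u tg y)) k := by
  rw [ctrlWires, ctrlGates, runGates_append, look_synth, ctrlFun, entryOf_startWires C u tg y h]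

/-- The wires after the logic for `i` positions. -/
noncomputable def scanWires (i : ℕ) : List Bool :=
  runGates (ctrlWires C u tg y)
    (scanAll C.numInputs (C.gates.length + C.outputs.length) i)

omit h in
theorem look_scanWires_add (i k : ℕ) :
    look (scanWires C u tg y i) (i * (scanSize + 1) + k) = look (ctrlWires C u tg y) k := by
  have := look_runGates_add (ctrlWires C u tg y)
    (scanAll C.numInputs (C.gates.length + C.outputs.length) i) k
  rwa [length_scanAll] at this

omit h in
theorem look_scanWires_start {i k m : ℕ}
    (hm : m = i * (scanSize + 1) + (ctrlSize + 1 + k)) :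
    look (scanWires C u tg y i) m = look (startWires C u tg y) k := by
  rw [hm, look_scanWires_add, look_ctrlWires_add]

/-- The node selected by the entry (or an arbitrary node if there is no entry). -/
def selBit (i : Fin C.numInputs) : Bool :=
  if look (ctrlBits (entryAt C u tg y)) 2 then
    (if look (ctrlBits (entryAt C u tg y)) 0 then (rawAt C u).right i else (rawAt C u).left i) else
  if look (ctrlBits (entryAt C u tg y)) 1 then
    (if look (ctrlBits (entryAt C u tg y)) 0 then (rawAt C u).par i else (rawAt C u).var i) else
  if look (ctrlBits (entryAt C u tg y)) 0 then succBits u i else u i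

/-- Every block computes the carry and the control bits anew, so the state of the scan always
occupies the most recent wires and the same block works at every position. -/
theorem look_scanWires_step (i : Fin C.numInputs)
    (hc : look (scanWires C u tg y i) 1 = carryAt u i)
    (hk : ∀ k : Fin 16, look (scanWires C u tg y i) (2 + k) = look (ctrlBits (entryAt C u tg y)) k)
        :
    look (scanWires C u tg y (i + 1)) 0 = selBit C u tg y i ∧
    look (scanWires C u tg y (i + 1)) 1 = carryAt u (i + 1) ∧
    (∀ k : Fin 16, look (scanWires C u tg y (i + 1)) (2 + k) =
      look (ctrlBits (entryAt C u tg y)) k) := by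
  set U := C.gates.length + C.outputs.length with hU
  set s := C.eval (List.ofFn u) with hs
  set w := scanWires C u tg y i with hw
  set v : Fin 23 → Bool := fun j => look (runGates w (nots (scanRefs C.numInputs U i) 0)) j with hv
  have hstep : ∀ k : Fin 18, look (scanWires C u tg y (i + 1)) k = scanFun v k := by
    intro k
    rw [scanWires, scanAll, runGates_append, scanGates, runGates_append, look_synth]
    rfl
  have hl : (scanRefs C.numInputs U i).length = 5 := rfl
  have hn : ∀ r : ℕ, r < 5 → look (runGates w (nots (scanRefs C.numInputs U i) 0)) (4 - r) =
      !look w ((scanRefs C.numInputs U i).getD r 0) := fun r hr => by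
    have := look_nots (scanRefs C.numInputs U i) 0 w r (by rw [hl]; exact hr)
    rwa [hl, add_zero] at this
  have hs' : ∀ k : ℕ, look (runGates w (nots (scanRefs C.numInputs U i) 0)) (5 + k) = look w k :=
    fun k => by
      have := look_runGates_add w (nots (scanRefs C.numInputs U i) 0) k
      rwa [length_nots, hl] at this
  have ho : ∀ r j m : ℕ, r < 5 → j < C.outputs.length →
      (scanRefs C.numInputs U i).getD r 0 = m →
      m = i * (scanSize + 1) + (ctrlSize + 1 + (C.outputs.length - 1 - j)) →
      look (runGates w (nots (scanRefs C.numInputs U i) 0)) (4 - r) = look s j := by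
    intro r j m hr hj hm e
    rw [hn r hr, hm, hw, look_scanWires_start C u tg y e, look_startWires_output C u tg y j hj,
      Bool.not_not]
  -- Each earlier position has added `scanSize + 1` gates. The outputs of `C` are stored in reverse,
  -- so their addresses grow by `scanSize` per position; the input bits are stored in order, so
  -- theirs grow by `scanSize + 2`.
  have hi := i.2
  have hmul : (i : ℕ) * (scanSize + 1) = i * scanSize + i := by ring
  have v0 : v 0 = (rawAt C u).right i := ho 4 (3 * C.numInputs + 7 + i)
      (C.numInputs + i * scanSize + ctrlSize)
    (by omega) (by omega) rfl (by rw [hmul]; omega)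
  have v1 : v 1 = (rawAt C u).left i := ho 3 (2 * C.numInputs + 6 + i)
      (2 * C.numInputs + i * scanSize + (ctrlSize + 1))
    (by omega) (by omega) rfl (by rw [hmul]; omega)
  have v2 : v 2 = (rawAt C u).par i := ho 2 (C.numInputs + 5 + i)
      (3 * C.numInputs + i * scanSize + (ctrlSize + 2))
    (by omega) (by omega) rfl (by rw [hmul]; omega)
  have v3 : v 3 = (rawAt C u).var i := ho 1 (4 + i)
      (4 * C.numInputs + i * scanSize + (ctrlSize + 3))
    (by omega) (by omega) rfl (by rw [hmul]; omega)
  have v4 : v 4 = !u i := by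
    refine (hn 0 (by omega)).trans ?_
    rw [hw, look_scanWires_start C u tg y (k := U + i), look_startWires_node]
    change U + i * (scanSize + 2) + (ctrlSize + 1) = _
    have : (i : ℕ) * (scanSize + 2) = i * scanSize + 2 * i := by ring
    rw [hmul, this]
    omega
  have v6 : v 6 = carryAt u i := (hs' 1).trans hc
  have v7 : ∀ k : Fin 16, v ⟨k + 7, by omega⟩ = look (ctrlBits (entryAt C u tg y)) k := fun k => by
    refine Eq.trans ?_ ((hs' (2 + k)).trans (hk k))
    rw [hv, show 5 + (2 + (k : ℕ)) = k + 7 by omega]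
  have a7 : v 7 = look (ctrlBits (entryAt C u tg y)) 0 := v7 0
  have a8 : v 8 = look (ctrlBits (entryAt C u tg y)) 1 := v7 1
  have a9 : v 9 = look (ctrlBits (entryAt C u tg y)) 2 := v7 2
  refine ⟨(hstep 0).trans ?_, (hstep 1).trans ?_, fun k => ?_⟩
  · simp only [scanFun, Fin.val_zero, look_cons_zero, selBit, a7, a8, a9, v0, v1, v2, v3, v4, v6,
      Bool.not_not, succBits]
  · rw [carryAt_succ]
    change (v 6 && !v 4) = _
    rw [v6, v4, Bool.not_not]
  · have := hstep ⟨2 + k, by omega⟩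
    refine this.trans ?_
    have e : ((⟨2 + k, by omega⟩ : Fin 18) : ℕ) = k + 1 + 1 := add_comm _ _
    rw [scanFun, e, look_cons_succ, look_cons_succ, look_ofFn, v7]

/-- The selected bits are not carried along: each stays where it was computed, at distance `scanSize
+ 1` from the next one. -/
theorem look_scanWires (i : ℕ) (hi : i ≤ C.numInputs) :
    look (scanWires C u tg y i) 1 = carryAt u i ∧
    (∀ k : Fin 16, look (scanWires C u tg y i) (2 + k) = look (ctrlBits (entryAt C u tg y)) k) ∧
    ∀ j : Fin C.numInputs, (j : ℕ) < i →
      look (scanWires C u tg y i) ((i - 1 - j) * (scanSize + 1)) = selBit C u tg y j := by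
  induction i with
  | zero =>
    have e0 : scanWires C u tg y 0 = ctrlWires C u tg y := by
      rw [scanWires, scanAll, runGates]
    rw [e0, carryAt_zero]
    refine ⟨look_ctrlWires C u tg y h ⟨1, by omega⟩, fun k => ?_,
      fun j hj => absurd hj (by omega)⟩
    refine (look_ctrlWires C u tg y h ⟨2 + k, by omega⟩).trans ?_
    have e : ((⟨2 + k, by omega⟩ : Fin 18) : ℕ) = k + 1 + 1 := add_comm _ _
    rw [e, look_cons_succ, look_cons_succ]
  | succ i ih =>
    obtain ⟨h1, h2, h3⟩ := ih (by omega)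
    obtain ⟨h4, h5, h6⟩ := look_scanWires_step C u tg y h ⟨i, hi⟩ h1 h2
    refine ⟨h5, h6, fun j hj => ?_⟩
    rcases Nat.lt_succ_iff_lt_or_eq.1 hj with hj | hj
    · rw [← h3 j hj]
      have := look_runGates_add (scanWires C u tg y i)
        (scanGates C.numInputs (C.gates.length + C.outputs.length) i)
        ((i - 1 - j) * (scanSize + 1))
      rw [length_scanGates] at this
      rw [← this, scanWires, scanAll, runGates_append, ← scanWires.eq_def]
      congr 1
      rw [show i + 1 - 1 - j = (i - 1 - j) + 1 by omega]
      ring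
    · have : j = ⟨i, hi⟩ := Fin.ext hj
      rw [this, ← h4]
      simp

/-- The output string of the reduction. -/
theorem eval_allGates :
    (allOutputs C).map (fun i => look (runGates (List.ofFn u ++ (List.ofFn tg ++ List.ofFn y))
        (allGates C)) i) =
      [look (ctrlBits (entryAt C u tg y)) 5,
        if carryAt u C.numInputs then look (ctrlBits (entryAt C u tg y)) 3 else
          look (ctrlBits (entryAt C u tg y)) 4, false, true,
        look (ctrlBits (entryAt C u tg y)) 6, look (ctrlBits (entryAt C u tg y)) 7,
        look (ctrlBits (entryAt C u tg y)) 8, look (ctrlBits (entryAt C u tg y)) 9,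
        look (ctrlBits (entryAt C u tg y)) 10] ++ (List.ofFn (selBit C u tg y) ++
      ([look (ctrlBits (entryAt C u tg y)) 11, look (ctrlBits (entryAt C u tg y)) 12,
        look (ctrlBits (entryAt C u tg y)) 13, look (ctrlBits (entryAt C u tg y)) 14,
        look (ctrlBits (entryAt C u tg y)) 15] ++ List.ofFn (selBit C u tg y))) := by
  obtain ⟨h1, h2, h3⟩ := look_scanWires C u tg y h C.numInputs le_rfl
  have hrun : runGates (List.ofFn u ++ (List.ofFn tg ++ List.ofFn y)) (allGates C) =
      runGates (scanWires C u tg y C.numInputs) (synth outFun) := by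
    simp only [allGates, runGates_append, scanWires, ctrlWires, startWires]
  rw [hrun]
  have hn : (nodeWires C.numInputs).map (fun i => look (runGates
      (scanWires C u tg y C.numInputs) (synth outFun)) i) = List.ofFn (selBit C u tg y) := by
    rw [nodeWires, List.map_ofFn]
    congr 1
    funext i
    rw [← h3 i i.2, Function.comp_apply, add_comm, look_runGates_add]
  have ho : ∀ k : Fin 14, look (runGates (scanWires C u tg y C.numInputs) (synth outFun)) k =
      outFun (fun i : Fin 18 => look (scanWires C u tg y C.numInputs) i) k := fun k => look_synth _
          _ k
  simp only [allOutputs, List.map_append, hn, List.map_cons, List.map_nil]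
  have hk : ∀ k < 16, look (scanWires C u tg y C.numInputs) (2 + k) =
      look (ctrlBits (entryAt C u tg y)) k := fun k hk => h2 ⟨k, hk⟩
  refine congrArg₂ (· ++ ·) ?_ (congrArg _ (congrArg (· ++ _) ?_))
  · rw [← hk 3 (by omega), ← hk 4 (by omega), ← hk 5 (by omega), ← hk 6 (by omega), ← hk 7
      (by omega), ← hk 8 (by omega), ← hk 9 (by omega), ← hk 10 (by omega), ← h1]
    exact congrArg₂ _ (ho 0) <| congrArg₂ _ (ho 1) <| congrArg₂ _ (ho 2) <| congrArg₂ _ (ho 3) <|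
      congrArg₂ _ (ho 4) <| congrArg₂ _ (ho 5) <| congrArg₂ _ (ho 6) <| congrArg₂ _ (ho 7) <|
      congrArg₂ _ (ho 8) rfl
  · rw [← hk 11 (by omega), ← hk 12 (by omega), ← hk 13 (by omega), ← hk 14 (by omega), ← hk 15
      (by omega)]
    exact congrArg₂ _ (ho 9) <| congrArg₂ _ (ho 10) <| congrArg₂ _ (ho 11) <|
      congrArg₂ _ (ho 12) <| congrArg₂ _ (ho 13) rfl

end

end SuccReals

namespace SuccReals

/-! ### The polynomials of the reduction -/

/-- The name of a variable. -/
def varName {n : ℕ} (k : Kind) (v : Fin n → Bool) : Fin (n + 4) → Bool :=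
  fun i => look (k.bits ++ List.ofFn v) i

/-- The number of the family that a variable belongs to. -/
def kindIndex {n : ℕ} (w : Fin (n + 4) → Bool) : ℕ :=
  Nat.ofBits fun i : Fin 4 => w ⟨i, by omega⟩

theorem kindIndex_varName {n : ℕ} (k : Kind) (v : Fin n → Bool) :
    kindIndex (varName k v) = k.code := by
  have : (fun i : Fin 4 => varName k v ⟨i, by omega⟩) = fun i : Fin 4 => (k.code : ℕ).testBit
      i := by
    funext i
    rw [varName, look_append_left (by rw [length_kindBits]; exact i.2), Kind.bits, look_ofFn]
  rw [kindIndex, this, Nat.ofBits_testBit, Nat.mod_eq_of_lt k.code.2]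

theorem varName_node {n : ℕ} (k : Kind) (v : Fin n → Bool) (i : Fin n) :
    varName k v (Fin.castLE (by omega) (Fin.natAdd 4 i)) = v i := by
  have := look_append_right k.bits (List.ofFn v) i
  rw [length_kindBits, look_ofFn] at this
  exact this

namespace Entry

/-- The coefficient of an entry, depending on the carry. -/
def coef (e : Entry) (c : Bool) : ℚ := if e.present c then if e.neg then -1 else 1 else 0

/-- The exponent vector of an entry at a node `u` with successor `v`. -/
noncomputable def expo {n : ℕ} (e : Entry) (w : Fin n → Bool) : (Fin (n + 4) → Bool) →₀ ℕ :=
  (e.k1.elim 0 fun k => Finsupp.single (varName k w) 1) +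
    (e.k2.elim 0 fun k => Finsupp.single (varName k w) 1)

/-- The sign of an entry and the families of its variables. -/
def key (e : Entry) : Bool × ℕ :=
  (e.neg, (e.k1.elim 0 fun k => 3 ^ (k.code : ℕ)) + (e.k2.elim 0 fun k => 3 ^ (k.code : ℕ)))

/-- The weight `3 ^ k` of the family number `k` forgets the nodes and retains the families. There
are only two factors, so base three keeps different pairs of families apart. -/
theorem expo_key {n : ℕ} (e : Entry) (w : Fin n → Bool) :
    ((e.expo w).sum fun x c => c * 3 ^ kindIndex x) = e.key.2 := by
  rw [expo, Finsupp.sum_add_index' (by simp) (by intros; ring)]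
  rcases e with ⟨_, _, _, _ | k, _ | k'⟩ <;> simp [key, kindIndex_varName]

/-- The value of an entry at a node `u` with successor `v`. -/
noncomputable def val {V : Type} (e : Entry) (Q : Kind → V → ℝ) (w : V) (c : Bool) : ℝ :=
  (if e.present c then if e.neg then -1 else 1 else 0) * (e.k1.elim 1 fun k => Q k w) *
    (e.k2.elim 1 fun k => Q k w)

end Entry

/-- The values of the given families of variables satisfy all equations. -/
def Solves {V : Type} (Q : Kind → V → ℝ) (raw : V → Raw V) (succ : V → V) (carry : V → Bool) :
    Prop :=
  ∀ tag u, ((eqn tag (raw u).code (raw u).fp (raw u).fl (raw u).fr).map fun e =>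
    e.val Q (e.sel.pick (raw u) u (succ u)) (carry u)).sum = 0

theorem length_eqn (tag c : ℕ) (fp fl fr : Bool) : (eqn tag c fp fl fr).length ≤ 4 := by
  unfold eqn
  split <;> first | decide | (split <;> first | decide | (split <;> decide))

/-- This finite check makes all coefficients units: entries of equal sign involve different
families, so their monomials differ whatever nodes the pointers name, even if these coincide. -/
theorem nodup_key_eqn (tag c : ℕ) (fp fl fr : Bool) :
    ((eqn tag c fp fl fr).map Entry.key).Nodup := by
  unfold eqn
  split <;> first | decide | (split <;> first | decide | (split <;> decide))

theorem eqn_of_large {tag : ℕ} (h : 32 ≤ tag) (c : ℕ) (fp fl fr : Bool) :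
    eqn tag c fp fl fr = [] := by
  unfold eqn
  split <;> first | omega | rfl

/-- Two bits address four entries; those beyond the end of the list count as zero, like the padding
of an instance. -/
theorem sum_twoBits {M : Type*} [AddCommMonoid M] (l : List M) (hl : l.length ≤ 4) :
    ∑ y : Fin 2 → Bool, (l[Nat.ofBits y]?).getD 0 = l.sum := by
  rw [← (finTwoArrowEquiv Bool).symm.sum_comp, Fintype.sum_prod_type, Fintype.sum_bool,
    Fintype.sum_bool, Fintype.sum_bool]
  have h1 : Nat.ofBits ((finTwoArrowEquiv Bool).symm (true, true)) = 3 := by decide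
  have h2 : Nat.ofBits ((finTwoArrowEquiv Bool).symm (true, false)) = 1 := by decide
  have h3 : Nat.ofBits ((finTwoArrowEquiv Bool).symm (false, true)) = 2 := by decide
  have h4 : Nat.ofBits ((finTwoArrowEquiv Bool).symm (false, false)) = 0 := by decide
  rw [h1, h2, h3, h4]
  match l, hl with
  | [], _ => simp
  | [a], _ => simp
  | [a, b], _ => simp [add_comm]
  | [a, b, c], _ => simp; abel
  | [a, b, c, d], _ => simp; abel

theorem ofBits_two_injective : Function.Injective (Nat.ofBits : (Fin 2 → Bool) → ℕ) := by
  have : ∀ y y' : Fin 2 → Bool, Nat.ofBits y = Nat.ofBits y' → y = y' := by decide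
  exact fun y y' => this y y'

open MvPolynomial in
/-- A sum of monomials with coefficients `0`, `1`, `-1` in which equal monomials have different
signs has coefficients `0`, `1`, `-1`. -/
theorem coeff_sum_monomial_unit {ι σ : Type*} [Fintype ι] (f : ι → σ →₀ ℕ) (c : ι → ℚ)
    (hc : ∀ i, c i = 0 ∨ c i = 1 ∨ c i = -1)
    (hf : ∀ i j, c i ≠ 0 → c i = c j → f i = f j → i = j) (m : σ →₀ ℕ) :
    coeff m (∑ i, monomial (f i) (c i)) = 0 ∨ coeff m (∑ i, monomial (f i) (c i)) = 1 ∨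
      coeff m (∑ i, monomial (f i) (c i)) = -1 := by
  classical
  -- The coefficient is the number of indices with sign `1` minus the number with sign `-1` at this
  -- monomial; by `hf`, each number is at most one.
  have h : coeff m (∑ i, monomial (f i) (c i)) =
      (Finset.univ.filter fun i => f i = m ∧ c i = 1).card -
        ((Finset.univ.filter fun i => f i = m ∧ c i = -1).card : ℚ) := by
    rw [coeff_sum, Finset.natCast_card_filter, Finset.natCast_card_filter,
      ← Finset.sum_sub_distrib]
    refine Finset.sum_congr rfl fun i _ => ?_
    rw [coeff_monomial]
    rcases hc i with h | h | h <;> by_cases hm : f i = m <;> simp [h, hm] <;> norm_num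
  have h1 : ∀ a : ℚ, a ≠ 0 → (Finset.univ.filter fun i => f i = m ∧ c i = a).card ≤ 1 := by
    intro a ha
    refine Finset.card_le_one.2 fun i hi j hj => ?_
    simp only [Finset.mem_filter, Finset.mem_univ, true_and] at hi hj
    exact hf i j (by rw [hi.2]; exact ha) (by rw [hi.2, hj.2]) (by rw [hi.1, hj.1])
  have h2 := h1 1 one_ne_zero
  have h3 := h1 (-1) (by norm_num)
  rw [h]
  generalize (Finset.univ.filter fun i => f i = m ∧ c i = 1).card = a at *
  generalize (Finset.univ.filter fun i => f i = m ∧ c i = -1).card = b at *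
  interval_cases a <;> interval_cases b <;> norm_num

/-! ### The created instance as a system of signed monomials. -/

section

variable (C : Circuit) (h : C.outputs.length = 4 * C.numInputs + 7)
  (x : Fin (C.numInputs + 5) → Bool) (y : Fin 2 → Bool)

/-- The node that an equation belongs to. -/
def nodeOf : Fin C.numInputs → Bool := fun i => x (Fin.castAdd 5 i)

/-- The number of an equation. -/
def tagOf : Fin 5 → Bool := fun i => x (Fin.natAdd C.numInputs i)

/-- The entry given by a number of an equation and a number of a monomial. -/
def entry : Option Entry := entryAt C (nodeOf C x) (tagOf C x) y

theorem out_build :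
    (build C h).out x y =
      [look (ctrlBits (entry C x y)) 5,
        if carryAt (nodeOf C x) C.numInputs then look (ctrlBits (entry C x y)) 3 else
          look (ctrlBits (entry C x y)) 4, false, true,
        look (ctrlBits (entry C x y)) 6, look (ctrlBits (entry C x y)) 7,
        look (ctrlBits (entry C x y)) 8, look (ctrlBits (entry C x y)) 9,
        look (ctrlBits (entry C x y)) 10] ++ (List.ofFn (selBit C (nodeOf C x) (tagOf C x) y) ++
      ([look (ctrlBits (entry C x y)) 11, look (ctrlBits (entry C x y)) 12,
        look (ctrlBits (entry C x y)) 13, look (ctrlBits (entry C x y)) 14,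
        look (ctrlBits (entry C x y)) 15] ++ List.ofFn (selBit C (nodeOf C x) (tagOf C x) y))) := by
  rw [entry, ← eval_allGates C (nodeOf C x) (tagOf C x) y h]
  have hx : List.ofFn x = List.ofFn (nodeOf C x) ++ List.ofFn (tagOf C x) := by
    rw [← List.ofFn_fin_append]
    congr 1
    exact (Fin.append_castAdd_natAdd (f := x)).symm
  have : (build C h).out x y = (allOutputs C).map fun i =>
      look (runGates (List.ofFn x ++ List.ofFn y) (allGates C)) i := rfl
  rw [this, hx, List.append_assoc]

theorem out_build_some (e : Entry) (he : entry C x y = some e) :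
    (build C h).out x y =
      [e.neg, e.present (carryAt (nodeOf C x) C.numInputs), false, true, e.k1.isSome] ++
        (((e.k1.getD .V).bits ++ List.ofFn (e.sel.pick (rawAt C (nodeOf C x)) (nodeOf C x)
          (succBits (nodeOf C x)))) ++ (e.k2.isSome :: ((e.k2.getD .V).bits ++
          List.ofFn (e.sel.pick (rawAt C (nodeOf C x)) (nodeOf C x)
            (succBits (nodeOf C x)))))) := by
  have hs : selBit C (nodeOf C x) (tagOf C x) y =
      e.sel.pick (rawAt C (nodeOf C x)) (nodeOf C x) (succBits (nodeOf C x)) := by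
    funext i
    have := ctrlBits_mux e (rawAt C (nodeOf C x)) (nodeOf C x) (succBits (nodeOf C x))
      (fun v => v i)
    rw [← this, ← he]
    rfl
  rw [out_build, hs, he]
  have hp : (if carryAt (nodeOf C x) C.numInputs then look (ctrlBits (some e)) 3 else
      look (ctrlBits (some e)) 4) = e.present (carryAt (nodeOf C x) C.numInputs) := by
    rcases e with ⟨n, g, s, k, k'⟩
    cases s <;> cases carryAt (nodeOf C x) C.numInputs <;> rfl
  rw [hp]
  generalize e.present (carryAt (nodeOf C x) C.numInputs) = p
  generalize List.ofFn _ = m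
  rcases e with ⟨n, g, s, k, k'⟩
  cases s <;> simp [ctrlBits, Sel.bits, Kind.bits, look]

theorem num_build : ((build C h).num x y : ℚ) =
    (entry C x y).elim 0 fun e => e.coef (carryAt (nodeOf C x) C.numInputs) := by
  -- The absolute value has a single bit, which is the presence of the entry; absent entries thus
  -- become padding with coefficient `0`.
  have h1 : ∀ w : List Bool, intAt w 0 1 = (if look w 0 then -1 else 1) *
      ((look w 1).toNat : ℤ) := by
    intro w
    simp [intAt, look, bitsAt, Nat.ofBits, Fin.foldr_succ]
  have h2 : (build C h).num x y = intAt ((build C h).out x y) 0 1 := rfl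
  rw [h2, h1]
  cases he : entry C x y with
  | none =>
    rw [out_build, he]
    simp [look, ctrlBits]
  | some e =>
    rw [out_build_some C h x y e he]
    cases hn : e.neg <;> cases hp : e.present (carryAt (nodeOf C x) C.numInputs) <;>
      simp [look, hn, hp, Entry.coef]

theorem den_build : (build C h).den x y = 1 := by
  have h1 : ∀ w : List Bool, intAt w 2 1 = (if look w 2 then -1 else 1) *
      ((look w 3).toNat : ℤ) := by
    intro w
    simp [intAt, look, bitsAt, Nat.ofBits, Fin.foldr_succ]
  have h2 : (build C h).den x y = intAt ((build C h).out x y) 2 1 := rfl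
  rw [h2, h1, out_build]
  simp [look]

theorem coeff_build : (build C h).coeff x y =
    (entry C x y).elim 0 fun e => e.coef (carryAt (nodeOf C x) C.numInputs) := by
  have : (build C h).coeff x y = ((build C h).num x y : ℚ) / ((build C h).den x y : ℚ) := rfl
  rw [this, den_build, num_build]
  simp

theorem C_mul_factor_mul_factor {n : ℕ} (q : ℚ) (e : Entry) (w : Fin n → Bool) :
    MvPolynomial.C q * QuadInstance.factor (e.k1.map fun k => varName k w) *
      QuadInstance.factor (e.k2.map fun k => varName k w) = MvPolynomial.monomial (e.expo w) q := by
  have hfac : ∀ k : Option Kind, QuadInstance.factor (k.map fun k => varName k w) =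
      MvPolynomial.monomial (k.elim 0 fun k => Finsupp.single (varName k w) 1) 1 := by
    intro k
    cases k <;> rfl
  rw [hfac, hfac, MvPolynomial.C_mul_monomial, MvPolynomial.monomial_mul, mul_one, mul_one,
    Entry.expo]

theorem monomial_build : (build C h).monomial x y = (entry C x y).elim 0 fun e =>
    MvPolynomial.monomial (e.expo (e.sel.pick (rawAt C (nodeOf C x)) (nodeOf C x)
      (succBits (nodeOf C x)))) (e.coef (carryAt (nodeOf C x) C.numInputs)) := by
  have hm : (build C h).monomial x y = MvPolynomial.C ((build C h).coeff x y) *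
      QuadInstance.factor (optBitsAt ((build C h).out x y) (2 * (build C h).coeffBits + 2)
        (build C h).varBits) *
      QuadInstance.factor (optBitsAt ((build C h).out x y)
        (2 * (build C h).coeffBits + (build C h).varBits + 3) (build C h).varBits) := rfl
  rw [hm, coeff_build]
  cases he : entry C x y with
  | none => simp; rfl
  | some e =>
    have hout := out_build_some C h x y e he
    set w := e.sel.pick (rawAt C (nodeOf C x)) (nodeOf C x) (succBits (nodeOf C x)) with hw
    have h1 : optBitsAt ((build C h).out x y) (2 * (build C h).coeffBits + 2) (build C h).varBits =
        e.k1.map fun k => varName k w := by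
      -- Numerator and denominator take two bits each, so bit `4` is the presence flag of the first
      -- factor.
      have hf : ((build C h).out x y).getD 4 false = e.k1.isSome := by rw [hout]; simp
      have hb : bitsAt ((build C h).out x y) 5 (C.numInputs + 4) = varName (e.k1.getD .V) w := by
        funext i
        rw [hout]
        refine (look_append_right [_, _, _, _, _] _ i).trans ?_
        rw [look_append_left]
        · rfl
        · rw [List.length_append, List.length_ofFn, length_kindBits]
          omega
      change (if ((build C h).out x y).getD 4 false = true then
        some (bitsAt ((build C h).out x y) 5 (C.numInputs + 4)) else none) = _
      rw [hf, hb]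
      cases e.k1 <;> rfl
    have h2 : optBitsAt ((build C h).out x y)
        (2 * (build C h).coeffBits + (build C h).varBits + 3) (build C h).varBits =
        e.k2.map fun k => varName k w := by
      have hl : ∀ k : Kind, (k.bits ++ List.ofFn w).length = C.numInputs + 4 := fun k => by
        rw [List.length_append, List.length_ofFn, length_kindBits, add_comm]
      -- The name of the first variable takes the `N + 4` bits after position `4`, so the second
      -- flag is bit `N + 9`.
      have hf : ((build C h).out x y).getD (C.numInputs + 9) false = e.k2.isSome := by
        rw [hout]
        rw [show C.numInputs + 9 = 5 + (C.numInputs + 4) by omega]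
        refine (look_append_right [_, _, _, _, _] _ _).trans ?_
        have := look_append_right ((e.k1.getD .V).bits ++ List.ofFn w)
          (e.k2.isSome :: ((e.k2.getD .V).bits ++ List.ofFn w)) 0
        rw [hl, add_zero] at this
        exact this
      have hb : bitsAt ((build C h).out x y) (C.numInputs + 10) (C.numInputs + 4) =
          varName (e.k2.getD .V) w := by
        funext i
        rw [hout, bitsAt, show C.numInputs + 10 + (i : ℕ) = 5 + (C.numInputs + 4 + (i + 1)) by
            omega]
        refine (look_append_right [_, _, _, _, _] _ _).trans ?_
        have := look_append_right ((e.k1.getD .V).bits ++ List.ofFn w)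
          (e.k2.isSome :: ((e.k2.getD .V).bits ++ List.ofFn w)) (i + 1)
        rw [hl, look_cons_succ] at this
        exact this
      have e1 : 2 * (build C h).coeffBits + (build C h).varBits + 3 = C.numInputs + 9 := by
        change 2 * 1 + (C.numInputs + 4) + 3 = _
        omega
      rw [e1]
      change (if ((build C h).out x y).getD (C.numInputs + 9) false = true then
        some (bitsAt ((build C h).out x y) (C.numInputs + 10) (C.numInputs + 4)) else none) = _
      rw [hf, hb]
      cases e.k2 <;> rfl
    rw [h1, h2]
    exact C_mul_factor_mul_factor _ e w

theorem wellFormed_build : (build C h).WellFormed := by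
  refine ⟨rfl, ?_, fun x y => ?_⟩
  · change (allOutputs C).length = 2 * (1 + 1) + 2 * (C.numInputs + 4 + 1)
    simp only [allOutputs, nodeWires, List.length_append, List.length_ofFn, List.length_cons,
      List.length_nil]
    omega
  · exact (den_build C h x y).trans_ne one_ne_zero

theorem coef_unit (e : Entry) (c : Bool) : e.coef c = 0 ∨ e.coef c = 1 ∨ e.coef c = -1 := by
  unfold Entry.coef
  split_ifs <;> simp

theorem neg_eq_of_coef_eq {e e' : Entry} {c : Bool} (h0 : e.coef c ≠ 0)
    (hc : e.coef c = e'.coef c) : e.neg = e'.neg := by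
  unfold Entry.coef at h0 hc
  cases h1 : e.present c <;> cases h2 : e'.present c <;> cases h3 : e.neg <;> cases h4 : e'.neg <;>
    simp only [h1, h2, h3, h4, if_true, if_false, Bool.false_eq_true] at h0 hc ⊢ <;>
    first | exact absurd rfl h0 | (exfalso; norm_num at hc)

theorem totalDegree_factor_le {n : ℕ} (v : Option (Fin n → Bool)) :
    (QuadInstance.factor v).totalDegree ≤ 1 := by
  cases v with
  | none => simp [QuadInstance.factor]
  | some v => simp [QuadInstance.factor]

theorem coeff_build_unit : (build C h).coeff x y = 0 ∨ (build C h).coeff x y = 1 ∨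
    (build C h).coeff x y = -1 := by
  rw [coeff_build]
  cases entry C x y with
  | none => exact Or.inl rfl
  | some e => exact coef_unit e _

/-- The exponent vector of a monomial. -/
noncomputable def expoAt : (Fin (C.numInputs + 4) → Bool) →₀ ℕ :=
  (entry C x y).elim 0 fun e => e.expo (e.sel.pick (rawAt C (nodeOf C x)) (nodeOf C x)
    (succBits (nodeOf C x)))

theorem poly_build : (build C h).poly x =
    ∑ y : Fin 2 → Bool, MvPolynomial.monomial (expoAt C x y) ((build C h).coeff x y) := by
  refine Finset.sum_congr rfl fun (y : Fin 2 → Bool) _ => ?_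
  refine (monomial_build C h x y).trans ?_
  rw [coeff_build, expoAt]
  cases entry C x y with
  | none => exact MvPolynomial.monomial_zero.symm
  | some e => rfl

/-- Equal nonzero coefficients mean equal signs, and equal exponents mean equal families; so the
keys agree, and `nodup_key_eqn` identifies the positions. -/
theorem expoAt_injective (y y' : Fin 2 → Bool) (h0 : (build C h).coeff x y ≠ 0)
    (hc : (build C h).coeff x y = (build C h).coeff x y') (he : expoAt C x y = expoAt C x y') :
    y = y' := by
  rw [coeff_build, coeff_build] at hc
  rw [coeff_build] at h0
  rw [expoAt, expoAt] at he
  cases h1 : entry C x y with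
  | none => simp [h1] at h0
  | some e =>
    cases h2 : entry C x y' with
    | none => simp [h1, h2] at h0 hc; exact absurd hc h0
    | some e' =>
      simp only [h1, h2, Option.elim_some] at h0 hc he
      have hk : e.key.2 = e'.key.2 := by
        rw [← Entry.expo_key e, ← Entry.expo_key e', he]
      have hn : e.neg = e'.neg := neg_eq_of_coef_eq h0 hc
      have hkey : e.key = e'.key := Prod.ext hn hk
      rw [entry, entryAt] at h1 h2
      obtain ⟨hl, hg⟩ := List.getElem?_eq_some_iff.1 h1
      obtain ⟨hl', hg'⟩ := List.getElem?_eq_some_iff.1 h2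
      have hnd := nodup_key_eqn (Nat.ofBits (tagOf C x)) (rawAt C (nodeOf C x)).code
        (rawAt C (nodeOf C x)).fp (rawAt C (nodeOf C x)).fl (rawAt C (nodeOf C x)).fr
      refine ofBits_two_injective ((hnd.getElem_inj_iff (hi := by simpa using hl)
        (hj := by simpa using hl')).1 ?_)
      rw [List.getElem_map, List.getElem_map, hg, hg', hkey]

theorem fourMonomials_build : (build C h).FourMonomialsUnitCoeffs := by
  classical
  intro (x : Fin (C.numInputs + 5) → Bool)
  have hcard : Fintype.card (Fin 2 → Bool) = 4 := by simp
  refine ⟨?_, fun y hy => (coeff_build_unit C h x y).resolve_left hy, ?_, ?_, fun m hm => ?_⟩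
  · exact (Finset.card_le_univ _).trans hcard.le
  · refine (MvPolynomial.totalDegree_finsetSum _ _).trans (Finset.sup_le fun y _ => ?_)
    refine (MvPolynomial.totalDegree_mul _ _).trans ?_
    have h1 := MvPolynomial.totalDegree_mul (MvPolynomial.C ((build C h).coeff x y))
      (QuadInstance.factor (optBitsAt ((build C h).out x y) (2 * (build C h).coeffBits + 2)
        (build C h).varBits))
    rw [MvPolynomial.totalDegree_C] at h1
    have h2 := totalDegree_factor_le (optBitsAt ((build C h).out x y)
      (2 * (build C h).coeffBits + 2) (build C h).varBits)
    have h3 := totalDegree_factor_le (optBitsAt ((build C h).out x y)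
      (2 * (build C h).coeffBits + (build C h).varBits + 3) (build C h).varBits)
    omega
  · have hsub : ((build C h).poly x).support ⊆
        Finset.univ.image fun y : Fin 2 → Bool => expoAt C x y := by
      rw [poly_build C h x]
      refine MvPolynomial.support_sum.trans fun m hm => ?_
      obtain ⟨y, -, hy⟩ := Finset.mem_biUnion.1 hm
      have := MvPolynomial.support_monomial_subset hy
      exact Finset.mem_image.2 ⟨y, Finset.mem_univ _, (Finset.mem_singleton.1 this).symm⟩
    exact (Finset.card_le_card hsub).trans (Finset.card_image_le.trans hcard.le)
  · have := coeff_sum_monomial_unit (expoAt C x) ((build C h).coeff x)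
      (coeff_build_unit C h x) (expoAt_injective C h x) m
    rw [← poly_build C h x] at this
    exact this.resolve_left (MvPolynomial.mem_support_iff.1 hm)

theorem aeval_monomial_entry {n : ℕ} (z : (Fin (n + 4) → Bool) → ℝ) (e : Entry) (w : Fin n → Bool)
    (c : Bool) : MvPolynomial.aeval z (MvPolynomial.monomial (e.expo w) (e.coef c)) =
      e.val (fun k v => z (varName k v)) w c := by
  rw [Entry.expo, ← mul_one (e.coef c), ← MvPolynomial.monomial_mul, map_mul,
    MvPolynomial.aeval_monomial, MvPolynomial.aeval_monomial, Entry.val]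
  have h1 : ((algebraMap ℚ ℝ) (e.coef c)) =
      (if e.present c then if e.neg then -1 else 1 else 0 : ℝ) := by
    unfold Entry.coef
    split_ifs <;> simp
  rw [h1]
  rcases e with ⟨_, _, _, _ | k, _ | k'⟩ <;> simp

theorem aeval_poly_build (z : (Fin (C.numInputs + 4) → Bool) → ℝ) :
    MvPolynomial.aeval z ((build C h).poly x) =
      ((eqn (Nat.ofBits (tagOf C x)) (rawAt C (nodeOf C x)).code (rawAt C (nodeOf C x)).fp
        (rawAt C (nodeOf C x)).fl (rawAt C (nodeOf C x)).fr).map fun e =>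
        e.val (fun k v => z (varName k v)) (e.sel.pick (rawAt C (nodeOf C x)) (nodeOf C x)
          (succBits (nodeOf C x))) (carryAt (nodeOf C x) C.numInputs)).sum := by
  rw [← sum_twoBits _ (by rw [List.length_map]; exact length_eqn _ _ _ _ _)]
  refine (map_sum _ _ _).trans (Finset.sum_congr rfl fun (y : Fin 2 → Bool) _ => ?_)
  rw [List.getElem?_map]
  refine (congrArg _ (monomial_build C h x y)).trans ?_
  have he : entry C x y = (eqn (Nat.ofBits (tagOf C x)) (rawAt C (nodeOf C x)).code
    (rawAt C (nodeOf C x)).fp (rawAt C (nodeOf C x)).fl (rawAt C (nodeOf C x)).fr)[Nat.ofBits y]? :=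
        rfl
  rw [he]
  cases (eqn (Nat.ofBits (tagOf C x)) (rawAt C (nodeOf C x)).code (rawAt C (nodeOf C x)).fp
        (rawAt C (nodeOf C x)).fl (rawAt C (nodeOf C x)).fr)[Nat.ofBits y]? with
  | none => exact map_zero _
  | some e => exact aeval_monomial_entry z e _ _

/-- A name consists of the code of a family and a node, so assignments to names and families of
functions on nodes are interchangeable. -/
theorem mem_succQUAD_build : build C h ∈ SuccQUAD ↔
    ∃ Q : Kind → (Fin C.numInputs → Bool) → ℝ,
      Solves Q (rawAt C) succBits (fun u => carryAt u C.numInputs) := by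
  constructor
  · rintro ⟨-, z, hz⟩
    refine ⟨fun k v => z (varName k v), fun tag u => ?_⟩
    -- Five bits reach exactly the tags below `32`; larger tags have no entries and impose nothing.
    by_cases ht : tag < 32
    · have := hz (Fin.append u fun i : Fin 5 => tag.testBit i)
      have h1 : nodeOf C (Fin.append u fun i : Fin 5 => tag.testBit i) = u := by
        funext i; simp [nodeOf]
      have h2 : Nat.ofBits (tagOf C (Fin.append u fun i : Fin 5 => tag.testBit i)) = tag := by
        have : tagOf C (Fin.append u fun i : Fin 5 => tag.testBit i) =
            fun i : Fin 5 => tag.testBit i := by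
          funext i; simp [tagOf]
        rw [this, Nat.ofBits_testBit, Nat.mod_eq_of_lt ht]
      have h3 := (aeval_poly_build C h (Fin.append u fun i : Fin 5 => tag.testBit i) z).symm.trans
        this
      rw [h1, h2] at h3
      exact h3
    · rw [eqn_of_large (by omega)]
      rfl
  · rintro ⟨Q, hQ⟩
    have hinv : Function.Injective Kind.code := by
      intro k k' hk
      cases k <;> cases k' <;> first | rfl | exact absurd hk (by decide)
    classical
    -- The fallback `.V` never matters, since the equations only mention names of the form `varName
    -- k v`.
    refine ⟨wellFormed_build C h, fun w : Fin (C.numInputs + 4) → Bool => Q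
        (if hw : ∃ k : Kind, kindIndex w = k.code then
      hw.choose else .V) fun i : Fin C.numInputs => w (Fin.castLE (by omega) (Fin.natAdd 4 i)), fun
          x => ?_⟩
    refine (aeval_poly_build C h x _).trans ?_
    convert hQ (Nat.ofBits (tagOf C x)) (nodeOf C x) using 6 with e k
    funext v
    have hw : ∃ k' : Kind, kindIndex (varName k v) = k'.code := ⟨k, kindIndex_varName k v⟩
    have hk : hw.choose = k := by
      exact (hinv (Fin.ext ((kindIndex_varName k v).symm.trans hw.choose_spec))).symm
    simp only [dif_pos hw, hk, varName_node]

end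

end SuccReals

namespace SuccReals

/-! ### Binary counting -/

/-- A cyclic successor function with a carry, together with the numbers that it enumerates. -/
structure Counts {V : Type} (succ : V → V) (carry : V → Bool) (rank : V → ℕ) : Prop where
  inj : Function.Injective rank
  step : ∀ u, carry u = false → rank (succ u) = rank u + 1
  wrap : ∀ u, carry u = true → rank (succ u) = 0
  top : ∀ u, carry u = true → ∀ v, rank v ≤ rank u

theorem ofBits_succ {n : ℕ} (u : Fin (n + 1) → Bool) :
    Nat.ofBits u = 2 * Nat.ofBits (fun i => u i.succ) + (u 0).toNat := by
  simp [Nat.ofBits, Fin.foldr_succ]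

/-- The induction removes the least significant bit, which passes on a carry; this is why an
arbitrary incoming carry `c` is needed instead of `1`. -/
theorem ofBits_add_carry {n : ℕ} (u : Fin n → Bool) (c : Bool) :
    Nat.ofBits (fun i => (u i).xor (c && carryAt u i)) + 2 ^ n * (c && carryAt u n).toNat =
      Nat.ofBits u + c.toNat := by
  induction n generalizing c with
  | zero => simp [Nat.ofBits, carryAt]
  | succ n ih =>
    have h : ∀ i, i ≤ n → carryAt u (i + 1) = (u 0 && carryAt (fun i => u i.succ) i) := by
      intro i hi
      rw [Bool.eq_iff_iff]
      simp only [carryAt, decide_eq_true_eq, Bool.and_eq_true]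
      constructor
      · exact fun h => ⟨h 0 (by simp), fun j hj => h j.succ (by simpa using hj)⟩
      · rintro ⟨h, h'⟩ j
        refine Fin.cases (fun _ => h) (fun j hj => h' j (by simpa using hj)) j
    have h1 := ih (fun i => u i.succ) (c && u 0)
    rw [ofBits_succ, ofBits_succ u, h n le_rfl, ← Bool.and_assoc]
    have h2 : (fun i : Fin n => (u i.succ).xor (c && carryAt u i.succ)) =
        fun i : Fin n => (u i.succ).xor (c && u 0 && carryAt (fun i => u i.succ) i) := by
      funext i
      rw [Fin.val_succ, h i i.2.le, ← Bool.and_assoc]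
    simp only [h2]
    have h0 : carryAt u ((0 : Fin (n + 1)) : ℕ) = true := carryAt_zero u
    rw [h0, Bool.and_true, pow_succ]
    have h3 : ((u 0).xor c).toNat + 2 * (c && u 0).toNat = (u 0).toNat + c.toNat := by
      cases u 0 <;> cases c <;> rfl
    set a := Nat.ofBits fun i : Fin n => (u i.succ).xor (c && u 0 && carryAt (fun i => u i.succ) i)
    set b := Nat.ofBits fun i : Fin n => u i.succ
    have h4 : 2 ^ n * 2 * (c && u 0 && carryAt (fun i => u i.succ) n).toNat =
      2 * (2 ^ n * (c && u 0 && carryAt (fun i => u i.succ) n).toNat) := by ring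
    rw [h4]
    omega

theorem counts_succBits (n : ℕ) :
    Counts (succBits (n := n)) (fun u => carryAt u n) Nat.ofBits := by
  have key : ∀ u : Fin n → Bool, Nat.ofBits (succBits u) + 2 ^ n * (carryAt u n).toNat =
      Nat.ofBits u + 1 := fun u => by
    have := ofBits_add_carry u true
    simp only [Bool.true_and, Bool.toNat_true] at this
    exact this
  refine ⟨fun u v h => ?_, fun u hu => ?_, fun u hu => ?_, fun u hu v => ?_⟩
  · funext i
    rw [← Nat.testBit_ofBits_lt u i i.2, ← Nat.testBit_ofBits_lt v i i.2, h]
  · have := key u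
    simpa [hu] using this
  -- An outgoing carry contributes `2 ^ n` to a sum that is at most `2 ^ n`, so nothing remains for
  -- the successor, and `u` has the largest value.
  · have := key u
    have h2 := Nat.ofBits_lt_two_pow u
    simp only [hu, Bool.toNat_true, mul_one] at this
    omega
  · have := key u
    have h2 := Nat.ofBits_lt_two_pow v
    simp only [hu, Bool.toNat_true, mul_one] at this
    omega

/-! ### Consequences of a cyclic enumeration. -/

namespace Counts

variable {V : Type} [Fintype V] {succ : V → V} {carry : V → Bool} {rank : V → ℕ}

/-- The rank of a successor is positive without carry and zero with carry, so the carries agree.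
Without carry, the ranks agree too; with carry, both ranks are maximal. -/
theorem bijective (hc : Counts succ carry rank) : Function.Bijective succ := by
  refine Finite.injective_iff_bijective.1 fun u v h => hc.inj ?_
  cases hu : carry u <;> cases hv : carry v
  · have := hc.step u hu
    rw [h, hc.step v hv] at this
    omega
  · have := hc.step u hu
    rw [h, hc.wrap v hv] at this
    omega
  · have := hc.wrap u hu
    rw [h, hc.step v hv] at this
    omega
  · exact le_antisymm (hc.top v hv u) (hc.top u hu v)

/-- An element of maximal rank must carry, as otherwise its successor would have a greater rank. -/
theorem existsUnique_carry [Nonempty V] (hc : Counts succ carry rank) : ∃! u, carry u = true := by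
  obtain ⟨u, hu⟩ := Finite.exists_max rank
  refine ⟨u, ?_, fun v hv => hc.inj (le_antisymm (hu v) (hc.top v hv u))⟩
  by_contra h
  have h1 := hc.step u (by simpa using h)
  have := hu (succ u)
  omega

/-- The reset at the carry anchors the enumeration at `0`; all other values follow from those of the
predecessors, which exist because `succ` is surjective. -/
theorem enum_eq (hc : Counts succ carry rank) {E : V → ℝ}
    (hE : ∀ u, E (succ u) = if carry u then 0 else E u + 1) (u : V) : E u = rank u := by
  induction hn : rank u using Nat.strong_induction_on generalizing u with
  | _ n ih =>
    obtain ⟨w, rfl⟩ := hc.bijective.2 u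
    rw [hE]
    cases hw : carry w
    · have := hc.step w hw
      rw [if_neg (by simp), ih (rank w) (by omega) w rfl, ← hn, this]
      push_cast
      rfl
    · rw [hc.wrap w hw] at hn
      rw [if_pos rfl, ← hn, Nat.cast_zero]

end Counts

/-! ### The equations, spelled out -/

/-- The defining equation of the value of a node. -/
def NodeEq {V : Type} (Q : Kind → V → ℝ) (r : Raw V) (u : V) : Prop :=
  match r.code with
  | 1 => Q .X u = 0
  | 2 => Q .X u = 1
  | 3 => Q .X u = Q .V r.var
  | 4 => Q .X u = Q .L u + Q .R u
  | 5 => Q .X u = Q .L u * Q .R u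
  | 6 => Q .X u = Q .L u - Q .R u
  | 7 => Q .X u = (Q .R u - Q .L u) * Q .Y u - 1
  | 9 => Q .X u = Q .L u * Q .L u + Q .R u * Q .R u
  | 10 => Q .X u = Q .L u * Q .R u
  | _ => True

/-- The equations of the reduction. -/
structure System {V : Type} (Q : Kind → V → ℝ) (raw : V → Raw V) (succ : V → V)
    (carry : V → Bool) : Prop where
  valid : ∀ u, validNode (raw u).code (raw u).fp (raw u).fl (raw u).fr = true
  node : ∀ u, NodeEq Q (raw u) u
  sq : ∀ u, Q .Y u = Q .Z u * Q .Z u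
  left : ∀ u, binCode (raw u).code = true → Q .L u = Q .X (raw u).left
  right : ∀ u, binCode (raw u).code = true → Q .R u = Q .X (raw u).right
  root : ∀ u, (usedCode (raw u).code && !(raw u).fp) = true → Q .X u = 0
  sort : ∀ u, Q .T u = if formCode (raw u).code then 1 else 0
  sortLeft : ∀ u, binCode (raw u).code = true →
    Q .T (raw u).left = if connCode (raw u).code then 1 else 0
  sortRight : ∀ u, binCode (raw u).code = true →
    Q .T (raw u).right = if connCode (raw u).code then 1 else 0
  enum : ∀ u, Q .E (succ u) = if carry u then 0 else Q .E u + 1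
  count : ∀ u, Q .S (succ u) = Q .S u + (if usedCode (raw u).code && !(raw u).fp then 1 else 0) -
    (if carry u then 1 else 0)
  parent : ∀ u, Q .P u = if usedCode (raw u).code && (raw u).fp then Q .E (raw u).par else -1
  parentLeft : ∀ u, binCode (raw u).code = true → Q .P (raw u).left = Q .E u
  parentRight : ∀ u, binCode (raw u).code = true → Q .P (raw u).right = Q .E u
  depth : ∀ u, (usedCode (raw u).code && (raw u).fp) = true → Q .H u = Q .H (raw u).par + 1
  enumLeft : ∀ u, Q .EL u = if binCode (raw u).code then Q .E (raw u).left else -1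
  enumRight : ∀ u, Q .ER u = if binCode (raw u).code then Q .E (raw u).right else -1
  distinct : ∀ u, binCode (raw u).code = true → Q .EL u * Q .W u - Q .ER u * Q .W u = 1
  distLeft : ∀ u, (usedCode (raw u).code && (raw u).fp) = true →
    Q .A u = Q .E u - Q .EL (raw u).par
  distRight : ∀ u, (usedCode (raw u).code && (raw u).fp) = true →
    Q .B u = Q .E u - Q .ER (raw u).par
  child : ∀ u, (usedCode (raw u).code && (raw u).fp) = true → Q .A u * Q .B u = 0

theorem binCode_of_connCode {c : ℕ} (h : connCode c = true) : binCode c = true := by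
  simp only [connCode, binCode, formCode, Bool.or_eq_true, beq_iff_eq] at h ⊢
  omega

/-! ### Translation between lists of entries and equations. -/

section

variable {V : Type} (Q : Kind → V → ℝ) (raw : V → Raw V) (succ : V → V) (carry : V → Bool)

/-- The left-hand side of an equation. -/
noncomputable def lhs (tag : ℕ) (u : V) : ℝ :=
  ((eqn tag (raw u).code (raw u).fp (raw u).fl (raw u).fr).map fun e =>
    e.val Q (e.sel.pick (raw u) u (succ u)) (carry u)).sum

theorem lhs_zero (u : V) : lhs Q raw succ carry 0 u = 0 ↔
    validNode (raw u).code (raw u).fp (raw u).fl (raw u).fr = true := by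
  unfold lhs eqn
  split_ifs with h <;> simp [h, Entry.val, Entry.present]

theorem lhs_node (u : V) : lhs Q raw succ carry 1 u = 0 ↔ NodeEq Q (raw u) u := by
  unfold lhs eqn NodeEq
  generalize (raw u).code = c
  match c with
  | 0 | 8 | n + 11 => simp
  | 1 => simp [Entry.val, Entry.present, Sel.pick]
  | 2 | 3 | 4 | 5 | 6 | 7 | 9 | 10 =>
    simp [Entry.val, Entry.present, Sel.pick]
    constructor <;> intro h <;> linarith

theorem lhs_sq (u : V) : lhs Q raw succ carry 2 u = 0 ↔ Q .Y u = Q .Z u * Q .Z u := by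
  simp only [lhs, eqn, Entry.val, Entry.present, Sel.pick]
  simp
  constructor <;> intro h <;> linarith

theorem lhs_enum (u : V) : lhs Q raw succ carry 9 u = 0 ↔
    Q .E (succ u) = if carry u then 0 else Q .E u + 1 := by
  simp only [lhs, eqn, Entry.val, Entry.present, Sel.pick]
  cases carry u <;> simp <;> constructor <;> intro h <;> linarith

theorem lhs_count (u : V) : lhs Q raw succ carry 10 u = 0 ↔
    Q .S (succ u) = Q .S u + (if usedCode (raw u).code && !(raw u).fp then 1 else 0) -
      (if carry u then 1 else 0) := by
  unfold lhs eqn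
  simp only
  cases usedCode (raw u).code && !(raw u).fp <;> cases carry u <;>
    simp [Entry.val, Entry.present, Sel.pick] <;> constructor <;> intro h <;> linarith

theorem lhs_sort (u : V) : lhs Q raw succ carry 6 u = 0 ↔
    Q .T u = if formCode (raw u).code then 1 else 0 := by
  unfold lhs eqn
  simp only
  cases formCode (raw u).code <;>
    simp [Entry.val, Entry.present, Sel.pick]
  constructor <;> intro h <;> linarith

theorem lhs_sortLeft (u : V) : lhs Q raw succ carry 7 u = 0 ↔ (binCode (raw u).code = true →
    Q .T (raw u).left = if connCode (raw u).code then 1 else 0) := by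
  unfold lhs eqn
  simp only
  cases h1 : connCode (raw u).code
  · cases binCode (raw u).code <;> simp [Entry.val, Entry.present, Sel.pick]
  · simp [Entry.val, Entry.present, Sel.pick, binCode_of_connCode h1]
    constructor <;> intro h <;> linarith

theorem lhs_sortRight (u : V) : lhs Q raw succ carry 8 u = 0 ↔ (binCode (raw u).code = true →
    Q .T (raw u).right = if connCode (raw u).code then 1 else 0) := by
  unfold lhs eqn
  simp only
  cases h1 : connCode (raw u).code
  · cases binCode (raw u).code <;> simp [Entry.val, Entry.present, Sel.pick]
  · simp [Entry.val, Entry.present, Sel.pick, binCode_of_connCode h1]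
    constructor <;> intro h <;> linarith

theorem lhs_parent (u : V) : lhs Q raw succ carry 11 u = 0 ↔
    Q .P u = if usedCode (raw u).code && (raw u).fp then Q .E (raw u).par else -1 := by
  unfold lhs eqn
  simp only
  cases usedCode (raw u).code && (raw u).fp <;> simp [Entry.val, Entry.present, Sel.pick] <;>
    constructor <;> intro h <;> linarith

theorem lhs_enumLeft (u : V) : lhs Q raw succ carry 15 u = 0 ↔
    Q .EL u = if binCode (raw u).code then Q .E (raw u).left else -1 := by
  unfold lhs eqn
  simp only
  cases binCode (raw u).code <;> simp [Entry.val, Entry.present, Sel.pick] <;>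
    constructor <;> intro h <;> linarith

theorem lhs_enumRight (u : V) : lhs Q raw succ carry 16 u = 0 ↔
    Q .ER u = if binCode (raw u).code then Q .E (raw u).right else -1 := by
  unfold lhs eqn
  simp only
  cases binCode (raw u).code <;> simp [Entry.val, Entry.present, Sel.pick] <;>
    constructor <;> intro h <;> linarith

theorem lhs_binary (u : V) :
    (lhs Q raw succ carry 3 u = 0 ↔ (binCode (raw u).code = true → Q .L u = Q .X (raw u).left)) ∧
    (lhs Q raw succ carry 4 u = 0 ↔ (binCode (raw u).code = true → Q .R u = Q .X (raw u).right)) ∧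
    (lhs Q raw succ carry 12 u = 0 ↔ (binCode (raw u).code = true → Q .P (raw u).left = Q .E u)) ∧
    (lhs Q raw succ carry 13 u = 0 ↔ (binCode (raw u).code = true → Q .P (raw u).right = Q .E u)) ∧
    (lhs Q raw succ carry 17 u = 0 ↔ (binCode (raw u).code = true →
      Q .EL u * Q .W u - Q .ER u * Q .W u = 1)) := by
  unfold lhs eqn
  simp only
  cases binCode (raw u).code <;> simp [Entry.val, Entry.present, Sel.pick]
  refine ⟨?_, ?_, ?_, ?_, ?_⟩ <;> constructor <;> intro h <;> linarith

theorem lhs_root (u : V) : lhs Q raw succ carry 5 u = 0 ↔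
    ((usedCode (raw u).code && !(raw u).fp) = true → Q .X u = 0) := by
  unfold lhs eqn
  simp only
  cases usedCode (raw u).code && !(raw u).fp <;> simp [Entry.val, Entry.present, Sel.pick]

theorem lhs_child (u : V) :
    (lhs Q raw succ carry 14 u = 0 ↔ ((usedCode (raw u).code && (raw u).fp) = true →
      Q .H u = Q .H (raw u).par + 1)) ∧
    (lhs Q raw succ carry 18 u = 0 ↔ ((usedCode (raw u).code && (raw u).fp) = true →
      Q .A u = Q .E u - Q .EL (raw u).par)) ∧
    (lhs Q raw succ carry 19 u = 0 ↔ ((usedCode (raw u).code && (raw u).fp) = true →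
      Q .B u = Q .E u - Q .ER (raw u).par)) ∧
    (lhs Q raw succ carry 20 u = 0 ↔ ((usedCode (raw u).code && (raw u).fp) = true →
      Q .A u * Q .B u = 0)) := by
  unfold lhs eqn
  simp only
  cases usedCode (raw u).code && (raw u).fp <;> simp [Entry.val, Entry.present, Sel.pick]
  refine ⟨?_, ?_, ?_⟩ <;> constructor <;> intro h <;> linarith

/-- This separates the syntax of the instance from its meaning: both directions of the reduction
only use `System`. -/
theorem solves_iff_system : Solves Q raw succ carry ↔ System Q raw succ carry := by
  constructor
  · intro h
    have h' : ∀ tag u, lhs Q raw succ carry tag u = 0 := h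
    exact {
      valid := fun u => (lhs_zero Q raw succ carry u).1 (h' _ u)
      node := fun u => (lhs_node Q raw succ carry u).1 (h' _ u)
      sq := fun u => (lhs_sq Q raw succ carry u).1 (h' _ u)
      left := fun u => (lhs_binary Q raw succ carry u).1.1 (h' _ u)
      right := fun u => (lhs_binary Q raw succ carry u).2.1.1 (h' _ u)
      root := fun u => (lhs_root Q raw succ carry u).1 (h' _ u)
      sort := fun u => (lhs_sort Q raw succ carry u).1 (h' _ u)
      sortLeft := fun u => (lhs_sortLeft Q raw succ carry u).1 (h' _ u)
      sortRight := fun u => (lhs_sortRight Q raw succ carry u).1 (h' _ u)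
      enum := fun u => (lhs_enum Q raw succ carry u).1 (h' _ u)
      count := fun u => (lhs_count Q raw succ carry u).1 (h' _ u)
      parent := fun u => (lhs_parent Q raw succ carry u).1 (h' _ u)
      parentLeft := fun u => (lhs_binary Q raw succ carry u).2.2.1.1 (h' _ u)
      parentRight := fun u => (lhs_binary Q raw succ carry u).2.2.2.1.1 (h' _ u)
      depth := fun u => (lhs_child Q raw succ carry u).1.1 (h' _ u)
      enumLeft := fun u => (lhs_enumLeft Q raw succ carry u).1 (h' _ u)
      enumRight := fun u => (lhs_enumRight Q raw succ carry u).1 (h' _ u)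
      distinct := fun u => (lhs_binary Q raw succ carry u).2.2.2.2.1 (h' _ u)
      distLeft := fun u => (lhs_child Q raw succ carry u).2.1.1 (h' _ u)
      distRight := fun u => (lhs_child Q raw succ carry u).2.2.1.1 (h' _ u)
      child := fun u => (lhs_child Q raw succ carry u).2.2.2.1 (h' _ u) }
  · intro h tag u
    change lhs Q raw succ carry tag u = 0
    match tag with
    | 0 => exact (lhs_zero Q raw succ carry u).2 (h.valid u)
    | 1 => exact (lhs_node Q raw succ carry u).2 (h.node u)
    | 2 => exact (lhs_sq Q raw succ carry u).2 (h.sq u)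
    | 3 => exact (lhs_binary Q raw succ carry u).1.2 (h.left u)
    | 4 => exact (lhs_binary Q raw succ carry u).2.1.2 (h.right u)
    | 5 => exact (lhs_root Q raw succ carry u).2 (h.root u)
    | 6 => exact (lhs_sort Q raw succ carry u).2 (h.sort u)
    | 7 => exact (lhs_sortLeft Q raw succ carry u).2 (h.sortLeft u)
    | 8 => exact (lhs_sortRight Q raw succ carry u).2 (h.sortRight u)
    | 9 => exact (lhs_enum Q raw succ carry u).2 (h.enum u)
    | 10 => exact (lhs_count Q raw succ carry u).2 (h.count u)
    | 11 => exact (lhs_parent Q raw succ carry u).2 (h.parent u)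
    | 12 => exact (lhs_binary Q raw succ carry u).2.2.1.2 (h.parentLeft u)
    | 13 => exact (lhs_binary Q raw succ carry u).2.2.2.1.2 (h.parentRight u)
    | 14 => exact (lhs_child Q raw succ carry u).1.2 (h.depth u)
    | 15 => exact (lhs_enumLeft Q raw succ carry u).2 (h.enumLeft u)
    | 16 => exact (lhs_enumRight Q raw succ carry u).2 (h.enumRight u)
    | 17 => exact (lhs_binary Q raw succ carry u).2.2.2.2.2 (h.distinct u)
    | 18 => exact (lhs_child Q raw succ carry u).2.1.2 (h.distLeft u)
    | 19 => exact (lhs_child Q raw succ carry u).2.2.1.2 (h.distRight u)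
    | 20 => exact (lhs_child Q raw succ carry u).2.2.2.2 (h.child u)
    | n + 21 => rfl

end

end SuccReals

namespace SuccReals

/-! ### From a solution to a true sentence -/

theorem usedCode_cases {c : ℕ} (h : usedCode c = true) :
    c = 1 ∨ c = 2 ∨ c = 3 ∨ c = 4 ∨ c = 5 ∨ c = 6 ∨ c = 7 ∨ c = 9 ∨ c = 10 := by
  simp only [usedCode, leafCode, binCode, formCode, Bool.or_eq_true, beq_iff_eq] at h
  omega

theorem usedCode_of_binCode {c : ℕ} (h : binCode c = true) : usedCode c = true := by
  simp [usedCode, h]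

namespace System

variable {V : Type} {Q : Kind → V → ℝ} {raw : V → Raw V} {succ : V → V} {carry : V → Bool}
  {rank : V → ℕ}

theorem fl_fr_of_leaf (hS : System Q raw succ carry) {u : V} (h : leafCode (raw u).code = true) :
    (raw u).fl = false ∧ (raw u).fr = false ∧ (raw u).fp = true := by
  have := hS.valid u
  have h0 : ((raw u).code == 0) = false := by
    simp only [leafCode, Bool.or_eq_true, beq_iff_eq] at h
    simp
    omega
  have h1 : binCode (raw u).code = false := by
    simp only [leafCode, Bool.or_eq_true, beq_iff_eq] at h
    rcases h with (h | h) | h <;> rw [h] <;> rfl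
  simp only [validNode, h0, h, h1, Bool.false_or, Bool.true_and, Bool.false_and, Bool.or_false,
    Bool.and_eq_true, Bool.not_eq_true'] at this
  tauto

theorem fl_fr_of_bin (hS : System Q raw succ carry) {u : V} (h : binCode (raw u).code = true) :
    (raw u).fl = true ∧ (raw u).fr = true ∧
      ((raw u).fp = true ∨ formCode (raw u).code = true) := by
  have := hS.valid u
  have h0 : ((raw u).code == 0) = false := by
    simp only [binCode, formCode, Bool.or_eq_true, beq_iff_eq] at h
    simp
    omega
  have h1 : leafCode (raw u).code = false := by
    simp only [binCode, formCode, Bool.or_eq_true, beq_iff_eq] at h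
    rcases h with (h | h) | ((h | h) | h) | h <;> rw [h] <;> rfl
  simp only [validNode, h0, h, h1, Bool.false_or, Bool.true_and, Bool.false_and,
    Bool.and_eq_true, Bool.or_eq_true] at this
  tauto

variable [Fintype V]

theorem enum_eq (hS : System Q raw succ carry) (hc : Counts succ carry rank) (u : V) :
    Q .E u = rank u := hc.enum_eq hS.enum u

/-- The parent pointers of the children of a node are correct, and depths increase. -/
theorem child_facts (hS : System Q raw succ carry) (hc : Counts succ carry rank) {u w : V}
    (hb : binCode (raw u).code = true) (hw : w = (raw u).left ∨ w = (raw u).right) :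
    usedCode (raw w).code = true ∧ (raw w).fp = true ∧ (raw w).par = u ∧ Q .H w = Q .H u + 1 ∧
      formCode (raw w).code = connCode (raw u).code := by
  have hP : Q .P w = Q .E u := by
    rcases hw with rfl | rfl
    · exact hS.parentLeft u hb
    · exact hS.parentRight u hb
  have hT : Q .T w = if connCode (raw u).code then 1 else 0 := by
    rcases hw with rfl | rfl
    · exact hS.sortLeft u hb
    · exact hS.sortRight u hb
  have h1 := hS.parent w
  rw [hP, hS.enum_eq hc] at h1
  -- The value `P w = E u` is a nonnegative rank, whereas a node without a parent or not in use has
  -- `P w = -1`.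
  have h2 : (usedCode (raw w).code && (raw w).fp) = true := by
    by_contra h
    rw [if_neg h] at h1
    have : (0 : ℝ) ≤ rank u := Nat.cast_nonneg _
    linarith
  have h3 := hS.depth w h2
  rw [if_pos h2, hS.enum_eq hc] at h1
  -- Equal enumeration values mean equal nodes.
  have h4 : (raw w).par = u := hc.inj (by exact_mod_cast h1.symm)
  rw [hS.sort w] at hT
  simp only [Bool.and_eq_true] at h2
  refine ⟨h2.1, h2.2, h4, by rw [h3, h4], ?_⟩
  cases h5 : formCode (raw w).code <;> cases h6 : connCode (raw u).code <;> simp [h5, h6] at hT ⊢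

omit [Fintype V] in
theorem left_ne_right (hS : System Q raw succ carry) {u : V} (hb : binCode (raw u).code = true) :
    (raw u).left ≠ (raw u).right := by
  intro h
  have h1 := hS.distinct u hb
  rw [hS.enumLeft u, hS.enumRight u, if_pos hb, if_pos hb, h, sub_self] at h1
  exact zero_ne_one h1

/-- Summed over all nodes, the differences `S (succ u) - S u` vanish because `succ` is a
permutation. So there are as many roots as carries, namely one. -/
theorem existsUnique_root [Nonempty V] (hS : System Q raw succ carry) (hc : Counts succ carry rank)
    :
    ∃! u, (usedCode (raw u).code && !(raw u).fp) = true := by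
  classical
  have h1 : ∑ u, Q .S (succ u) = ∑ u, Q .S u := hc.bijective.sum_comp (Q .S)
  simp only [hS.count, Finset.sum_sub_distrib, Finset.sum_add_distrib] at h1
  have h2 : (∑ u, if (usedCode (raw u).code && !(raw u).fp) = true then (1 : ℝ) else 0) =
      ∑ u, if carry u = true then (1 : ℝ) else 0 := by linarith
  rw [Finset.sum_boole, Finset.sum_boole, Nat.cast_inj] at h2
  have h3 : (Finset.univ.filter fun u => carry u = true).card = 1 := by
    rw [Finset.card_eq_one]
    obtain ⟨u, hu, hu'⟩ := hc.existsUnique_carry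
    exact ⟨u, by ext v; simp only [Finset.mem_filter, Finset.mem_univ, true_and,
      Finset.mem_singleton]; exact ⟨hu' v, fun h => h ▸ hu⟩⟩
  rw [h3, Finset.card_eq_one] at h2
  obtain ⟨u, hu⟩ := h2
  refine ⟨u, ?_, fun v hv => ?_⟩
  · have : u ∈ Finset.univ.filter fun u => (usedCode (raw u).code && !(raw u).fp) = true := by
      rw [hu]; exact Finset.mem_singleton_self u
    exact (Finset.mem_filter.1 this).2
  · have : v ∈ Finset.univ.filter fun u => (usedCode (raw u).code && !(raw u).fp) = true :=
      Finset.mem_filter.2 ⟨Finset.mem_univ _, hv⟩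
    rw [hu] at this
    exact Finset.mem_singleton.1 this

omit [Fintype V] in
-- On a finite set, any real-valued function gives a strict order that is well-founded in both
-- directions. Hence the depths need neither be integers nor have a prescribed value at the root.
theorem wellFounded_gt [Finite V] (f : V → ℝ) : WellFounded fun a b : V => f b < f a := by
  have : IsTrans V fun a b => f b < f a := ⟨fun _ _ _ h h' => h'.trans h⟩
  have : Std.Irrefl fun a b : V => f b < f a := ⟨fun _ h => lt_irrefl _ h⟩
  exact Finite.wellFounded_of_trans_of_irrefl _

omit [Fintype V] in
theorem wellFounded_lt [Finite V] (f : V → ℝ) : WellFounded fun a b : V => f a < f b := by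
  have : IsTrans V fun a b => f a < f b := ⟨fun _ _ _ h h' => h.trans h'⟩
  have : Std.Irrefl fun a b : V => f a < f b := ⟨fun _ h => lt_irrefl _ h⟩
  exact Finite.wellFounded_of_trans_of_irrefl _

/-- Every node in use is the root of the tree of a term or of a formula. -/
theorem exists_isAt (hS : System Q raw succ carry) (hc : Counts succ carry rank) (u : V) :
    usedCode (raw u).code = true →
    (formCode (raw u).code = false → ∃ t : Term V,
      t.IsAt (fun v => (raw v).toNode) (raw u).toNode.parent u ∧ t.eval (Q .V) = Q .X u) ∧
    (formCode (raw u).code = true → ∃ φ : Formula V,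
      φ.IsAt (fun v => (raw v).toNode) (raw u).toNode.parent u ∧ φ.IsNormal ∧
        (Q .X u = 0 → φ.Holds (Q .V))) := by
  -- Children have depth greater by one, so the induction hypothesis is available at all nodes of
  -- greater depth.
  induction u using (wellFounded_gt (Q .H)).induction with
  | _ u ih =>
  intro hu
  have hn := hS.node u
  unfold NodeEq at hn
  have hleaf : ∀ ℓ : Label V, leafCode (raw u).code = true →
      decodeLabel (raw u).code (raw u).var = some ℓ →
      (raw u).toNode = ⟨some ℓ, (raw u).toNode.parent, none, none⟩ := by
    intro ℓ h1 h2
    obtain ⟨h3, h4, -⟩ := hS.fl_fr_of_leaf h1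
    simp [Raw.toNode, h2, h3, h4]
  have hbin : ∀ ℓ : Label V, binCode (raw u).code = true →
      decodeLabel (raw u).code (raw u).var = some ℓ →
      (raw u).toNode = ⟨some ℓ, (raw u).toNode.parent, some (raw u).left, some (raw u).right⟩ := by
    intro ℓ h1 h2
    obtain ⟨h3, h4, -⟩ := hS.fl_fr_of_bin h1
    simp [Raw.toNode, h2, h3, h4]
  have hterm : binCode (raw u).code = true → connCode (raw u).code = false →
      ∀ w, w = (raw u).left ∨ w = (raw u).right → ∃ t : Term V,
        t.IsAt (fun v => (raw v).toNode) (some u) w ∧ t.eval (Q .V) = Q .X w := by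
    intro h1 h2 w hw
    obtain ⟨h3, h4, h5, h6, h7⟩ := hS.child_facts hc h1 hw
    obtain ⟨t, ht, ht'⟩ := (ih w (by rw [h6]; linarith) h3).1 (by rw [h7, h2])
    have : (raw w).toNode.parent = some u := by simp [Raw.toNode, h4, h5]
    exact ⟨t, by rwa [this] at ht, ht'⟩
  have hform : binCode (raw u).code = true → connCode (raw u).code = true →
      ∀ w, w = (raw u).left ∨ w = (raw u).right → ∃ φ : Formula V,
        φ.IsAt (fun v => (raw v).toNode) (some u) w ∧ φ.IsNormal ∧
          (Q .X w = 0 → φ.Holds (Q .V)) := by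
    intro h1 h2 w hw
    obtain ⟨h3, h4, h5, h6, h7⟩ := hS.child_facts hc h1 hw
    obtain ⟨t, ht, ht'⟩ := (ih w (by rw [h6]; linarith) h3).2 (by rw [h7, h2])
    have : (raw w).toNode.parent = some u := by simp [Raw.toNode, h4, h5]
    exact ⟨t, by rwa [this] at ht, ht'⟩
  -- The cases are, in this order, the constants `0` and `1`, variables, `+`, `·`, `=`, `<`, `∧` and
  -- `∨`.
  rcases usedCode_cases hu with h | h | h | h | h | h | h | h | h
  · rw [h] at hn
    refine ⟨fun _ => ⟨.zero, hleaf _ (by rw [h]; rfl) (by rw [h]; rfl), hn.symm⟩, fun h' => ?_⟩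
    rw [h] at h'
    exact absurd h' (by decide)
  · rw [h] at hn
    refine ⟨fun _ => ⟨.one, hleaf _ (by rw [h]; rfl) (by rw [h]; rfl), hn.symm⟩, fun h' => ?_⟩
    rw [h] at h'
    exact absurd h' (by decide)
  · rw [h] at hn
    refine ⟨fun _ => ⟨.var (raw u).var, hleaf _ (by rw [h]; rfl) (by rw [h]; rfl), hn.symm⟩,
      fun h' => ?_⟩
    rw [h] at h'
    exact absurd h' (by decide)
  · rw [h] at hn
    have hb : binCode (raw u).code = true := by rw [h]; rfl
    have hcn : connCode (raw u).code = false := by rw [h]; rfl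
    obtain ⟨s, hs, hs'⟩ := hterm hb hcn _ (Or.inl rfl)
    obtain ⟨t, ht, ht'⟩ := hterm hb hcn _ (Or.inr rfl)
    refine ⟨fun _ => ⟨.add s t, ⟨_, _, hS.left_ne_right hb, hbin _ hb (by rw [h]; rfl), hs, ht⟩,
        ?_⟩,
      fun h' => ?_⟩
    · rw [Term.eval, hs', ht', ← hS.left u hb, ← hS.right u hb]
      exact hn.symm
    · rw [h] at h'
      exact absurd h' (by decide)
  · rw [h] at hn
    have hb : binCode (raw u).code = true := by rw [h]; rfl
    have hcn : connCode (raw u).code = false := by rw [h]; rfl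
    obtain ⟨s, hs, hs'⟩ := hterm hb hcn _ (Or.inl rfl)
    obtain ⟨t, ht, ht'⟩ := hterm hb hcn _ (Or.inr rfl)
    refine ⟨fun _ => ⟨.mul s t, ⟨_, _, hS.left_ne_right hb, hbin _ hb (by rw [h]; rfl), hs, ht⟩,
        ?_⟩,
      fun h' => ?_⟩
    · rw [Term.eval, hs', ht', ← hS.left u hb, ← hS.right u hb]
      exact hn.symm
    · rw [h] at h'
      exact absurd h' (by decide)
  · rw [h] at hn
    have hb : binCode (raw u).code = true := by rw [h]; rfl
    have hcn : connCode (raw u).code = false := by rw [h]; rfl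
    obtain ⟨s, hs, hs'⟩ := hterm hb hcn _ (Or.inl rfl)
    obtain ⟨t, ht, ht'⟩ := hterm hb hcn _ (Or.inr rfl)
    refine ⟨fun h' => ?_, fun _ => ⟨.eq s t, ⟨_, _, hS.left_ne_right hb,
      hbin _ hb (by rw [h]; rfl), hs, ht⟩, trivial, fun h0 => ?_⟩⟩
    · rw [h] at h'
      exact absurd h' (by decide)
    · rw [Formula.Holds, hs', ht', ← hS.left u hb, ← hS.right u hb]
      simp only at hn
      linarith
  · rw [h] at hn
    have hb : binCode (raw u).code = true := by rw [h]; rfl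
    have hcn : connCode (raw u).code = false := by rw [h]; rfl
    obtain ⟨s, hs, hs'⟩ := hterm hb hcn _ (Or.inl rfl)
    obtain ⟨t, ht, ht'⟩ := hterm hb hcn _ (Or.inr rfl)
    refine ⟨fun h' => ?_, fun _ => ⟨.lt s t, ⟨_, _, hS.left_ne_right hb,
      hbin _ hb (by rw [h]; rfl), hs, ht⟩, trivial, fun h0 => ?_⟩⟩
    · rw [h] at h'
      exact absurd h' (by decide)
    · rw [Formula.Holds, hs', ht', ← hS.left u hb, ← hS.right u hb]
      simp only at hn
      rw [h0, hS.sq u] at hn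
      -- The equation now reads `(R - L) * Z² = 1`, which is impossible for `R ≤ L`.
      by_contra hle
      have h1 : (Q .R u - Q .L u) * (Q .Z u * Q .Z u) ≤ 0 :=
        mul_nonpos_of_nonpos_of_nonneg (by linarith) (mul_self_nonneg _)
      linarith
  · rw [h] at hn
    have hb : binCode (raw u).code = true := by rw [h]; rfl
    have hcn : connCode (raw u).code = true := by rw [h]; rfl
    obtain ⟨s, hs, hs1, hs2⟩ := hform hb hcn _ (Or.inl rfl)
    obtain ⟨t, ht, ht1, ht2⟩ := hform hb hcn _ (Or.inr rfl)
    refine ⟨fun h' => ?_, fun _ => ⟨.and s t, ⟨_, _, hS.left_ne_right hb,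
      hbin _ hb (by rw [h]; rfl), hs, ht⟩, ⟨hs1, ht1⟩, fun h0 => ?_⟩⟩
    · rw [h] at h'
      exact absurd h' (by decide)
    · simp only at hn
      rw [h0] at hn
      -- A vanishing sum of two squares makes the values of both conjuncts zero.
      have h1 := mul_self_nonneg (Q .L u)
      have h2 := mul_self_nonneg (Q .R u)
      refine ⟨hs2 ?_, ht2 ?_⟩
      · rw [← hS.left u hb]
        exact mul_self_eq_zero.1 (by linarith)
      · rw [← hS.right u hb]
        exact mul_self_eq_zero.1 (by linarith)
  · rw [h] at hn
    have hb : binCode (raw u).code = true := by rw [h]; rfl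
    have hcn : connCode (raw u).code = true := by rw [h]; rfl
    obtain ⟨s, hs, hs1, hs2⟩ := hform hb hcn _ (Or.inl rfl)
    obtain ⟨t, ht, ht1, ht2⟩ := hform hb hcn _ (Or.inr rfl)
    refine ⟨fun h' => ?_, fun _ => ⟨.or s t, ⟨_, _, hS.left_ne_right hb,
      hbin _ hb (by rw [h]; rfl), hs, ht⟩, ⟨hs1, ht1⟩, fun h0 => ?_⟩⟩
    · rw [h] at h'
      exact absurd h' (by decide)
    · simp only at hn
      rw [h0, hS.left u hb, hS.right u hb] at hn
      rcases mul_eq_zero.1 hn.symm with h1 | h1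
      · exact Or.inl (hs2 h1)
      · exact Or.inr (ht2 h1)

/-- Every node in use is reachable from the only node without a parent. -/
theorem reachable (hS : System Q raw succ carry) (hc : Counts succ carry rank) {r : V}
    (hr : ∀ v, (usedCode (raw v).code && !(raw v).fp) = true → v = r) (v : V) :
    usedCode (raw v).code = true → Relation.ReflTransGen (fun a b =>
      (raw a).toNode.left = some b ∨ (raw a).toNode.right = some b) r v := by
  -- Here the induction goes upwards: a parent has smaller depth.
  induction v using (wellFounded_lt (Q .H)).induction with
  | _ v ih =>
  intro hv
  cases hp : (raw v).fp
  · rw [hr v (by simp [hv, hp])]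
  · have hvp : (usedCode (raw v).code && (raw v).fp) = true := by simp [hv, hp]
    set q := (raw v).par with hq
    have h1 := hS.child v hvp
    have h2 : (0 : ℝ) ≤ rank v := Nat.cast_nonneg _
    rw [hS.distLeft v hvp, hS.distRight v hvp, hS.enumLeft, hS.enumRight, hS.enum_eq hc] at h1
    -- If the parent had no children, then `EL` and `ER` would be `-1` there, and both distances of
    -- `v` would be its rank plus one, so that their product could not vanish.
    cases hb : binCode (raw q).code
    · rw [← hq, hb, if_neg (by simp), if_neg (by simp)] at h1
      rcases mul_eq_zero.1 h1 with h3 | h3 <;> linarith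
    · rw [← hq, hb, if_pos rfl, if_pos rfl, hS.enum_eq hc, hS.enum_eq hc] at h1
      obtain ⟨h3, h4, -⟩ := hS.fl_fr_of_bin hb
      have h5 : v = (raw q).left ∨ v = (raw q).right := by
        rcases mul_eq_zero.1 h1 with h | h
        · exact Or.inl (hc.inj (by exact_mod_cast sub_eq_zero.1 h))
        · exact Or.inr (hc.inj (by exact_mod_cast sub_eq_zero.1 h))
      refine (ih q (by rw [hS.depth v hvp]; linarith) (usedCode_of_binCode hb)).tail ?_
      simp only [Raw.toNode, h3, h4, if_true, Option.some.injEq]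
      exact h5.imp Eq.symm Eq.symm

theorem exists_formula [Nonempty V] (hS : System Q raw succ carry) (hc : Counts succ carry rank) :
    ∃ φ : Formula V, Represents (fun v => (raw v).toNode) φ ∧ φ.IsNormal ∧
      ∃ ξ : V → ℝ, φ.Holds ξ := by
  obtain ⟨r, hr, hr'⟩ := hS.existsUnique_root hc
  have hr1 : usedCode (raw r).code = true ∧ (raw r).fp = false := by simpa using hr
  -- Local validity allows a missing parent only at labels of formulas.
  have hf : formCode (raw r).code = true := by
    cases hl : leafCode (raw r).code
    · have hb : binCode (raw r).code = true := by
        have := hr1.1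
        simpa [usedCode, hl] using this
      exact (hS.fl_fr_of_bin hb).2.2.resolve_left (by simp [hr1.2])
    · have := (hS.fl_fr_of_leaf hl).2.2
      rw [hr1.2] at this
      exact absurd this (by decide)
  obtain ⟨φ, h1, h2, h3⟩ := (hS.exists_isAt hc r hr1.1).2 hf
  have hp : (raw r).toNode.parent = none := by simp [Raw.toNode, hr1.2]
  rw [hp] at h1
  refine ⟨φ, ⟨r, h1, fun v hv => hS.reachable hc hr' v ?_⟩, h2, Q .V, h3 (hS.root r hr)⟩
  -- A node not in use passes the validity check only with code `0`. This excludes invalid codes as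
  -- well as `≤` and `¬` outside the tree.
  have := hS.valid v
  by_contra hu
  have h4 : leafCode (raw v).code = false := by simp [usedCode] at hu; exact hu.1
  have h5 : binCode (raw v).code = false := by simp [usedCode] at hu; exact hu.2
  simp only [validNode, h4, h5, Bool.false_and, Bool.or_false, beq_iff_eq] at this
  exact hv (by simp [Raw.toNode, this, decodeLabel])

end System

end SuccReals

namespace SuccReals

/-! ### From a true sentence to a solution -/

/-- The code of a label. -/
def Label.code {V : Type} : Label V → ℕ
  | unused => 0 | zero => 1 | one => 2 | var _ => 3 | add => 4 | mul => 5 | eq => 6 | lt => 7 | le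
      => 8
  | and => 9 | or => 10 | not => 11

theorem decodeLabel_eq_some {V : Type} {c : ℕ} {x : V} {ℓ : Label V}
    (h : decodeLabel c x = some ℓ) : c = ℓ.code ∧ ∀ y, ℓ = .var y → y = x := by
  unfold decodeLabel at h
  split at h <;> simp only [Option.some.injEq, reduceCtorEq] at h <;> subst h <;>
    simp [Label.code]

theorem Raw.toNode_eq_leaf {V : Type} {r : Raw V} {ℓ : Label V} {p : Option V}
    (h : r.toNode = ⟨some ℓ, p, none, none⟩) : r.code = ℓ.code ∧ (∀ y, ℓ = .var y → y = r.var) ∧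
      r.toNode.parent = p ∧ r.fl = false ∧ r.fr = false := by
  have hl := decodeLabel_eq_some (congrArg Node.label h)
  have h1 := congrArg Node.left h
  have h2 := congrArg Node.right h
  refine ⟨hl.1, hl.2, congrArg Node.parent h, ?_, ?_⟩
  · simpa [Raw.toNode] using h1
  · simpa [Raw.toNode] using h2

theorem Raw.toNode_eq_bin {V : Type} {r : Raw V} {ℓ : Label V} {p : Option V} {a b : V}
    (h : r.toNode = ⟨some ℓ, p, some a, some b⟩) : r.code = ℓ.code ∧
      r.toNode.parent = p ∧ r.fl = true ∧ r.fr = true ∧ r.left = a ∧ r.right = b := by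
  have hl := decodeLabel_eq_some (congrArg Node.label h)
  have h1 := congrArg Node.left h
  have h2 := congrArg Node.right h
  simp only [Raw.toNode, Option.ite_none_right_eq_some, Option.some.injEq] at h1 h2
  exact ⟨hl.1, congrArg Node.parent h, h1.1, h2.1, h1.2, h2.2⟩

/-- The real number that measures by how much a formula in normal form is violated. -/
noncomputable def Formula.val {V : Type} (ξ : V → ℝ) : Formula V → ℝ
  | eq s t => s.eval ξ - t.eval ξ
  | lt s t => if s.eval ξ < t.eval ξ then 0 else -1
  | le _ _ => 0
  | and φ ψ => φ.val ξ * φ.val ξ + ψ.val ξ * ψ.val ξ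
  | or φ ψ => φ.val ξ * ψ.val ξ
  | not _ => 0

/-- Only this direction is needed here; that a vanishing value implies truth is part of
`System.exists_isAt`. -/
theorem Formula.val_eq_zero {V : Type} {ξ : V → ℝ} {φ : Formula V} (hn : φ.IsNormal)
    (h : φ.Holds ξ) : φ.val ξ = 0 := by
  induction φ with
  | eq s t => exact sub_eq_zero.2 h
  | lt s t => exact if_pos h
  | le => rfl
  | and φ ψ ih ih' => rw [val, ih hn.1 h.1, ih' hn.2 h.2]; simp
  | or φ ψ ih ih' =>
    rcases h with h | h
    · rw [val, ih hn.1 h, zero_mul]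
    · rw [val, ih' hn.2 h, mul_zero]
  | not => rfl

/-! ### Trees in a node table: uniqueness, levels and values. -/

section

variable {V : Type} {d : V → Node V}

/-- The description of a node determines the outermost symbol and the children, and recursively the
whole term. The parents may differ, as they play no role in this. -/
theorem Term.isAt_unique {p p' : Option V} {v : V} {s t : Term V} (hs : s.IsAt d p v)
    (ht : t.IsAt d p' v) : s = t := by
  induction s generalizing p p' v t with
  | var x => cases t <;> simp_all [Term.IsAt]
  | zero => cases t <;> simp_all [Term.IsAt]
  | one => cases t <;> simp_all [Term.IsAt]
  | add s s' ih ih' =>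
    obtain ⟨l, r, -, h, h1, h2⟩ := hs
    cases t with
    | add t t' =>
      obtain ⟨l', r', -, h', h1', h2'⟩ := ht
      rw [h] at h'
      simp only [Node.mk.injEq, Option.some.injEq] at h'
      obtain ⟨-, -, rfl, rfl⟩ := h'
      rw [ih h1 h1', ih' h2 h2']
    | _ => simp_all [Term.IsAt]
  | mul s s' ih ih' =>
    obtain ⟨l, r, -, h, h1, h2⟩ := hs
    cases t with
    | mul t t' =>
      obtain ⟨l', r', -, h', h1', h2'⟩ := ht
      rw [h] at h'
      simp only [Node.mk.injEq, Option.some.injEq] at h'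
      obtain ⟨-, -, rfl, rfl⟩ := h'
      rw [ih h1 h1', ih' h2 h2']
    | _ => simp_all [Term.IsAt]

theorem Formula.isAt_unique {p p' : Option V} {v : V} {φ ψ : Formula V} (hφ : φ.IsAt d p v)
    (hψ : ψ.IsAt d p' v) (hn : φ.IsNormal) : φ = ψ := by
  induction φ generalizing p p' v ψ with
  | eq s s' =>
    obtain ⟨l, r, -, h, h1, h2⟩ := hφ
    cases ψ with
    | eq t t' =>
      obtain ⟨l', r', -, h', h1', h2'⟩ := hψ
      rw [h] at h'
      simp only [Node.mk.injEq, Option.some.injEq] at h'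
      obtain ⟨-, -, rfl, rfl⟩ := h'
      rw [Term.isAt_unique h1 h1', Term.isAt_unique h2 h2']
    | _ => simp_all [Formula.IsAt]
  | lt s s' =>
    obtain ⟨l, r, -, h, h1, h2⟩ := hφ
    cases ψ with
    | lt t t' =>
      obtain ⟨l', r', -, h', h1', h2'⟩ := hψ
      rw [h] at h'
      simp only [Node.mk.injEq, Option.some.injEq] at h'
      obtain ⟨-, -, rfl, rfl⟩ := h'
      rw [Term.isAt_unique h1 h1', Term.isAt_unique h2 h2']
    | _ => simp_all [Formula.IsAt]
  | le => exact hn.elim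
  | and φ φ' ih ih' =>
    obtain ⟨l, r, -, h, h1, h2⟩ := hφ
    cases ψ with
    | and t t' =>
      obtain ⟨l', r', -, h', h1', h2'⟩ := hψ
      rw [h] at h'
      simp only [Node.mk.injEq, Option.some.injEq] at h'
      obtain ⟨-, -, rfl, rfl⟩ := h'
      rw [ih h1 h1' hn.1, ih' h2 h2' hn.2]
    | _ => simp_all [Formula.IsAt]
  | or φ φ' ih ih' =>
    obtain ⟨l, r, -, h, h1, h2⟩ := hφ
    cases ψ with
    | or t t' =>
      obtain ⟨l', r', -, h', h1', h2'⟩ := hψ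
      rw [h] at h'
      simp only [Node.mk.injEq, Option.some.injEq] at h'
      obtain ⟨-, -, rfl, rfl⟩ := h'
      rw [ih h1 h1' hn.1, ih' h2 h2' hn.2]
    | _ => simp_all [Formula.IsAt]
  | not => exact hn.elim

/-- The tree of a term or of a formula in normal form is rooted at the node; only a formula
may lack a parent. -/
def RootsTree (d : V → Node V) (v : V) : Prop :=
  (∃ (t : Term V) (p : V), t.IsAt d (some p) v) ∨
    ∃ (φ : Formula V) (p : Option V), φ.IsNormal ∧ φ.IsAt d p v

/-- The edges from parents to children. -/
abbrev Edge (d : V → Node V) (a b : V) : Prop := (d a).left = some b ∨ (d a).right = some b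

/-- Besides passing the tree property down, this records that each child names its parent, so that
no node is reached through two different parents. -/
theorem rootsTree_of_edge {v w : V} (hv : RootsTree d v) (he : Edge d v w) :
    RootsTree d w ∧ (d w).parent = some v := by
  have hterm : ∀ (t : Term V) (w : V), t.IsAt d (some v) w → (d w).parent = some v := by
    intro t w h
    cases t with
    | var x => exact congrArg Node.parent h
    | zero => exact congrArg Node.parent h
    | one => exact congrArg Node.parent h
    | add s t => obtain ⟨_, _, -, h, -⟩ := h; exact congrArg Node.parent h
    | mul s t => obtain ⟨_, _, -, h, -⟩ := h; exact congrArg Node.parent h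
  have hform : ∀ (φ : Formula V) (w : V), φ.IsAt d (some v) w → (d w).parent = some v := by
    intro φ w h
    cases φ with
    | not φ => obtain ⟨_, h, -⟩ := h; exact congrArg Node.parent h
    | _ => obtain ⟨_, _, -, h, -⟩ := h; exact congrArg Node.parent h
  rcases hv with ⟨t, p, h⟩ | ⟨φ, p, hn, h⟩
  · cases t with
    | var x => rw [Edge, h] at he; simp at he
    | zero => rw [Edge, h] at he; simp at he
    | one => rw [Edge, h] at he; simp at he
    | add s t =>
      obtain ⟨l, r, -, h, h1, h2⟩ := h
      rw [Edge, h] at he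
      simp only [Option.some.injEq] at he
      rcases he with rfl | rfl
      · exact ⟨Or.inl ⟨_, _, h1⟩, hterm _ _ h1⟩
      · exact ⟨Or.inl ⟨_, _, h2⟩, hterm _ _ h2⟩
    | mul s t =>
      obtain ⟨l, r, -, h, h1, h2⟩ := h
      rw [Edge, h] at he
      simp only [Option.some.injEq] at he
      rcases he with rfl | rfl
      · exact ⟨Or.inl ⟨_, _, h1⟩, hterm _ _ h1⟩
      · exact ⟨Or.inl ⟨_, _, h2⟩, hterm _ _ h2⟩
  · cases φ with
    | eq s t =>
      obtain ⟨l, r, -, h, h1, h2⟩ := h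
      rw [Edge, h] at he
      simp only [Option.some.injEq] at he
      rcases he with rfl | rfl
      · exact ⟨Or.inl ⟨_, _, h1⟩, hterm _ _ h1⟩
      · exact ⟨Or.inl ⟨_, _, h2⟩, hterm _ _ h2⟩
    | lt s t =>
      obtain ⟨l, r, -, h, h1, h2⟩ := h
      rw [Edge, h] at he
      simp only [Option.some.injEq] at he
      rcases he with rfl | rfl
      · exact ⟨Or.inl ⟨_, _, h1⟩, hterm _ _ h1⟩
      · exact ⟨Or.inl ⟨_, _, h2⟩, hterm _ _ h2⟩
    | le s t => exact hn.elim
    | and s t =>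
      obtain ⟨l, r, -, h, h1, h2⟩ := h
      rw [Edge, h] at he
      simp only [Option.some.injEq] at he
      rcases he with rfl | rfl
      · exact ⟨Or.inr ⟨_, _, hn.1, h1⟩, hform _ _ h1⟩
      · exact ⟨Or.inr ⟨_, _, hn.2, h2⟩, hform _ _ h2⟩
    | or s t =>
      obtain ⟨l, r, -, h, h1, h2⟩ := h
      rw [Edge, h] at he
      simp only [Option.some.injEq] at he
      rcases he with rfl | rfl
      · exact ⟨Or.inr ⟨_, _, hn.1, h1⟩, hform _ _ h1⟩
      · exact ⟨Or.inr ⟨_, _, hn.2, h2⟩, hform _ _ h2⟩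
    | not φ => exact hn.elim

/-- The node `v` lies `n` levels below `r`. -/
def Level (d : V → Node V) (r : V) : ℕ → V → Prop
  | 0, v => v = r
  | n + 1, v => ∃ u, Level d r n u ∧ Edge d u v

theorem exists_level {r v : V} (h : Relation.ReflTransGen (Edge d) r v) : ∃ n, Level d r n v := by
  induction h with
  | refl => exact ⟨0, rfl⟩
  | tail _ he ih =>
    obtain ⟨n, hn⟩ := ih
    exact ⟨n + 1, _, hn, he⟩

theorem rootsTree_of_level {r : V} (hr : RootsTree d r) {n : ℕ} {v : V} (h : Level d r n v) :
    RootsTree d v := by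
  induction n generalizing v with
  | zero => exact h ▸ hr
  | succ n ih =>
    obtain ⟨u, hu, he⟩ := h
    exact (rootsTree_of_edge (ih hu) he).1

/-- Going upwards from `v` is forced by the parent pointers, and it can only stop at the root, which
has no parent. -/
theorem level_unique {r : V} (hr : RootsTree d r) (hp : (d r).parent = none) {n m : ℕ} {v : V}
    (h : Level d r n v) (h' : Level d r m v) : n = m := by
  induction n generalizing m v with
  | zero =>
    cases m with
    | zero => rfl
    | succ m =>
      obtain ⟨u, hu, he⟩ := h'
      have := (rootsTree_of_edge (rootsTree_of_level hr hu) he).2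
      rw [show v = r from h, hp] at this
      exact absurd this (by simp)
  | succ n ih =>
    obtain ⟨u, hu, he⟩ := h
    have h1 := (rootsTree_of_edge (rootsTree_of_level hr hu) he).2
    cases m with
    | zero =>
      rw [show v = r from h', hp] at h1
      exact absurd h1 (by simp)
    | succ m =>
      obtain ⟨u', hu', he'⟩ := h'
      have h2 := (rootsTree_of_edge (rootsTree_of_level hr hu') he').2
      rw [h1, Option.some.injEq] at h2
      rw [ih hu (h2 ▸ hu')]

open Classical in
/-- The depth of a node below the root. -/
noncomputable def depth (d : V → Node V) (r v : V) : ℝ :=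
  if h : ∃ n, Level d r n v then (h.choose : ℝ) else 0

theorem depth_eq {r : V} (hr : RootsTree d r) (hp : (d r).parent = none) {n : ℕ} {v : V}
    (h : Level d r n v) : depth d r v = n := by
  have h' : ∃ n, Level d r n v := ⟨n, h⟩
  rw [depth, dif_pos h', level_unique hr hp h'.choose_spec h]

open Classical in
/-- The value of a node of the tree. -/
noncomputable def nodeVal (d : V → Node V) (ξ : V → ℝ) (v : V) : ℝ :=
  if h : ∃ (t : Term V) (p : V), t.IsAt d (some p) v then h.choose.eval ξ else
  if h : ∃ (φ : Formula V) (p : Option V), φ.IsNormal ∧ φ.IsAt d p v then h.choose.val ξ else 0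

theorem nodeVal_term {ξ : V → ℝ} {t : Term V} {p v : V} (h : t.IsAt d (some p) v) :
    nodeVal d ξ v = t.eval ξ := by
  have h' : ∃ (t : Term V) (p : V), t.IsAt d (some p) v := ⟨t, p, h⟩
  obtain ⟨q, hq⟩ := h'.choose_spec
  rw [nodeVal, dif_pos h', Term.isAt_unique h hq]

/-- The labels of terms and formulas are disjoint, so the first alternative in `nodeVal` does not
apply; the chosen formula is the given one by uniqueness. -/
theorem nodeVal_formula {ξ : V → ℝ} {φ : Formula V} {p : Option V} {v : V} (hn : φ.IsNormal)
    (h : φ.IsAt d p v) : nodeVal d ξ v = φ.val ξ := by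
  have h0 : ¬ ∃ (t : Term V) (p : V), t.IsAt d (some p) v := by
    rintro ⟨t, q, ht⟩
    have h1 : ∃ t' : Label V, (d v).label = some t' ∧
        (t' = .zero ∨ t' = .one ∨ (∃ x, t' = .var x) ∨ t' = .add ∨ t' = .mul) := by
      cases t with
      | var x => exact ⟨_, congrArg Node.label ht, by simp⟩
      | zero => exact ⟨_, congrArg Node.label ht, by simp⟩
      | one => exact ⟨_, congrArg Node.label ht, by simp⟩
      | add s t => obtain ⟨_, _, -, ht, -⟩ := ht; exact ⟨_, congrArg Node.label ht, by simp⟩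
      | mul s t => obtain ⟨_, _, -, ht, -⟩ := ht; exact ⟨_, congrArg Node.label ht, by simp⟩
    obtain ⟨t', h1, h2⟩ := h1
    cases φ with
    | le s t => exact hn
    | not φ => exact hn
    | eq s t | lt s t | and s t | or s t =>
      obtain ⟨_, _, -, h, -⟩ := h
      rw [h] at h1
      cases h1
      simp at h2
  have h' : ∃ (φ : Formula V) (p : Option V), φ.IsNormal ∧ φ.IsAt d p v := ⟨φ, p, hn, h⟩
  obtain ⟨q, hq, hq'⟩ := h'.choose_spec
  rw [nodeVal, dif_neg h0, dif_pos h', Formula.isAt_unique h hq' hn]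

end

/-! ### The solution belonging to a true sentence. -/

section

variable {V : Type} {raw : V → Raw V}

theorem code_of_term {t : Term V} {p : Option V} {v : V}
    (h : t.IsAt (fun v => (raw v).toNode) p v) :
    usedCode (raw v).code = true ∧ formCode (raw v).code = false ∧ (raw v).toNode.parent = p := by
  cases t with
  | var x => obtain ⟨h1, -, h2, -⟩ := Raw.toNode_eq_leaf h; rw [h1]; exact ⟨rfl, rfl, h2⟩
  | zero => obtain ⟨h1, -, h2, -⟩ := Raw.toNode_eq_leaf h; rw [h1]; exact ⟨rfl, rfl, h2⟩
  | one => obtain ⟨h1, -, h2, -⟩ := Raw.toNode_eq_leaf h; rw [h1]; exact ⟨rfl, rfl, h2⟩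
  | add s t =>
    obtain ⟨_, _, -, h, -⟩ := h
    obtain ⟨h1, h2, -⟩ := Raw.toNode_eq_bin h
    rw [h1]; exact ⟨rfl, rfl, h2⟩
  | mul s t =>
    obtain ⟨_, _, -, h, -⟩ := h
    obtain ⟨h1, h2, -⟩ := Raw.toNode_eq_bin h
    rw [h1]; exact ⟨rfl, rfl, h2⟩

theorem code_of_formula {φ : Formula V} {p : Option V} {v : V} (hn : φ.IsNormal)
    (h : φ.IsAt (fun v => (raw v).toNode) p v) :
    usedCode (raw v).code = true ∧ formCode (raw v).code = true ∧ (raw v).toNode.parent = p := by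
  cases φ with
  | le => exact hn.elim
  | not => exact hn.elim
  | _ =>
    obtain ⟨_, _, -, h, -⟩ := h
    obtain ⟨h1, h2, -⟩ := Raw.toNode_eq_bin h
    rw [h1]; exact ⟨rfl, rfl, h2⟩

theorem Raw.parent_eq {r : Raw V} : (∀ p, r.toNode.parent = some p ↔ r.fp = true ∧ r.par = p) ∧
    (r.toNode.parent = none ↔ r.fp = false) := by
  cases h : r.fp <;> simp [Raw.toNode, h]

/-- Local properties of the nodes of the tree. -/
theorem local_of_rootsTree {v : V} (hv : RootsTree (fun v => (raw v).toNode) v) :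
    usedCode (raw v).code = true ∧
    validNode (raw v).code (raw v).fp (raw v).fl (raw v).fr = true ∧
    (binCode (raw v).code = true → (raw v).left ≠ (raw v).right ∧
      ∀ w, w = (raw v).left ∨ w = (raw v).right → usedCode (raw w).code = true ∧
        formCode (raw w).code = connCode (raw v).code) ∧
    (∀ w, Edge (fun v => (raw v).toNode) v w ↔
      binCode (raw v).code = true ∧ (w = (raw v).left ∨ w = (raw v).right)) := by
  have hleaf : ∀ (ℓ : Label V) (p : V), leafCode ℓ.code = true → binCode ℓ.code = false →
      (raw v).toNode = ⟨some ℓ, some p, none, none⟩ → _ := fun ℓ p h1 h2 h => by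
    obtain ⟨h3, -, h4, h5, h6⟩ := Raw.toNode_eq_leaf h
    have h7 := (Raw.parent_eq.1 p).1 h4
    have hR : usedCode (raw v).code = true ∧
      validNode (raw v).code (raw v).fp (raw v).fl (raw v).fr = true ∧
      (binCode (raw v).code = true → (raw v).left ≠ (raw v).right ∧
        ∀ w, w = (raw v).left ∨ w = (raw v).right → usedCode (raw w).code = true ∧
          formCode (raw w).code = connCode (raw v).code) ∧
      (∀ w, Edge (fun v => (raw v).toNode) v w ↔
        binCode (raw v).code = true ∧ (w = (raw v).left ∨ w = (raw v).right)) := by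
      refine ⟨?_, ?_, ?_, fun w => ?_⟩
      · rw [h3, usedCode, h1]; rfl
      · rw [h3, validNode, h1, h5, h6, h7.1]; simp
      · rw [h3, h2]; exact fun h => absurd h (by decide)
      · rw [Edge, h, h3, h2]; simp
    exact hR
  have hbin : ∀ (ℓ : Label V) (p : Option V) (a b : V), binCode ℓ.code = true →
      (p = none → formCode ℓ.code = true) → a ≠ b →
      (∀ w, w = a ∨ w = b → usedCode (raw w).code = true ∧
        formCode (raw w).code = connCode ℓ.code) →
      (raw v).toNode = ⟨some ℓ, p, some a, some b⟩ → _ := fun ℓ p a b h1 h2 hne hw h => by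
    obtain ⟨h3, h4, h5, h6, rfl, rfl⟩ := Raw.toNode_eq_bin h
    have hR : usedCode (raw v).code = true ∧
      validNode (raw v).code (raw v).fp (raw v).fl (raw v).fr = true ∧
      (binCode (raw v).code = true → (raw v).left ≠ (raw v).right ∧
        ∀ w, w = (raw v).left ∨ w = (raw v).right → usedCode (raw w).code = true ∧
          formCode (raw w).code = connCode (raw v).code) ∧
      (∀ w, Edge (fun v => (raw v).toNode) v w ↔
        binCode (raw v).code = true ∧ (w = (raw v).left ∨ w = (raw v).right)) := by
      refine ⟨?_, ?_, ?_, fun w => ?_⟩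
      · rw [h3, usedCode, h1]; simp
      · have : ((raw v).fp || formCode ℓ.code) = true := by
          cases hp : (raw v).fp
          · rw [h2 (h4.symm.trans (Raw.parent_eq.2.2 hp))]; rfl
          · rfl
        rw [h3, validNode, h1, h5, h6, this]; simp
      · rw [h3]; exact fun _ => ⟨hne, hw⟩
      · rw [Edge, h, h3, h1]; simp [eq_comm]
    exact hR
  rcases hv with ⟨t, p, h⟩ | ⟨φ, p, hn, h⟩
  · cases t with
    | var x => exact hleaf _ _ rfl rfl h
    | zero => exact hleaf _ _ rfl rfl h
    | one => exact hleaf _ _ rfl rfl h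
    | add s t =>
      obtain ⟨l, r, hne, h, h1, h2⟩ := h
      refine hbin _ _ _ _ rfl (by simp) hne ?_ h
      rintro w (rfl | rfl)
      · exact ⟨(code_of_term h1).1, (code_of_term h1).2.1⟩
      · exact ⟨(code_of_term h2).1, (code_of_term h2).2.1⟩
    | mul s t =>
      obtain ⟨l, r, hne, h, h1, h2⟩ := h
      refine hbin _ _ _ _ rfl (by simp) hne ?_ h
      rintro w (rfl | rfl)
      · exact ⟨(code_of_term h1).1, (code_of_term h1).2.1⟩
      · exact ⟨(code_of_term h2).1, (code_of_term h2).2.1⟩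
  · cases φ with
    | eq s t =>
      obtain ⟨l, r, hne, h, h1, h2⟩ := h
      refine hbin _ _ _ _ rfl (fun _ => rfl) hne ?_ h
      rintro w (rfl | rfl)
      · exact ⟨(code_of_term h1).1, (code_of_term h1).2.1⟩
      · exact ⟨(code_of_term h2).1, (code_of_term h2).2.1⟩
    | lt s t =>
      obtain ⟨l, r, hne, h, h1, h2⟩ := h
      refine hbin _ _ _ _ rfl (fun _ => rfl) hne ?_ h
      rintro w (rfl | rfl)
      · exact ⟨(code_of_term h1).1, (code_of_term h1).2.1⟩
      · exact ⟨(code_of_term h2).1, (code_of_term h2).2.1⟩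
    | le s t => exact hn.elim
    | and s t =>
      obtain ⟨l, r, hne, h, h1, h2⟩ := h
      refine hbin _ _ _ _ rfl (fun _ => rfl) hne ?_ h
      rintro w (rfl | rfl)
      · exact ⟨(code_of_formula hn.1 h1).1, (code_of_formula hn.1 h1).2.1⟩
      · exact ⟨(code_of_formula hn.2 h2).1, (code_of_formula hn.2 h2).2.1⟩
    | or s t =>
      obtain ⟨l, r, hne, h, h1, h2⟩ := h
      refine hbin _ _ _ _ rfl (fun _ => rfl) hne ?_ h
      rintro w (rfl | rfl)
      · exact ⟨(code_of_formula hn.1 h1).1, (code_of_formula hn.1 h1).2.1⟩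
      · exact ⟨(code_of_formula hn.2 h2).1, (code_of_formula hn.2 h2).2.1⟩
    | not φ => exact hn.elim

/-- The solution of the system given by a true sentence. -/
noncomputable def solution (raw : V → Raw V) (rank : V → ℕ) (r : V) (ξ : V → ℝ) (s : V → ℝ) :
    Kind → V → ℝ :=
  let X := nodeVal (fun v => (raw v).toNode) ξ
  let L := fun v => X (raw v).left
  let R := fun v => X (raw v).right
  let Y := fun v => if L v < R v then 1 / (R v - L v) else 0
  let EL := fun v => if binCode (raw v).code then (rank (raw v).left : ℝ) else -1
  let ER := fun v => if binCode (raw v).code then (rank (raw v).right : ℝ) else -1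
  fun k => match k with
  | .V => ξ
  | .X => X
  | .L => L
  | .R => R
  | .Y => Y
  | .Z => fun v => Real.sqrt (Y v)
  | .T => fun v => if formCode (raw v).code then 1 else 0
  | .E => fun v => rank v
  | .S => s
  | .P => fun v => if usedCode (raw v).code && (raw v).fp then (rank (raw v).par : ℝ) else -1
  | .H => depth (fun v => (raw v).toNode) r
  | .EL => EL
  | .ER => ER
  | .W => fun v => 1 / (EL v - ER v)
  | .A => fun v => rank v - EL (raw v).par
  | .B => fun v => rank v - ER (raw v).par

theorem nodeEq_solution (rank : V → ℕ) (r : V) (ξ : V → ℝ) (s : V → ℝ) {v : V}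
    (hv : RootsTree (fun v => (raw v).toNode) v) :
    NodeEq (solution raw rank r ξ s) (raw v) v := by
  rcases hv with ⟨t, p, h⟩ | ⟨φ, p, hn, h⟩
  · have hX : solution raw rank r ξ s .X v = t.eval ξ := nodeVal_term h
    cases t with
    | var x =>
      obtain ⟨h1, h2, -⟩ := Raw.toNode_eq_leaf h
      rw [NodeEq, h1]
      exact hX.trans (congrArg ξ (h2 x rfl))
    | zero =>
      obtain ⟨h1, -⟩ := Raw.toNode_eq_leaf h
      rw [NodeEq, h1]
      exact hX
    | one =>
      obtain ⟨h1, -⟩ := Raw.toNode_eq_leaf h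
      rw [NodeEq, h1]
      exact hX
    | add s' t' =>
      obtain ⟨_, _, -, h, h1, h2⟩ := h
      obtain ⟨h3, -, -, -, rfl, rfl⟩ := Raw.toNode_eq_bin h
      rw [NodeEq, h3]
      exact hX.trans (congrArg₂ _ (nodeVal_term h1).symm (nodeVal_term h2).symm)
    | mul s' t' =>
      obtain ⟨_, _, -, h, h1, h2⟩ := h
      obtain ⟨h3, -, -, -, rfl, rfl⟩ := Raw.toNode_eq_bin h
      rw [NodeEq, h3]
      exact hX.trans (congrArg₂ _ (nodeVal_term h1).symm (nodeVal_term h2).symm)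
  · have hX : solution raw rank r ξ s .X v = φ.val ξ := nodeVal_formula hn h
    cases φ with
    | eq s' t' =>
      obtain ⟨_, _, -, h, h1, h2⟩ := h
      obtain ⟨h3, -, -, -, rfl, rfl⟩ := Raw.toNode_eq_bin h
      rw [NodeEq, h3]
      exact hX.trans (congrArg₂ _ (nodeVal_term h1).symm (nodeVal_term h2).symm)
    | lt s' t' =>
      obtain ⟨_, _, -, h, h1, h2⟩ := h
      obtain ⟨h3, -, -, -, rfl, rfl⟩ := Raw.toNode_eq_bin h
      rw [NodeEq, h3]
      refine hX.trans ?_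
      have h4 : nodeVal (fun v => (raw v).toNode) ξ (raw v).left = s'.eval ξ := nodeVal_term h1
      have h5 : nodeVal (fun v => (raw v).toNode) ξ (raw v).right = t'.eval ξ := nodeVal_term h2
      -- The variable `Y` is the reciprocal of the gap if the comparison holds, which gives the
      -- value `0`; otherwise `Y = 0` gives `-1`, in accordance with `Formula.val`.
      change (if s'.eval ξ < t'.eval ξ then (0 : ℝ) else -1) =
        (nodeVal (fun v => (raw v).toNode) ξ (raw v).right -
          nodeVal (fun v => (raw v).toNode) ξ (raw v).left) *
        (if nodeVal (fun v => (raw v).toNode) ξ (raw v).left <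
            nodeVal (fun v => (raw v).toNode) ξ (raw v).right then
          1 / (nodeVal (fun v => (raw v).toNode) ξ (raw v).right -
            nodeVal (fun v => (raw v).toNode) ξ (raw v).left) else 0) - 1
      rw [h4, h5]
      split_ifs with hlt
      · rw [mul_one_div_cancel (sub_pos.2 hlt).ne', sub_self]
      · simp
    | le s' t' => exact hn.elim
    | and s' t' =>
      obtain ⟨_, _, -, h, h1, h2⟩ := h
      obtain ⟨h3, -, -, -, rfl, rfl⟩ := Raw.toNode_eq_bin h
      rw [NodeEq, h3]
      exact hX.trans (congrArg₂ (fun a b => a * a + b * b) (nodeVal_formula hn.1 h1).symm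
        (nodeVal_formula hn.2 h2).symm)
    | or s' t' =>
      obtain ⟨_, _, -, h, h1, h2⟩ := h
      obtain ⟨h3, -, -, -, rfl, rfl⟩ := Raw.toNode_eq_bin h
      rw [NodeEq, h3]
      exact hX.trans (congrArg₂ _ (nodeVal_formula hn.1 h1).symm (nodeVal_formula hn.2 h2).symm)
    | not s' => exact hn.elim

open Classical in
theorem Counts.exists_count [Fintype V] {succ : V → V} {carry : V → Bool} {rank : V → ℕ}
    (hc : Counts succ carry rank) (r : V) : ∃ s : V → ℝ, ∀ u, s (succ u) =
      s u + (if u = r then 1 else 0) - (if carry u then 1 else 0) := by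
  -- The partial count is the indicator of the nodes after `r`: it rises by one on leaving `r` and
  -- is cancelled when the enumeration wraps around.
  refine ⟨fun u => if rank r < rank u then 1 else 0, fun u => ?_⟩
  cases hu : carry u <;> beta_reduce
  · rw [hc.step u hu]
    have : u = r ↔ rank u = rank r := hc.inj.eq_iff.symm
    rw [this]
    split_ifs <;> first | omega | simp_all
  · rw [hc.wrap u hu]
    have h1 := hc.top u hu r
    have : u = r ↔ rank u = rank r := hc.inj.eq_iff.symm
    rw [this]
    split_ifs <;> first | omega | simp_all

theorem system_solution [Fintype V] {succ : V → V} {carry : V → Bool} {rank : V → ℕ}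
    (hc : Counts succ carry rank) {φ : Formula V} {r : V}
    (hφ : φ.IsAt (fun v => (raw v).toNode) none r)
    (hr : ∀ v, (raw v).toNode.label ≠ some .unused →
      Relation.ReflTransGen (Edge fun v => (raw v).toNode) r v)
    (hn : φ.IsNormal) {ξ : V → ℝ} (hξ : φ.Holds ξ) :
    ∃ Q, System Q raw succ carry := by
  classical
  obtain ⟨s, hs⟩ := hc.exists_count r
  have hroot : RootsTree (fun v => (raw v).toNode) r := Or.inr ⟨φ, none, hn, hφ⟩
  have hrp := (code_of_formula hn hφ).2.2
  have hru := (code_of_formula hn hφ).1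
  have hused : ∀ v, usedCode (raw v).code = true →
      Relation.ReflTransGen (Edge fun v => (raw v).toNode) r v := by
    intro v hv
    refine hr v fun h => ?_
    have := (decodeLabel_eq_some h).1
    rw [this] at hv
    exact Bool.false_ne_true hv
  have htree : ∀ v, usedCode (raw v).code = true → RootsTree (fun v => (raw v).toNode) v := by
    intro v hv
    obtain ⟨n, h⟩ := exists_level (hused v hv)
    exact rootsTree_of_level hroot h
  -- A label other than "unused" puts the node into the tree, where all nodes have codes in use.
  have hunused : ∀ v, usedCode (raw v).code = false → (raw v).code = 0 := by
    intro v hv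
    by_contra h0
    have h1 : (raw v).toNode.label ≠ some .unused := fun h => h0 (decodeLabel_eq_some h).1
    obtain ⟨n, h⟩ := exists_level (hr v h1)
    have := (local_of_rootsTree (rootsTree_of_level hroot h)).1
    rw [hv] at this
    exact absurd this (by decide)
  have hchild : ∀ u, binCode (raw u).code = true → ∀ w, w = (raw u).left ∨ w = (raw u).right →
      usedCode (raw w).code = true ∧ (raw w).fp = true ∧ (raw w).par = u ∧
        formCode (raw w).code = connCode (raw u).code := by
    intro u hb w hw
    have ht := htree u (usedCode_of_binCode hb)
    obtain ⟨-, -, h3, h4⟩ := local_of_rootsTree ht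
    have h5 := (rootsTree_of_edge ht ((h4 w).2 ⟨hb, hw⟩)).2
    obtain ⟨h6, h7⟩ := (Raw.parent_eq.1 u).1 h5
    exact ⟨((h3 hb).2 w hw).1, h6, h7, ((h3 hb).2 w hw).2⟩
  -- The last edge of a path from the root to `v` comes from the node that `v` names as its parent.
  -- The path is not empty, because the root has no parent.
  have hpar : ∀ v, (usedCode (raw v).code && (raw v).fp) = true → ∃ n,
      Level (fun v => (raw v).toNode) r n (raw v).par ∧
      Edge (fun v => (raw v).toNode) (raw v).par v ∧ binCode (raw (raw v).par).code = true ∧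
      (v = (raw (raw v).par).left ∨ v = (raw (raw v).par).right) := by
    intro v hv
    rw [Bool.and_eq_true] at hv
    obtain ⟨n, h⟩ := exists_level (hused v hv.1)
    cases n with
    | zero =>
      rw [show v = r from h, Raw.parent_eq.2.1 hrp] at hv
      exact absurd hv.2 (by decide)
    | succ n =>
      obtain ⟨u, hu, he⟩ := h
      have ht := rootsTree_of_level hroot hu
      have h5 := (rootsTree_of_edge ht he).2
      obtain ⟨h6, h7⟩ := (Raw.parent_eq.1 u).1 h5
      obtain ⟨-, -, -, h4⟩ := local_of_rootsTree ht
      rw [h7]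
      exact ⟨n, hu, he, (h4 v).1 he⟩
  -- A node reached through an edge names a parent, so only the root itself lacks one.
  have hroot_iff : ∀ u, (usedCode (raw u).code && !(raw u).fp) = true ↔ u = r := by
    intro u
    constructor
    · intro h
      rw [Bool.and_eq_true, Bool.not_eq_true'] at h
      obtain ⟨n, hl⟩ := exists_level (hused u h.1)
      cases n with
      | zero => exact hl
      | succ n =>
        obtain ⟨w, hw, he⟩ := hl
        have h5 := (rootsTree_of_edge (rootsTree_of_level hroot hw) he).2
        rw [((Raw.parent_eq.1 w).1 h5).1] at h
        exact absurd h.2 (by decide)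
    · rintro rfl
      rw [hru, Raw.parent_eq.2.1 hrp]
      rfl
  refine ⟨solution raw rank r ξ s, ?_⟩
  exact {
    valid := fun u => by
      cases hu : usedCode (raw u).code
      · rw [hunused u hu]; rfl
      · exact (local_of_rootsTree (htree u hu)).2.1
    node := fun u => by
      cases hu : usedCode (raw u).code
      · rw [NodeEq, hunused u hu]; trivial
      · exact nodeEq_solution rank r ξ s (htree u hu)
    sq := fun u => by
      refine (Real.mul_self_sqrt ?_).symm
      change (0 : ℝ) ≤ if nodeVal (fun v => (raw v).toNode) ξ (raw u).left <
        nodeVal (fun v => (raw v).toNode) ξ (raw u).right then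
        1 / (nodeVal (fun v => (raw v).toNode) ξ (raw u).right -
          nodeVal (fun v => (raw v).toNode) ξ (raw u).left) else 0
      split_ifs with h
      · exact one_div_nonneg.2 (sub_nonneg.2 h.le)
      · exact le_rfl
    left := fun u _ => rfl
    right := fun u _ => rfl
    root := fun u hu => by
      rw [(hroot_iff u).1 hu]
      exact (nodeVal_formula hn hφ).trans (Formula.val_eq_zero hn hξ)
    sort := fun u => rfl
    sortLeft := fun u hu => by
      have := (hchild u hu _ (Or.inl rfl)).2.2.2
      rw [← this]
      rfl
    sortRight := fun u hu => by
      have := (hchild u hu _ (Or.inr rfl)).2.2.2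
      rw [← this]
      rfl
    enum := fun u => by
      change (rank (succ u) : ℝ) = if carry u then 0 else (rank u : ℝ) + 1
      cases hu : carry u
      · rw [hc.step u hu]; simp
      · rw [hc.wrap u hu]; simp
    count := fun u => by
      refine (hs u).trans ?_
      change _ = s u + (if usedCode (raw u).code && !(raw u).fp then 1 else 0) -
        (if carry u then 1 else 0)
      rw [if_congr (hroot_iff u) rfl rfl]
    parent := fun u => rfl
    parentLeft := fun u hu => by
      obtain ⟨h1, h2, h3, -⟩ := hchild u hu _ (Or.inl rfl)
      change (if usedCode (raw (raw u).left).code && (raw (raw u).left).fp then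
        (rank (raw (raw u).left).par : ℝ) else -1) = rank u
      rw [h1, h2, h3]
      rfl
    parentRight := fun u hu => by
      obtain ⟨h1, h2, h3, -⟩ := hchild u hu _ (Or.inr rfl)
      change (if usedCode (raw (raw u).right).code && (raw (raw u).right).fp then
        (rank (raw (raw u).right).par : ℝ) else -1) = rank u
      rw [h1, h2, h3]
      rfl
    depth := fun u hu => by
      obtain ⟨n, h1, h2, -⟩ := hpar u hu
      have h3 : Level (fun v => (raw v).toNode) r (n + 1) u := ⟨_, h1, h2⟩
      change depth _ r u = depth _ r (raw u).par + 1
      rw [depth_eq hroot hrp h1, depth_eq hroot hrp h3]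
      push_cast
      rfl
    enumLeft := fun u => rfl
    enumRight := fun u => rfl
    distinct := fun u hu => by
      have hne := ((local_of_rootsTree (htree u (usedCode_of_binCode hu))).2.2.1 hu).1
      have h1 : (rank (raw u).left : ℝ) - rank (raw u).right ≠ 0 := by
        rw [sub_ne_zero]
        exact fun h => hne (hc.inj (by exact_mod_cast h))
      rw [← sub_mul]
      change ((if binCode (raw u).code then (rank (raw u).left : ℝ) else -1) -
        (if binCode (raw u).code then (rank (raw u).right : ℝ) else -1)) *
        (1 / ((if binCode (raw u).code then (rank (raw u).left : ℝ) else -1) -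
        (if binCode (raw u).code then (rank (raw u).right : ℝ) else -1))) = 1
      rw [if_pos hu, if_pos hu, mul_one_div_cancel h1]
    distLeft := fun u _ => rfl
    distRight := fun u _ => rfl
    child := fun u hu => by
      obtain ⟨n, -, -, h1, h2⟩ := hpar u hu
      change ((rank u : ℝ) - if binCode (raw (raw u).par).code then
          (rank (raw (raw u).par).left : ℝ) else -1) *
        ((rank u : ℝ) - if binCode (raw (raw u).par).code then
          (rank (raw (raw u).par).right : ℝ) else -1) = 0
      rw [if_pos h1, if_pos h1]
      rcases h2 with h2 | h2
      · rw [← h2, sub_self, zero_mul]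
      · rw [← h2, sub_self, mul_zero] }

/-- The system is solvable if and only if the node table describes a true sentence. -/
theorem exists_solves_iff [Fintype V] [Nonempty V] {succ : V → V} {carry : V → Bool} {rank : V → ℕ}
    (hc : Counts succ carry rank) : (∃ Q, Solves Q raw succ carry) ↔
      ∃ φ : Formula V, Represents (fun v => (raw v).toNode) φ ∧ φ.IsNormal ∧
        ∃ ξ : V → ℝ, φ.Holds ξ := by
  constructor
  · rintro ⟨Q, hQ⟩
    exact ((solves_iff_system Q raw succ carry).1 hQ).exists_formula hc
  · rintro ⟨φ, ⟨r, h1, h2⟩, h3, ξ, h4⟩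
    obtain ⟨Q, hQ⟩ := system_solution hc h1 h2 h3 h4
    exact ⟨Q, (solves_iff_system Q raw succ carry).2 hQ⟩

end

theorem build_mem_succQUAD_iff (C : Circuit) (h : C.outputs.length = 4 * C.numInputs + 7) :
    build C h ∈ SuccQUAD ↔ C ∈ SuccETR := by
  rw [mem_succQUAD_build, exists_solves_iff (counts_succBits C.numInputs)]
  -- The node table of `C` agrees by definition with the decoded raw contents.
  exact ⟨fun h' => ⟨h, h'⟩, fun h' => h'.2⟩

end SuccReals

namespace SuccReals
open Cmd

/-! ### Programs with counters and an output tape -/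

/-- The counters of the programs. -/
inductive Ctr where
  | len | blocks | check | outs | wires | pos | fst | snd
  deriving DecidableEq

instance : Fintype Ctr where
  elems := {.len, .blocks, .check, .outs, .wires, .pos, .fst, .snd}
  complete c := by cases c <;> decide

/-- The stacks of the programs. -/
inductive Stk where
  | inp | out | acc | tmp
  | ctr (c : Ctr)
  deriving DecidableEq

instance : Fintype Stk where
  elems := {.inp, .out, .acc, .tmp} ∪ Finset.univ.image .ctr
  complete k := by cases k <;> simp

/-- The contents of the memory: the rest of the input, the output so far and the values of the
counters. -/
@[ext]
structure Mem where
  inp : List Sym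
  o : List Sym
  val : Ctr → ℕ

namespace Mem

/-- The stacks representing a memory; the auxiliary stack contains `t` symbols. -/
def tapes (t : ℕ) (m : Mem) : Stk → List Sym
  | .inp => m.inp
  | .out => []
  | .acc => m.o.reverse
  | .tmp => List.replicate t .tick
  | .ctr c => List.replicate (m.val c) .tick

/-- Appending to the output. -/
def emit (m : Mem) (w : List Sym) : Mem := { m with o := m.o ++ w }

/-- Setting a counter. -/
def set (m : Mem) (c : Ctr) (x : ℕ) : Mem := { m with val := Function.update m.val c x }

/-- Replacing the input. -/
def setInp (m : Mem) (w : List Sym) : Mem := { m with inp := w }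

@[simp] theorem inp_emit (m : Mem) (w : List Sym) : (m.emit w).inp = m.inp := rfl
@[simp] theorem o_emit (m : Mem) (w : List Sym) : (m.emit w).o = m.o ++ w := rfl
@[simp] theorem val_emit (m : Mem) (w : List Sym) : (m.emit w).val = m.val := rfl
@[simp] theorem inp_set (m : Mem) (c : Ctr) (x : ℕ) : (m.set c x).inp = m.inp := rfl
@[simp] theorem o_set (m : Mem) (c : Ctr) (x : ℕ) : (m.set c x).o = m.o := rfl
@[simp] theorem inp_setInp (m : Mem) (w : List Sym) : (m.setInp w).inp = w := rfl
@[simp] theorem o_setInp (m : Mem) (w : List Sym) : (m.setInp w).o = m.o := rfl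
@[simp] theorem val_setInp (m : Mem) (w : List Sym) : (m.setInp w).val = m.val := rfl

theorem val_set (m : Mem) (c : Ctr) (x : ℕ) : (m.set c x).val = Function.update m.val c x := rfl

@[simp] theorem val_set_self (m : Mem) (c : Ctr) (x : ℕ) : (m.set c x).val c = x :=
  Function.update_self ..

theorem emit_emit (m : Mem) (w w' : List Sym) : (m.emit w).emit w' = m.emit (w ++ w') := by
  simp [emit]

@[simp] theorem emit_nil (m : Mem) : m.emit [] = m := by simp [emit]

end Mem

open Mem

section

variable (m : Mem) (t : ℕ)

theorem within_skip : Within .skip (m.tapes t) (m.tapes t) 1 := ⟨1, le_rfl, .skip _⟩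

theorem within_push_acc (a : Sym) :
    Within (.push .acc a) (m.tapes t) ((m.emit [a]).tapes t) 1 := by
  refine ⟨1, le_rfl, ?_⟩
  convert Runs.push Stk.acc a (m.tapes t) using 1
  funext k
  cases k <;> simp [tapes, emit]

theorem within_push_ctr (c : Ctr) :
    Within (.push (.ctr c) .tick) (m.tapes t) ((m.set c (m.val c + 1)).tapes t) 1 := by
  refine ⟨1, le_rfl, ?_⟩
  convert Runs.push (Stk.ctr c) Sym.tick (m.tapes t) using 1
  funext k
  cases k with
  | ctr c' => by_cases h : c' = c <;> simp [tapes, Mem.set, h, List.replicate_succ]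
  | _ => simp [tapes, Mem.set]

theorem within_pop_ctr (c : Ctr) :
    Within (.pop (.ctr c)) (m.tapes t) ((m.set c (m.val c - 1)).tapes t) 1 := by
  refine ⟨1, le_rfl, ?_⟩
  convert Runs.pop (Stk.ctr c) (m.tapes t) using 1
  funext k
  cases k with
  | ctr c' => by_cases h : c' = c <;> simp [tapes, Mem.set, h]
  | _ => simp [tapes, Mem.set]

theorem within_pop_inp :
    Within (.pop .inp) (m.tapes t) ((m.setInp m.inp.tail).tapes t) 1 := by
  refine ⟨1, le_rfl, ?_⟩
  convert Runs.pop Stk.inp (m.tapes t) using 1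
  funext k
  cases k <;> simp [tapes, setInp]

theorem within_move_inp_acc {a : Sym} {l : List Sym} (h : m.inp = a :: l) :
    Within (.move .inp .acc) (m.tapes t) (((m.setInp l).emit [a]).tapes t) 1 := by
  refine ⟨1, le_rfl, ?_⟩
  convert Runs.move Stk.inp Stk.acc (m.tapes t) a l h using 1
  funext k
  cases k <;> simp [tapes, setInp, emit]

theorem within_move_inp_ctr (c : Ctr) {l : List Sym} (h : m.inp = .tick :: l) :
    Within (.move .inp (.ctr c)) (m.tapes t) (((m.setInp l).set c (m.val c + 1)).tapes t) 1 := by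
  refine ⟨1, le_rfl, ?_⟩
  convert Runs.move Stk.inp (Stk.ctr c) (m.tapes t) .tick l h using 1
  funext k
  cases k with
  | ctr c' => by_cases h : c' = c <;> simp [tapes, Mem.set, h, setInp, List.replicate_succ]
  | _ => simp [tapes, Mem.set, setInp]

theorem within_move_ctr_tmp (c : Ctr) (h : m.val c ≠ 0) :
    Within (.move (.ctr c) .tmp) (m.tapes t) ((m.set c (m.val c - 1)).tapes (t + 1)) 1 := by
  refine ⟨1, le_rfl, ?_⟩
  obtain ⟨x, hx⟩ := Nat.exists_eq_succ_of_ne_zero h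
  convert Runs.move (Stk.ctr c) .tmp (m.tapes t) .tick (List.replicate x .tick)
    (by simp [tapes, hx, List.replicate_succ]) using 1
  funext k
  cases k with
  | ctr c' => by_cases h : c' = c <;> simp [tapes, Mem.set, h, hx]
  | _ => simp [tapes, Mem.set, List.replicate_succ]

theorem within_move_tmp_ctr (c : Ctr) :
    Within (.move .tmp (.ctr c)) (m.tapes (t + 1)) ((m.set c (m.val c + 1)).tapes t) 1 := by
  refine ⟨1, le_rfl, ?_⟩
  convert Runs.move .tmp (Stk.ctr c) (m.tapes (t + 1)) .tick (List.replicate t .tick)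
    (by simp [tapes, List.replicate_succ]) using 1
  funext k
  cases k with
  | ctr c' => by_cases h : c' = c <;> simp [tapes, Mem.set, h, List.replicate_succ]
  | _ => simp [tapes, Mem.set]

end

/-- The test for a counter symbol. -/
def isTick : Option Sym → Bool := fun a => a == some .tick

theorem isTick_ctr (m : Mem) (t : ℕ) (c : Ctr) :
    isTick (m.tapes t (.ctr c)).head? = !(m.val c == 0) := by
  simp only [tapes]
  cases m.val c <;> rfl

theorem isTick_tmp (m : Mem) (t : ℕ) : isTick (m.tapes t .tmp).head? = !(t == 0) := by
  simp only [tapes]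
  cases t <;> rfl

/-! ### Straight-line programs -/

/-- Instructions: append a word to the output; append a multiple of a counter to the output in
unary; increase a counter; decrease a counter. -/
inductive Op where
  | emit (w : List Sym)
  | copy (c : Ctr) (k : ℕ)
  | inc (c : Ctr) (k : ℕ)
  | dec (c : Ctr) (k : ℕ)

/-- Repetition of a program. -/
def rep (x : Cmd Stk) : ℕ → Cmd Stk
  | 0 => .skip
  | k + 1 => .seq x (rep x k)

/-- The program appending a word to the output. -/
def emitCmd : List Sym → Cmd Stk
  | [] => .skip
  | a :: w => .seq (.push .acc a) (emitCmd w)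

theorem within_emitCmd (w : List Sym) (m : Mem) (t : ℕ) :
    Within (emitCmd w) (m.tapes t) ((m.emit w).tapes t) (w.length + 1) := by
  induction w generalizing m with
  | nil => rw [emit_nil]; exact within_skip m t
  | cons a w ih =>
    have h := (within_push_acc m t a).seq (ih (m.emit [a]))
    rw [emit_emit] at h
    exact h.mono (by simp only [List.length_cons]; omega)

namespace Op

/-- The effect of an instruction. -/
def run : Op → Mem → Mem
  | emit w, m => m.emit w
  | copy c k, m => m.emit (List.replicate (k * m.val c) .tick)
  | inc c k, m => m.set c (m.val c + k)
  | dec c k, m => m.set c (m.val c - k)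

/-- The program of an instruction. -/
def cmd : Op → Cmd Stk
  | emit w => emitCmd w
  | copy c k =>
    .seq (.loop (.ctr c) isTick
      (.seq (.move (.ctr c) .tmp) (emitCmd (List.replicate k .tick))))
      (.loop .tmp isTick (.move .tmp (.ctr c)))
  | inc c k => rep (.push (.ctr c) .tick) k
  | dec c k => rep (.pop (.ctr c)) k

/-- A counter can only be read by removing its ticks. They are kept on the auxiliary stack while the
output grows and are then moved back. -/
theorem within_copy (c : Ctr) (k : ℕ) (m : Mem) :
    Within (copy c k).cmd (m.tapes 0) (((copy c k).run m).tapes 0)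
      (m.val c * (k + 5) + 2) := by
  have h1 := Within.loop (k := .ctr c) (p := isTick)
    (c := .seq (.move (.ctr c) .tmp) (emitCmd (List.replicate k .tick))) (m.val c)
    (fun i => ((m.set c (m.val c - i)).emit (List.replicate (k * i) .tick)).tapes i) (B := k + 2)
    (fun i hi => by rw [isTick_ctr]; simp; omega) (by rw [isTick_ctr]; simp) (fun i hi => by
      have := (within_move_ctr_tmp ((m.set c (m.val c - i)).emit (List.replicate (k * i) .tick)) i c
        (by simp; omega)).seq (within_emitCmd (List.replicate k .tick) _ _)
      convert this using 1
      · congr 1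
        ext1
        · rfl
        · simp [Nat.mul_succ]
        · simp [val_set, Nat.sub_sub]
      · simp; omega)
  have h2 := Within.loop (k := .tmp) (p := isTick) (c := .move .tmp (.ctr c)) (m.val c)
    (fun i => ((m.set c i).emit (List.replicate (k * m.val c) .tick)).tapes (m.val c - i)) (B := 1)
    (fun i hi => by rw [isTick_tmp]; simp; omega) (by rw [isTick_tmp]; simp) (fun i hi => by
      obtain ⟨x, hx⟩ : ∃ x, m.val c - i = x + 1 := ⟨m.val c - i - 1, by omega⟩
      convert within_move_tmp_ctr ((m.set c i).emit (List.replicate (k * m.val c) .tick)) x c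
        using 1
      · rw [hx]
      · rw [show m.val c - (i + 1) = x by omega]
        congr 1
        ext1
        · rfl
        · rfl
        · simp [val_set])
  have h3 : (m.set c (m.val c)).emit (List.replicate (k * 0) .tick) = m := by
    ext1 <;> simp [val_set]
  have h4 : (m.set c (m.val c)).emit (List.replicate (k * m.val c) .tick) = (copy c k).run m := by
    ext1 <;> simp [val_set, run]
  simp only [h3, h4, Nat.sub_self, Nat.sub_zero] at h1 h2
  refine (h1.seq h2).mono (le_of_eq ?_)
  ring

theorem within_rep_push (c : Ctr) (k : ℕ) (m : Mem) :
    Within (inc c k).cmd (m.tapes 0) (((inc c k).run m).tapes 0) (k + 1) := by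
  induction k generalizing m with
  | zero =>
    have e : (inc c 0).run m = m := by ext1 <;> simp [run, val_set]
    rw [e]
    exact within_skip m 0
  | succ k ih =>
    have h := (within_push_ctr m 0 c).seq (ih _)
    have e : (inc c k).run (m.set c (m.val c + 1)) = (inc c (k + 1)).run m := by
      ext1
      · rfl
      · rfl
      · simp [run, val_set, add_assoc, add_comm]
    rw [e] at h
    exact h.mono (by omega)

theorem within_rep_pop (c : Ctr) (k : ℕ) (m : Mem) :
    Within (dec c k).cmd (m.tapes 0) (((dec c k).run m).tapes 0) (k + 1) := by
  induction k generalizing m with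
  | zero =>
    have e : (dec c 0).run m = m := by ext1 <;> simp [run, val_set]
    rw [e]
    exact within_skip m 0
  | succ k ih =>
    have h := (within_pop_ctr m 0 c).seq (ih _)
    have e : (dec c k).run (m.set c (m.val c - 1)) = (dec c (k + 1)).run m := by
      ext1
      · rfl
      · rfl
      · simp [run, val_set, Nat.sub_sub, add_comm]
    rw [e] at h
    exact h.mono (by omega)

/-- The running time of an instruction is linear in the values of the counters. -/
theorem exists_within (x : Op) : ∃ K, ∀ (m : Mem) (B : ℕ), (∀ c, m.val c ≤ B) →
    Within x.cmd (m.tapes 0) ((x.run m).tapes 0) (K * (B + 1)) ∧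
      ∀ c, (x.run m).val c ≤ B + K := by
  have hset : ∀ (m : Mem) (B K y : ℕ) (c : Ctr), (∀ c, m.val c ≤ B) → y ≤ B + K →
      ∀ c', (m.set c y).val c' ≤ B + K := by
    intro m B K y c h hy c'
    rw [val_set, Function.update_apply]
    split_ifs
    · exact hy
    · exact (h c').trans (Nat.le_add_right _ _)
  cases x with
  | emit w =>
    exact ⟨w.length + 1, fun m B h => ⟨(within_emitCmd w m 0).mono (Nat.le_mul_of_pos_right _
      (Nat.succ_pos _)), fun c => (h c).trans (Nat.le_add_right _ _)⟩⟩
  | copy c k =>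
    refine ⟨k + 7, fun m B h => ⟨(within_copy c k m).mono ?_, fun c =>
      (h c).trans (Nat.le_add_right _ _)⟩⟩
    calc m.val c * (k + 5) + 2 ≤ B * (k + 5) + 2 :=
          Nat.add_le_add_right (Nat.mul_le_mul_right _ (h c)) _
      _ ≤ (k + 7) * (B + 1) := by ring_nf; omega
  | inc c k =>
    exact ⟨k + 1, fun m B h => ⟨(within_rep_push c k m).mono (Nat.le_mul_of_pos_right _
      (Nat.succ_pos _)), hset m B _ _ c h (by have := h c; omega)⟩⟩
  | dec c k =>
    exact ⟨k + 1, fun m B h => ⟨(within_rep_pop c k m).mono (Nat.le_mul_of_pos_right _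
      (Nat.succ_pos _)), hset m B _ _ c h (by have := h c; omega)⟩⟩

end Op

/-- The effect of a list of instructions. -/
def runOps : List Op → Mem → Mem
  | [], m => m
  | x :: l, m => runOps l (x.run m)

/-- The program of a list of instructions. -/
def opsCmd : List Op → Cmd Stk
  | [] => .skip
  | x :: l => .seq x.cmd (opsCmd l)

theorem runOps_append (l l' : List Op) (m : Mem) : runOps (l ++ l') m = runOps l' (runOps l m) := by
  induction l generalizing m with
  | nil => rfl
  | cons x l ih => exact ih _

/-- A fixed list of instructions takes time linear in the counters and increases them by at most a
constant; this increase is absorbed in the constant of the remaining list. -/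
theorem exists_within_opsCmd (l : List Op) : ∃ K, ∀ (m : Mem) (B : ℕ), (∀ c, m.val c ≤ B) →
    Within (opsCmd l) (m.tapes 0) ((runOps l m).tapes 0) (K * (B + 1)) ∧
      ∀ c, (runOps l m).val c ≤ B + K := by
  induction l with
  | nil =>
    exact ⟨1, fun m B h => ⟨(within_skip m 0).mono (by omega), fun c => (h c).trans (by omega)⟩⟩
  | cons x l ih =>
    obtain ⟨K, hK⟩ := x.exists_within
    obtain ⟨K', hK'⟩ := ih
    refine ⟨K + K' * (K + 1) + K', fun m B h => ?_⟩
    obtain ⟨h1, h2⟩ := hK m B h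
    obtain ⟨h3, h4⟩ := hK' _ _ h2
    refine ⟨(h1.seq h3).mono ?_, fun c => (h4 c).trans ?_⟩
    · calc K * (B + 1) + K' * (B + K + 1) ≤ K * (B + 1) + K' * (K + 1) * (B + 1) := by
            rw [mul_assoc]
            refine Nat.add_le_add_left (Nat.mul_le_mul_left _ ?_) _
            ring_nf
            have := Nat.zero_le (K * B)
            omega
        _ ≤ _ := by rw [← add_mul]; exact Nat.mul_le_mul_right _ (by omega)
    · have := Nat.zero_le (K' * (K + 1))
      omega

/-- The program repeating a list of instructions while a counter is positive. -/
def whileCmd (c : Ctr) (l : List Op) : Cmd Stk := .loop (.ctr c) isTick (opsCmd l)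

/-- Each round raises the counters by a constant, so after at most `B` rounds they are still linear
in `B`. Every round costs linear time, which makes quadratic time in total. -/
theorem exists_within_whileCmd (c : Ctr) (l : List Op) :
    ∃ K, ∀ (n : ℕ) (m : ℕ → Mem) (B : ℕ), n ≤ B → (∀ c, (m 0).val c ≤ B) →
      (∀ i < n, (m i).val c ≠ 0) → (m n).val c = 0 → (∀ i < n, m (i + 1) = runOps l (m i)) →
      Within (whileCmd c l) ((m 0).tapes 0) ((m n).tapes 0) (K * (B + 1) ^ 2) ∧
        ∀ c, (m n).val c ≤ K * (B + 1) := by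
  obtain ⟨K, hK⟩ := exists_within_opsCmd l
  refine ⟨K * (K + 1) + 2, fun n m B hn hB hp h0 hm => ?_⟩
  have hb : ∀ i ≤ n, ∀ c, (m i).val c ≤ B + i * K := by
    intro i hi
    induction i with
    | zero => simpa using hB
    | succ i ih =>
      intro c
      rw [hm i hi]
      have := (hK _ _ (ih (by omega))).2 c
      rw [Nat.succ_mul]
      omega
  have hb' : ∀ i ≤ n, B + i * K + 1 ≤ (K + 1) * (B + 1) := by
    intro i hi
    have : i * K ≤ B * K := Nat.mul_le_mul_right _ (hi.trans hn)
    rw [add_mul, one_mul, mul_add, mul_one, mul_comm K B]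
    omega
  refine ⟨(Within.loop n (fun i => (m i).tapes 0) (B := K * ((K + 1) * (B + 1)))
    (fun i hi => ?_) ?_ fun i hi => ?_).mono ?_, fun c => (hb n le_rfl c).trans ?_⟩
  · rw [isTick_ctr]
    simpa using hp i hi
  · rw [isTick_ctr]
    simpa using h0
  · rw [hm i hi]
    exact (hK _ _ (hb i hi.le)).1.mono (Nat.mul_le_mul_left _ (hb' i hi.le))
  · calc n * (K * ((K + 1) * (B + 1)) + 1) + 1 ≤ B * (K * ((K + 1) * (B + 1)) + 1) + 1 :=
          Nat.add_le_add_right (Nat.mul_le_mul_right _ hn) _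
      _ ≤ (K * (K + 1) + 2) * (B + 1) ^ 2 :=
          -- The added term is the exact difference of the two sides.
          le_of_le_of_eq (Nat.le_add_right _ (K * (K + 1) * (B + 1) + (2 * B ^ 2 + 3 * B + 1)))
            (by ring)
  · have h1 := hb' n le_rfl
    have h2 : (K + 1) * (B + 1) ≤ (K * (K + 1) + 2) * (B + 1) :=
      Nat.mul_le_mul_right _ (by nlinarith [Nat.zero_le (K * K)])
    omega

end SuccReals

namespace SuccReals
open Cmd Mem

/-! ### Programs for families of memories -/

section

variable {ι : Type} {size : ι → ℕ}

/-- The counters are linear in the size. -/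
def Small (size : ι → ℕ) (m : ι → Mem) : Prop := ∃ K, ∀ a c, (m a).val c ≤ K * (size a + 1)

/-- The program transforms the memories `m` into `m'` in quadratic time. -/
def Fast (size : ι → ℕ) (c : Cmd Stk) (m m' : ι → Mem) : Prop :=
  Small size m → Small size m' ∧ ∃ K, ∀ a,
    Within c ((m a).tapes 0) ((m' a).tapes 0) (K * (size a + 1) ^ 2)

/-- Linear counters are both hypothesis and conclusion of `Fast`, so the bound of one phase feeds
the next one and the time remains quadratic. -/
theorem Fast.seq {c c' : Cmd Stk} {m m' m'' : ι → Mem} (h : Fast size c m m')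
    (h' : Fast size c' m' m'') : Fast size (c.seq c') m m'' := by
  intro hm
  obtain ⟨h1, K, h2⟩ := h hm
  obtain ⟨h3, K', h4⟩ := h' h1
  exact ⟨h3, K + K', fun a => ((h2 a).seq (h4 a)).mono (by rw [add_mul])⟩

theorem fast_opsCmd (l : List Op) (m m' : ι → Mem) (h : ∀ a, runOps l (m a) = m' a) :
    Fast size (opsCmd l) m m' := by
  rintro ⟨K, hK⟩
  obtain ⟨K', hK'⟩ := exists_within_opsCmd l
  refine ⟨⟨K + K', fun a c => ?_⟩, K' * (K + 1), fun a => ?_⟩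
  · rw [← h a]
    refine ((hK' _ _ (hK a)).2 c).trans ?_
    rw [add_mul]
    exact Nat.add_le_add_left (Nat.le_mul_of_pos_right _ (Nat.succ_pos _)) _
  · rw [← h a]
    refine (hK' _ _ (hK a)).1.mono ?_
    rw [mul_assoc]
    refine Nat.mul_le_mul_left _ ?_
    calc K * (size a + 1) + 1 ≤ (K + 1) * (size a + 1) := by rw [add_mul]; omega
      _ ≤ _ := Nat.mul_le_mul_left _ (Nat.le_self_pow two_ne_zero _)

theorem fast_whileCmd (c : Ctr) (l : List Op) (n : ι → ℕ) (m : ι → ℕ → Mem)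
    (hn : ∀ a, n a ≤ size a) (hp : ∀ a, ∀ i < n a, (m a i).val c ≠ 0)
    (he : ∀ a, (m a (n a)).val c = 0) (hm : ∀ a, ∀ i < n a, runOps l (m a i) = m a (i + 1)) :
    Fast size (whileCmd c l) (fun a => m a 0) (fun a => m a (n a)) := by
  rintro ⟨K, hK⟩
  obtain ⟨K', hK'⟩ := exists_within_whileCmd c l
  have h : ∀ a, (K + 1) * (size a + 1) + 1 ≤ (K + 2) * (size a + 1) := fun a => by
    rw [add_mul K 2, add_mul K 1]
    omega
  have h1 := fun a => hK' (n a) (m a) ((K + 1) * (size a + 1))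
    ((hn a).trans (by rw [add_mul]; omega))
    (fun c => (hK a c).trans (Nat.mul_le_mul_right _ (Nat.le_succ _))) (hp a) (he a)
    (fun i hi => (hm a i hi).symm)
  refine ⟨⟨K' * (K + 2), fun a c => ((h1 a).2 c).trans ?_⟩, K' * (K + 2) ^ 2, fun a =>
    (h1 a).1.mono ?_⟩
  · rw [mul_assoc]
    exact Nat.mul_le_mul_left _ (h a)
  · rw [mul_assoc, ← mul_pow]
    exact Nat.mul_le_mul_left _ (Nat.pow_le_pow_left (h a) 2)

end

/-! ### Writing references and negation gates -/

/-- The number described by a list of multiples of counters and a constant. -/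
def refVal (m : Mem) (x : List (Ctr × ℕ) × ℕ) : ℕ :=
  (x.1.map fun y => y.2 * m.val y.1).sum + x.2

/-- The instructions writing a number in unary. -/
def refOps (x : List (Ctr × ℕ) × ℕ) : List Op :=
  x.1.map (fun y => .copy y.1 y.2) ++ [.emit (encodeNat x.2)]

/-- Unary numbers are added by concatenation; only the constant, written last, brings the separator.
-/
theorem runOps_refOps (x : List (Ctr × ℕ) × ℕ) (m : Mem) :
    runOps (refOps x) m = m.emit (encodeNat (refVal m x)) := by
  obtain ⟨l, k⟩ := x
  induction l generalizing m with
  | nil => simp [refOps, refVal, runOps, Op.run]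
  | cons y l ih =>
    have h : runOps (refOps (y :: l, k)) m = runOps (refOps (l, k)) ((Op.copy y.1 y.2).run m) := rfl
    rw [h, ih, Op.run, emit_emit]
    simp only [refVal, List.map_cons, List.sum_cons, encodeNat, val_emit, List.replicate_add,
      List.append_assoc]

/-- The instructions writing a list of negation gates. -/
def notsOps : List (List (Ctr × ℕ) × ℕ) → ℕ → List Op
  | [], _ => []
  | x :: l, r => .emit [.not] :: (refOps (x.1, x.2 + r) ++ notsOps l (r + 1))

theorem runOps_notsOps (l : List (List (Ctr × ℕ) × ℕ)) (r : ℕ) (m : Mem) :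
    runOps (notsOps l r) m = m.emit ((nots (l.map (refVal m)) r).flatMap encodeGate) := by
  induction l generalizing r m with
  | nil => simp [notsOps, nots, runOps]
  | cons x l ih =>
    have h : ∀ w, refVal (m.emit w) = refVal m := fun _ => rfl
    rw [notsOps, runOps, runOps_append, runOps_refOps, ih]
    simp only [h, emit_emit, Op.run]
    simp [nots, encodeGate, refVal, add_assoc]

/-- Values of the counters. -/
def vals (n b c o w p f s : ℕ) : Ctr → ℕ
  | .len => n
  | .blocks => b
  | .check => c
  | .outs => o
  | .wires => w
  | .pos => p
  | .fst => f
  | .snd => s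

section

variable (n b c o w p f s x : ℕ) (inp out : List Sym)

@[simp] theorem set_len : Mem.set ⟨inp, out, vals n b c o w p f s⟩ .len x =
    ⟨inp, out, vals x b c o w p f s⟩ :=
  Mem.ext rfl rfl (funext fun k => by cases k <;> rfl)
@[simp] theorem set_blocks : Mem.set ⟨inp, out, vals n b c o w p f s⟩ .blocks x =
    ⟨inp, out, vals n x c o w p f s⟩ :=
  Mem.ext rfl rfl (funext fun k => by cases k <;> rfl)
@[simp] theorem set_check : Mem.set ⟨inp, out, vals n b c o w p f s⟩ .check x =
    ⟨inp, out, vals n b x o w p f s⟩ :=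
  Mem.ext rfl rfl (funext fun k => by cases k <;> rfl)
@[simp] theorem set_outs : Mem.set ⟨inp, out, vals n b c o w p f s⟩ .outs x =
    ⟨inp, out, vals n b c x w p f s⟩ :=
  Mem.ext rfl rfl (funext fun k => by cases k <;> rfl)
@[simp] theorem set_wires : Mem.set ⟨inp, out, vals n b c o w p f s⟩ .wires x =
    ⟨inp, out, vals n b c o x p f s⟩ :=
  Mem.ext rfl rfl (funext fun k => by cases k <;> rfl)
@[simp] theorem set_pos : Mem.set ⟨inp, out, vals n b c o w p f s⟩ .pos x =
    ⟨inp, out, vals n b c o w x f s⟩ :=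
  Mem.ext rfl rfl (funext fun k => by cases k <;> rfl)
@[simp] theorem set_fst : Mem.set ⟨inp, out, vals n b c o w p f s⟩ .fst x =
    ⟨inp, out, vals n b c o w p x s⟩ :=
  Mem.ext rfl rfl (funext fun k => by cases k <;> rfl)
@[simp] theorem set_snd : Mem.set ⟨inp, out, vals n b c o w p f s⟩ .snd x =
    ⟨inp, out, vals n b c o w p f x⟩ :=
  Mem.ext rfl rfl (funext fun k => by cases k <;> rfl)

end

theorem small_vals {ι : Type} {size : ι → ℕ} {inp out : ι → List Sym} {n b c o w p f s : ι → ℕ}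
    (K : ℕ) (h : ∀ a, n a + b a + c a + o a + w a + p a + f a + s a ≤ K * (size a + 1)) :
    Small size (fun a => ⟨inp a, out a, vals (n a) (b a) (c a) (o a) (w a) (p a) (f a) (s a)⟩) :=
  ⟨K, fun a k => by have := h a; cases k <;> simp only [vals] <;> omega⟩

/-! ### The program writing the instance -/

/-- The references of the control logic. -/
def ctrlSpec : List (List (Ctr × ℕ) × ℕ) :=
  [([(.len, 1)], 0), ([(.len, 2)], 1), ([(.len, 3)], 2), ([(.len, 4)], 3), ([(.len, 4)], 4),
    ([(.len, 4)], 5), ([(.len, 4)], 6), ([(.wires, 1), (.len, 1)], 6),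
    ([(.wires, 1), (.len, 1)], 5), ([(.wires, 1), (.len, 1)], 4), ([(.wires, 1), (.len, 1)], 3),
    ([(.wires, 1), (.len, 1)], 2), ([(.wires, 1), (.len, 1)], 1), ([(.wires, 1), (.len, 1)], 0)]

/-- The references at one position. -/
noncomputable def scanSpec : List (List (Ctr × ℕ) × ℕ) :=
  [([(.wires, 1)], ctrlSize + 1), ([(.len, 4), (.pos, 1)], ctrlSize + 3),
    ([(.len, 3), (.pos, 1)], ctrlSize + 2), ([(.len, 2), (.pos, 1)], ctrlSize + 1),
    ([(.len, 1), (.pos, 1)], ctrlSize)]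

/-- The instructions writing the control logic. -/
noncomputable def ctrlOps : List Op :=
  notsOps ctrlSpec 0 ++ [.emit ((synth ctrlFun).flatMap encodeGate)]

/-- The instructions writing the gates for one position. -/
noncomputable def scanOps : List Op :=
  notsOps scanSpec 0 ++ [.emit ((synth scanFun).flatMap encodeGate), .dec .blocks 1,
    .inc .wires (scanSize + 2), .inc .pos scanSize, .inc .fst (scanSize + 1),
    .inc .snd (scanSize + 1)]

/-- The instructions writing a wire of the selected node. -/
noncomputable def wireOps (c : Ctr) : List Op :=
  .dec c (scanSize + 1) :: refOps ([(c, 1)], (synth outFun).length)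

/-- The program writing the instance after the copied gates and the negated outputs. -/
noncomputable def writeCmd : Cmd Stk :=
  .seq (opsCmd ctrlOps) <| .seq (whileCmd .blocks scanOps) <|
  .seq (opsCmd [.emit ((synth outFun).flatMap encodeGate ++ .fin ::
    [0, 1, 2, 3, 4, 5, 6, 7, 8].flatMap encodeNat)]) <|
  .seq (whileCmd .fst (wireOps .fst)) <|
  .seq (opsCmd [.emit ([9, 10, 11, 12, 13].flatMap encodeNat)]) <|
  .seq (whileCmd .snd (wireOps .snd)) <| opsCmd [.emit [.fin]]

theorem runOps_ctrlOps (n b U : ℕ) (o : List Sym) :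
    runOps ctrlOps ⟨[], o, vals n b 0 0 U 0 0 0⟩ =
      ⟨[], o ++ (ctrlGates n U).flatMap encodeGate, vals n b 0 0 U 0 0 0⟩ := by
  have h : ctrlSpec.map (refVal ⟨[], o, vals n b 0 0 U 0 0 0⟩) = ctrlRefs n U := by
    simp [ctrlSpec, refVal, vals, ctrlRefs]
  rw [ctrlOps, runOps_append, runOps_notsOps, h]
  simp [runOps, Op.run, emit, ctrlGates]

/-- The counters `.wires` and `.pos` hold the parts of the addresses that grow with the position, so
every reference is a fixed linear combination of counters. Meanwhile `.fst` and `.snd` accumulate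
the total length of the blocks. -/
theorem runOps_scanOps (n b U i f s : ℕ) (o : List Sym) :
    runOps scanOps
      ⟨[], o, vals n b 0 0 (U + i * (scanSize + 2)) (i * scanSize) f s⟩ =
      ⟨[], o ++ (scanGates n U i).flatMap encodeGate, vals n (b - 1) 0 0
        (U + (i + 1) * (scanSize + 2)) ((i + 1) * scanSize) (f + (scanSize + 1))
        (s + (scanSize + 1))⟩ := by
  have h : scanSpec.map (refVal ⟨[], o, vals n b 0 0 (U + i * (scanSize + 2)) (i * scanSize) f s⟩) =
      scanRefs n U i := by
    simp [scanSpec, refVal, vals, scanRefs, add_assoc]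
  rw [scanOps, runOps_append, runOps_notsOps, h]
  simp [runOps, Op.run, emit, scanGates, vals, Nat.succ_mul, add_assoc]

theorem nodeWires_eq (n : ℕ) : nodeWires n =
    (List.range n).map fun i => (n - 1 - i) * (scanSize + 1) + (synth outFun).length := by
  exact List.ext_getElem (by simp [nodeWires]) (by simp [nodeWires])

/-- The output while the wires of the selected node are written. -/
noncomputable def wireOut (n k : ℕ) : List Sym :=
  ((List.range k).map fun i =>
    (n - 1 - i) * (scanSize + 1) + (synth outFun).length).flatMap encodeNat

theorem wireOut_succ (n k : ℕ) : wireOut n (k + 1) = wireOut n k ++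
    encodeNat ((n - 1 - k) * (scanSize + 1) + (synth outFun).length) := by
  simp [wireOut, List.range_succ]

/-- The counter is reduced by one block length before each reference and then is the address itself,
up to the length of the output logic. The node is listed twice, and each listing uses up a counter
of its own. -/
theorem runOps_wireOps_fst (n b U p s k : ℕ) (o : List Sym) (hk : k < n) :
    runOps (wireOps .fst) ⟨[], o ++ wireOut n k, vals n b 0 0 U p ((n - k) * (scanSize + 1)) s⟩ =
      ⟨[], o ++ wireOut n (k + 1), vals n b 0 0 U p ((n - (k + 1)) * (scanSize + 1)) s⟩ := by
  have h : (n - k) * (scanSize + 1) - (scanSize + 1) = (n - (k + 1)) * (scanSize + 1) := by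
    rw [show n - k = n - (k + 1) + 1 by omega, Nat.succ_mul, Nat.add_sub_cancel]
  rw [wireOps, runOps, runOps_refOps, wireOut_succ, show n - 1 - k = n - (k + 1) by omega]
  simp [Op.run, emit, refVal, vals, h]

theorem runOps_wireOps_snd (n b U p f k : ℕ) (o : List Sym) (hk : k < n) :
    runOps (wireOps .snd) ⟨[], o ++ wireOut n k, vals n b 0 0 U p f ((n - k) * (scanSize + 1))⟩ =
      ⟨[], o ++ wireOut n (k + 1), vals n b 0 0 U p f ((n - (k + 1)) * (scanSize + 1))⟩ := by
  have h : (n - k) * (scanSize + 1) - (scanSize + 1) = (n - (k + 1)) * (scanSize + 1) := by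
    rw [show n - k = n - (k + 1) + 1 by omega, Nat.succ_mul, Nat.add_sub_cancel]
  rw [wireOps, runOps, runOps_refOps, wireOut_succ, show n - 1 - k = n - (k + 1) by omega]
  simp [Op.run, emit, refVal, vals, h]

theorem fast_writeCmd {ι : Type} {size : ι → ℕ} (n U : ι → ℕ) (o : ι → List Sym)
    (hn : ∀ a, n a ≤ size a) :
    Fast size writeCmd (fun a => ⟨[], o a, vals (n a) (n a) 0 0 (U a) 0 0 0⟩) (fun a =>
      ⟨[], o a ++ ((ctrlGates (n a) (U a) ++ (scanAll (n a) (U a) (n a) ++ synth outFun)).flatMap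
          encodeGate ++ .fin :: (([0, 1, 2, 3, 4, 5, 6, 7, 8] ++ (nodeWires (n a) ++
            ([9, 10, 11, 12, 13] ++ nodeWires (n a)))).flatMap encodeNat ++ [.fin])),
        vals (n a) 0 0 0 (U a + n a * (scanSize + 2)) (n a * scanSize) 0 0⟩) := by
  refine (fast_opsCmd _ _ _ fun a => runOps_ctrlOps _ _ _ _).seq ?_
  refine Fast.seq (m' := fun a => ⟨[], o a ++ (ctrlGates (n a) (U a)).flatMap encodeGate ++
    (scanAll (n a) (U a) (n a)).flatMap encodeGate, vals (n a) 0 0 0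
      (U a + n a * (scanSize + 2)) (n a * scanSize) (n a * (scanSize + 1))
        (n a * (scanSize + 1))⟩) ?_ ?_
  · have h := fast_whileCmd (size := size) .blocks scanOps n (fun a i => ⟨[],
      o a ++ (ctrlGates (n a) (U a)).flatMap encodeGate ++
      (scanAll (n a) (U a) i).flatMap encodeGate, vals (n a) (n a - i) 0 0
      (U a + i * (scanSize + 2)) (i * scanSize) (i * (scanSize + 1)) (i * (scanSize + 1))⟩) hn
      (fun a i hi => by simp only [vals]; omega) (fun a => by simp [vals]) (fun a i hi => by
        rw [runOps_scanOps, scanAll, List.flatMap_append, List.append_assoc, Nat.sub_sub,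
          Nat.succ_mul i (scanSize + 1)])
    simpa [scanAll] using h
  refine (fast_opsCmd _ _ _ fun a => rfl).seq ?_
  generalize hS : (fun a => runOps [.emit ((synth outFun).flatMap encodeGate ++ .fin ::
    [0, 1, 2, 3, 4, 5, 6, 7, 8].flatMap encodeNat)] ⟨[], o a ++ (ctrlGates (n a) (U a)).flatMap
      encodeGate ++ (scanAll (n a) (U a) (n a)).flatMap encodeGate, vals (n a) 0 0 0
      (U a + n a * (scanSize + 2)) (n a * scanSize) (n a * (scanSize + 1))
        (n a * (scanSize + 1))⟩) = S
  obtain ⟨o', ho'⟩ : ∃ o' : ι → List Sym, o' = fun a => o a ++ (ctrlGates (n a) (U a)).flatMap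
      encodeGate ++ (scanAll (n a) (U a) (n a)).flatMap encodeGate ++
        ((synth outFun).flatMap encodeGate ++ .fin ::
          [0, 1, 2, 3, 4, 5, 6, 7, 8].flatMap encodeNat) := ⟨_, rfl⟩
  have hS' : S = fun a => ⟨[], o' a, vals (n a) 0 0 0
      (U a + n a * (scanSize + 2)) (n a * scanSize) (n a * (scanSize + 1))
        (n a * (scanSize + 1))⟩ := by
    rw [← hS, ho']
    rfl
  rw [hS']
  have hpos : ∀ a, ∀ i < n a, (n a - i) * (scanSize + 1) ≠ 0 := fun a i hi =>
    Nat.mul_ne_zero (by omega) (Nat.succ_ne_zero _)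
  refine Fast.seq (m' := fun a => ⟨[], o' a ++ wireOut (n a) (n a), vals (n a) 0 0 0
      (U a + n a * (scanSize + 2)) (n a * scanSize) 0 (n a * (scanSize + 1))⟩) ?_ ?_
  · have h := fast_whileCmd (size := size) .fst (wireOps .fst) n (fun a i => ⟨[],
      o' a ++ wireOut (n a) i, vals (n a) 0 0 0 (U a + n a * (scanSize + 2)) (n a * scanSize)
        ((n a - i) * (scanSize + 1)) (n a * (scanSize + 1))⟩) hn
      hpos (fun a => by simp [vals]) (fun a i hi => runOps_wireOps_fst _ _ _ _ _ _ _ hi)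
    simpa [wireOut] using h
  refine (fast_opsCmd _ _ (fun a => ⟨[], o' a ++ wireOut (n a) (n a) ++
    [9, 10, 11, 12, 13].flatMap encodeNat, vals (n a) 0 0 0
      (U a + n a * (scanSize + 2)) (n a * scanSize) 0 (n a * (scanSize + 1))⟩) fun a => rfl).seq ?_
  refine Fast.seq (m' := fun a => ⟨[], o' a ++ wireOut (n a) (n a) ++
    [9, 10, 11, 12, 13].flatMap encodeNat ++ wireOut (n a) (n a), vals (n a) 0 0 0
      (U a + n a * (scanSize + 2)) (n a * scanSize) 0 0⟩) ?_ ?_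
  · have h := fast_whileCmd (size := size) .snd (wireOps .snd) n (fun a i => ⟨[],
      o' a ++ wireOut (n a) (n a) ++ [9, 10, 11, 12, 13].flatMap encodeNat ++ wireOut (n a) i,
      vals (n a) 0 0 0 (U a + n a * (scanSize + 2)) (n a * scanSize) 0
        ((n a - i) * (scanSize + 1))⟩) hn
      hpos (fun a => by simp [vals]) (fun a i hi => runOps_wireOps_snd _ _ _ _ _ _ _ hi)
    simpa [wireOut] using h
  refine fast_opsCmd _ _ _ fun a => ?_
  have hw : (nodeWires (n a)).flatMap encodeNat = wireOut (n a) (n a) := by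
    rw [nodeWires_eq, wireOut]
  simp only [runOps, Op.run, emit, ho', List.flatMap_append, hw, List.append_assoc]
  simp only [List.cons_append]

end SuccReals

namespace SuccReals
open Cmd Mem

/-! ### Reading the circuit -/

/-- The test for a symbol other than the end mark. -/
def notFin : Option Sym → Bool := fun a => !(a == some .fin)

/-- The test for the first symbol of a gate. -/
def isGate : Option Sym → Bool := fun a =>
  a == some .tru || a == some .fls || a == some .not || a == some .and || a == some .or

/-- The program reading the number of inputs. -/
def readCmd : Cmd Stk :=
  .seq (.loop .inp isTick (.seq (.move .inp (.ctr .len))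
    (.seq (.push (.ctr .blocks) .tick) (.push (.ctr .check) .tick)))) (.pop .inp)

/-- The number of inputs is stored three times: `.len` is kept for references, `.blocks` controls
the loop over the positions, and `.check` is used up in testing the number of outputs. -/
theorem within_readCmd (n : ℕ) (w : List Sym) :
    Within readCmd (tapes 0 ⟨encodeNat n ++ w, [], vals 0 0 0 0 0 0 0 0⟩)
      (tapes 0 ⟨w, [], vals n n n 0 0 0 0 0⟩) (4 * n + 2) := by
  have h := Within.loop (k := .inp) (p := isTick) (c := .seq (.move .inp (.ctr .len))
    (.seq (.push (.ctr .blocks) .tick) (.push (.ctr .check) .tick))) n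
    (fun i => tapes 0 ⟨encodeNat (n - i) ++ w, [], vals i i i 0 0 0 0 0⟩) (B := 3)
    (fun i hi => by
      obtain ⟨x, hx⟩ : ∃ x, n - i = x + 1 := ⟨n - i - 1, by omega⟩
      rw [hx]; rfl)
    (by rw [Nat.sub_self]; rfl)
    (fun i hi => by
      obtain ⟨x, hx⟩ : ∃ x, n - i = x + 1 := ⟨n - i - 1, by omega⟩
      have h := (within_move_inp_ctr ⟨encodeNat (n - i) ++ w, [], vals i i i 0 0 0 0 0⟩ 0 .len
        (l := encodeNat x ++ w) (by simp [hx, encodeNat, List.replicate_succ])).seq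
        ((within_push_ctr _ 0 .blocks).seq (within_push_ctr _ 0 .check))
      rw [show n - (i + 1) = x by omega]
      simpa [setInp, vals] using h)
  have h2 := h.seq (within_pop_inp _ 0)
  simp only [Nat.sub_zero, Nat.sub_self] at h2
  exact h2.mono (by omega)

/-- The program copying the gates. -/
def gatesCmd : Cmd Stk :=
  .seq (.loop .inp notFin (.seq (.ite .inp isGate (.push (.ctr .wires) .tick) .skip)
    (.move .inp .acc))) (.pop .inp)

/-- The gates need no translation, since their references count backwards. Their number is found by
counting the symbols that begin a gate. -/
theorem within_copy_symbols (w w' o : List Sym) (hw : ∀ a ∈ w, a ≠ .fin) (n b c u : ℕ) :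
    Within (.loop .inp notFin (.seq (.ite .inp isGate (.push (.ctr .wires) .tick) .skip)
      (.move .inp .acc))) (tapes 0 ⟨w ++ .fin :: w', o, vals n b c 0 u 0 0 0⟩)
      (tapes 0 ⟨.fin :: w', o ++ w, vals n b c 0 (u + w.countP fun a => isGate (some a)) 0 0 0⟩)
      (4 * w.length + 1) := by
  induction w generalizing o u with
  | nil =>
    simp only [List.append_nil]
    exact ⟨1, by simp, .loopEnd rfl⟩
  | cons a w ih =>
    have h1 : Within (.ite .inp isGate (.push (.ctr .wires) .tick) .skip)
        (tapes 0 ⟨a :: w ++ .fin :: w', o, vals n b c 0 u 0 0 0⟩)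
        (tapes 0 ⟨a :: w ++ .fin :: w', o,
          vals n b c 0 (u + if isGate (some a) then 1 else 0) 0 0 0⟩) 2 := by
      cases ha : isGate (some a)
      · exact (within_skip _ 0).iteFalse ha
      · have h := within_push_ctr ⟨a :: w ++ .fin :: w', o, vals n b c 0 u 0 0 0⟩ 0 .wires
        rw [set_wires] at h
        exact h.iteTrue ha
    obtain ⟨t, ht, hr⟩ := h1.seq (within_move_inp_acc _ 0 rfl)
    obtain ⟨t', ht', hr'⟩ := ih (o ++ [a]) (fun x hx => hw x (List.mem_cons_of_mem _ hx))
      (u + if isGate (some a) then 1 else 0)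
    have h3 := Runs.loopStep (k := .inp) (p := notFin) (by
      have := hw a List.mem_cons_self
      simpa [tapes, notFin] using this) hr hr'
    refine ⟨t' + t + 1, ?_, ?_⟩
    · rw [List.length_cons]
      omega
    · rw [List.countP_cons]
      simpa [add_assoc, add_comm, add_left_comm] using h3

theorem countP_encodeNat (n : ℕ) : (encodeNat n).countP (fun a => isGate (some a)) = 0 := by
  rw [List.countP_eq_zero]
  intro a ha
  simp only [encodeNat, List.mem_append, List.mem_replicate, List.mem_singleton] at ha
  rcases ha with ⟨-, rfl⟩ | rfl <;> decide

theorem countP_encodeGate (g : Gate) : (encodeGate g).countP (fun a => isGate (some a)) = 1 := by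
  rcases g with (_ | _) | i | ⟨i, j⟩ | ⟨i, j⟩
  · rfl
  · rfl
  all_goals
    simp only [encodeGate, List.countP_cons, List.countP_append, countP_encodeNat]
    rfl

theorem countP_gates (l : List Gate) :
    (l.flatMap encodeGate).countP (fun a => isGate (some a)) = l.length := by
  induction l with
  | nil => rfl
  | cons g l ih => rw [List.flatMap_cons, List.countP_append, countP_encodeGate, ih,
      List.length_cons, add_comm]

theorem ne_fin_of_mem_encodeNat {n : ℕ} {a : Sym} (h : a ∈ encodeNat n) : a ≠ .fin := by
  simp only [encodeNat, List.mem_append, List.mem_replicate, List.mem_singleton] at h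
  rcases h with ⟨-, rfl⟩ | rfl <;> decide

theorem ne_fin_of_mem_gates {l : List Gate} : ∀ a ∈ l.flatMap encodeGate, a ≠ .fin := by
  intro a ha
  obtain ⟨g, -, ha⟩ := List.mem_flatMap.1 ha
  rcases g with (_ | _) | i | ⟨i, j⟩ | ⟨i, j⟩ <;>
    simp only [encodeGate, List.mem_cons, List.mem_append, List.not_mem_nil, or_false] at ha
  · exact ha ▸ by decide
  · exact ha ▸ by decide
  · rcases ha with rfl | ha
    · decide
    · exact ne_fin_of_mem_encodeNat ha
  all_goals
    rcases ha with rfl | ha | ha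
    · decide
    · exact ne_fin_of_mem_encodeNat ha
    · exact ne_fin_of_mem_encodeNat ha

theorem within_gatesCmd (l : List Gate) (w o : List Sym) (n b c : ℕ) :
    Within gatesCmd (tapes 0 ⟨l.flatMap encodeGate ++ .fin :: w, o, vals n b c 0 0 0 0 0⟩)
      (tapes 0 ⟨w, o ++ l.flatMap encodeGate, vals n b c 0 l.length 0 0 0⟩)
      (4 * (l.flatMap encodeGate).length + 2) := by
  have h := (within_copy_symbols (l.flatMap encodeGate) w o ne_fin_of_mem_gates n b c 0).seq
    (within_pop_inp _ 0)
  rw [countP_gates, zero_add] at h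
  exact h

/-- The instructions after copying a reference to an output. -/
def shiftOps : List Op := [.copy .outs 1, .emit [.sep], .inc .outs 1, .inc .wires 1]

/-- The program negating the wire with the next reference of the input. -/
def outputCmd : Cmd Stk :=
  .seq (emitCmd [.not]) (.seq (.loop .inp isTick (.move .inp .acc))
    (.seq (.pop .inp) (opsCmd shiftOps)))

/-- The program negating the outputs of the circuit. -/
def outputsCmd : Cmd Stk := .seq (.loop .inp notFin outputCmd) (.pop .inp)

theorem within_copy_ticks (x : ℕ) (w o : List Sym) (v : Ctr → ℕ) :
    Within (.loop .inp isTick (.move .inp .acc)) (tapes 0 ⟨encodeNat x ++ w, o, v⟩)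
      (tapes 0 ⟨.sep :: w, o ++ List.replicate x .tick, v⟩) (2 * x + 1) := by
  induction x generalizing o with
  | zero =>
    simp only [List.replicate_zero, List.append_nil]
    exact ⟨1, by simp, .loopEnd rfl⟩
  | succ x ih =>
    obtain ⟨t, ht, hr⟩ := within_move_inp_acc ⟨encodeNat (x + 1) ++ w, o, v⟩ 0 (a := .tick)
      (l := encodeNat x ++ w) (by simp [encodeNat, List.replicate_succ])
    obtain ⟨t', ht', hr'⟩ := ih (o ++ [.tick])
    refine ⟨_, ?_, by
      simpa [List.replicate_succ] using Runs.loopStep (k := .inp) (p := isTick) rfl hr hr'⟩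
    omega

/-- The new reference has to skip the `j` negation gates already written; the value `j` of `.outs`
is appended in unary to the copied ticks. -/
theorem exists_within_outputCmd : ∃ K, ∀ (x j n b c u B : ℕ) (w o : List Sym),
    x ≤ B → j ≤ B → n ≤ B → b ≤ B → c ≤ B → u ≤ B →
    Within outputCmd (tapes 0 ⟨encodeNat x ++ w, o, vals n b c j u 0 0 0⟩)
      (tapes 0 ⟨w, o ++ encodeGate (.not (x + j)), vals n b c (j + 1) (u + 1) 0 0 0⟩)
      (K * (B + 1)) := by
  obtain ⟨K, hK⟩ := exists_within_opsCmd shiftOps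
  refine ⟨K + 4, fun x j n b c u B w o hx hj hn hb hc hu => ?_⟩
  have h := (within_emitCmd [.not] ⟨encodeNat x ++ w, o, vals n b c j u 0 0 0⟩ 0).seq
    ((within_copy_ticks x w (o ++ [.not]) (vals n b c j u 0 0 0)).seq
      ((within_pop_inp ⟨.sep :: w, o ++ [.not] ++ List.replicate x .tick, vals n b c j u 0 0 0⟩
        0).seq (hK _ B (fun k => by cases k <;> simp only [val_setInp, vals] <;> omega)).1))
  have e : runOps shiftOps (setInp ⟨.sep :: w, o ++ [.not] ++ List.replicate x .tick,
      vals n b c j u 0 0 0⟩ w) =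
      ⟨w, o ++ encodeGate (.not (x + j)), vals n b c (j + 1) (u + 1) 0 0 0⟩ := by
    simp only [shiftOps, runOps, Op.run, emit, setInp, set_outs, set_wires, vals, one_mul,
      encodeGate, encodeNat, List.replicate_add]
    simp only [List.append_assoc, List.cons_append, List.nil_append]
  simp only [List.tail_cons, e] at h
  refine h.mono ?_
  rw [add_mul]
  simp only [List.length_cons, List.length_nil]
  omega

theorem within_outputs_loop {K B : ℕ} (hK : ∀ (x j n b c u : ℕ) (w o : List Sym),
    x ≤ B → j ≤ B → n ≤ B → b ≤ B → c ≤ B → u ≤ B →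
    Within outputCmd (tapes 0 ⟨encodeNat x ++ w, o, vals n b c j u 0 0 0⟩)
      (tapes 0 ⟨w, o ++ encodeGate (.not (x + j)), vals n b c (j + 1) (u + 1) 0 0 0⟩) K)
    (l : List ℕ) (w o : List Sym) (j n b c u : ℕ) (hl : ∀ x ∈ l, x ≤ B) (hj : j + l.length ≤ B)
    (hn : n ≤ B) (hb : b ≤ B) (hc : c ≤ B) (hu : u + l.length ≤ B) :
    Within (.loop .inp notFin outputCmd)
      (tapes 0 ⟨l.flatMap encodeNat ++ .fin :: w, o, vals n b c j u 0 0 0⟩)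
      (tapes 0 ⟨.fin :: w, o ++ (nots l j).flatMap encodeGate,
        vals n b c (j + l.length) (u + l.length) 0 0 0⟩) (l.length * (K + 1) + 1) := by
  induction l generalizing o j u with
  | nil =>
    simp only [nots, List.flatMap_nil, List.append_nil]
    exact ⟨1, by simp, .loopEnd rfl⟩
  | cons x l ih =>
    rw [List.length_cons] at hj hu
    obtain ⟨t, ht, hr⟩ := hK x j n b c u (l.flatMap encodeNat ++ .fin :: w) o
      (hl x List.mem_cons_self) (by omega) hn hb hc (by omega)
    obtain ⟨t', ht', hr'⟩ := ih (o ++ encodeGate (.not (x + j))) (j + 1) (u + 1)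
      (fun y hy => hl y (List.mem_cons_of_mem _ hy)) (by omega) (by omega)
    have h3 := Runs.loopStep (k := .inp) (p := notFin) (by cases x <;> rfl) hr hr'
    refine ⟨t' + t + 1, ?_, ?_⟩
    · rw [List.length_cons, Nat.succ_mul]
      omega
    · simpa [nots, add_assoc, add_comm 1] using h3

end SuccReals

namespace SuccReals
open Cmd Mem

/-! ### Clearing stacks -/

/-- A step lengthens a stack by at most one symbol. This bounds the length of the output by the
running time, and hence the cost of erasing or moving it. -/
theorem Cmd.Runs.length_le {K : Type} [DecidableEq K] {c : Cmd K} {S S' : K → List Sym} {t : ℕ}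
    (h : Runs c S S' t) (k : K) : (S' k).length ≤ (S k).length + t := by
  induction h with
  | skip => exact Nat.le_succ _
  | push k' a S =>
    rw [Function.update_apply]
    split_ifs with hk
    · rw [hk, List.length_cons]
    · exact Nat.le_succ _
  | pop k' S =>
    rw [Function.update_apply]
    split_ifs with hk
    · rw [hk, List.length_tail]
      omega
    · exact Nat.le_succ _
  | move k' k'' S a l h =>
    simp only [Function.update_apply]
    split_ifs with h1 h2 h3
    · rw [h1, h2, h, List.length_cons]
      omega
    · rw [h1, List.length_cons]
    · rw [h3, h, List.length_cons]
      omega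
    · exact Nat.le_succ _
  | seq _ _ ih ih' => omega
  | iteTrue _ _ ih => omega
  | iteFalse _ _ ih => omega
  | loopEnd => exact Nat.le_succ _
  | loopStep _ _ _ ih ih' => omega

/-- The program emptying a stack. -/
def clearCmd (k : Stk) : Cmd Stk := .loop k Option.isSome (.pop k)

theorem within_clearCmd (k : Stk) (S : Stk → List Sym) :
    Within (clearCmd k) S (Function.update S k []) (2 * (S k).length + 1) := by
  generalize hw : S k = w
  induction w generalizing S with
  | nil =>
    rw [← hw, Function.update_eq_self]
    exact ⟨1, by simp, .loopEnd (by rw [hw]; rfl)⟩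
  | cons a w ih =>
    obtain ⟨t, ht, hr⟩ := ih (Function.update S k (S k).tail) (by simp [hw])
    rw [Function.update_idem] at hr
    exact ⟨_, by rw [List.length_cons]; omega, .loopStep (by rw [hw]; rfl) (.pop k S) hr⟩

/-- The program emptying a list of stacks. -/
def clearAll : List Stk → Cmd Stk
  | [] => .skip
  | k :: l => .seq (clearCmd k) (clearAll l)

theorem within_clearAll (l : List Stk) (S : Stk → List Sym) (B : ℕ) (hB : ∀ k, (S k).length ≤ B) :
    Within (clearAll l) S (fun k => if k ∈ l then [] else S k) (l.length * (2 * B + 1) + 1) := by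
  induction l generalizing S with
  | nil => exact ⟨1, by simp, .skip S⟩
  | cons k l ih =>
    have h := (within_clearCmd k S).seq (ih (Function.update S k []) fun k' => by
      rw [Function.update_apply]
      split_ifs
      · exact Nat.zero_le _
      · exact hB k')
    have e : (fun k' => if k' ∈ l then [] else Function.update S k [] k') =
        fun k' => if k' ∈ k :: l then [] else S k' := by
      funext k'
      by_cases h1 : k' = k
      · simp [h1]
      · simp [h1]
    rw [e] at h
    refine h.mono ?_
    have := hB k
    rw [List.length_cons, Nat.add_mul, Nat.one_mul]
    omega

/-- The stacks during the transport of the output. -/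
def outStacks (w w' : List Sym) : Stk → List Sym
  | .acc => w
  | .out => w'
  | _ => []

theorem within_move_acc_out (w w' : List Sym) :
    Within (.loop .acc Option.isSome (.move .acc .out)) (outStacks w w')
      (outStacks [] (w.reverse ++ w')) (2 * w.length + 1) := by
  induction w generalizing w' with
  | nil => exact ⟨1, by simp, .loopEnd rfl⟩
  | cons a w ih =>
    obtain ⟨t, ht, hr⟩ := ih (a :: w')
    have h := Runs.move Stk.acc Stk.out (outStacks (a :: w) w') a w rfl
    have e : Function.update (Function.update (outStacks (a :: w) w') .acc w) .out
        (a :: Function.update (outStacks (a :: w) w') .acc w .out) = outStacks w (a :: w') := by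
      funext k
      cases k <;> simp [outStacks]
    rw [e] at h
    refine ⟨t + 1 + 1, by rw [List.length_cons]; omega, ?_⟩
    rw [List.reverse_cons, List.append_assoc]
    exact .loopStep rfl h hr

/-- The program clearing the counters and moving the output to its stack. -/
def finishCmd : Cmd Stk :=
  .seq (clearAll [.ctr .len, .ctr .blocks, .ctr .check, .ctr .outs, .ctr .wires, .ctr .pos,
    .ctr .fst, .ctr .snd]) (.loop .acc Option.isSome (.move .acc .out))

/-- Emptying eight counters costs `2 * B + 1` steps each, with one step at the end of the list;
moving the output costs another `2 * B + 1` and undoes its reversal on `.acc`. -/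
theorem within_finishCmd (o : List Sym) (v : Ctr → ℕ) (B : ℕ)
    (hB : ∀ k, (tapes 0 ⟨[], o, v⟩ k).length ≤ B) :
    Within finishCmd (tapes 0 ⟨[], o, v⟩) (single .out o) (18 * B + 10) := by
  have h1 := within_clearAll [.ctr .len, .ctr .blocks, .ctr .check, .ctr .outs, .ctr .wires,
    .ctr .pos, .ctr .fst, .ctr .snd] _ B hB
  have h2 := within_move_acc_out o.reverse []
  have e1 : (fun k => if k ∈ [Stk.ctr .len, .ctr .blocks, .ctr .check, .ctr .outs, .ctr .wires,
      .ctr .pos, .ctr .fst, .ctr .snd] then [] else tapes 0 ⟨[], o, v⟩ k) =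
      outStacks o.reverse [] := by
    funext k
    rcases k with _ | _ | _ | _ | c
    · rfl
    · rfl
    · rfl
    · rfl
    · cases c <;> rfl
  have e2 : outStacks [] (o.reverse.reverse ++ []) = single .out o := by
    funext k
    cases k <;> simp [single, outStacks]
  rw [e1] at h1
  rw [e2] at h2
  refine (h1.seq h2).mono ?_
  have := hB .acc
  simp only [tapes] at this
  simp only [List.length_cons, List.length_nil]
  omega

/-! ### The reduction -/

/-- A circuit that does not encode a sentence. -/
def noCircuit : Circuit where
  numInputs := 0
  gates := [.const false]
  outputs := List.replicate 7 0
  gates_wf := ⟨trivial, trivial⟩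
  outputs_wf i hi := by simp [List.eq_of_mem_replicate hi]

theorem length_noCircuit : noCircuit.outputs.length = 4 * noCircuit.numInputs + 7 := rfl

/-- All outputs are false, so every node is marked as unused and none can be a root. -/
theorem noCircuit_not_mem : noCircuit ∉ SuccETR := by
  rintro ⟨-, φ, ⟨r, h, -⟩, hn, -⟩
  have h1 : (noCircuit.nodeTable r).label = some .unused := rfl
  cases φ with
  | le s t => exact hn
  | not φ => exact hn
  | eq s t | lt s t | and s t | or s t =>
    obtain ⟨_, _, -, h, -⟩ := h
    rw [h] at h1
    cases h1

/-- The instance created from a circuit. -/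
noncomputable def reduce (C : Circuit) : QuadInstance :=
  if h : C.outputs.length = 4 * C.numInputs + 7 then build C h else build noCircuit length_noCircuit

theorem reduce_mem_iff (C : Circuit) : C ∈ SuccETR ↔ reduce C ∈ SuccQUAD := by
  unfold reduce
  split_ifs with h
  · exact (build_mem_succQUAD_iff C h).symm
  · rw [build_mem_succQUAD_iff]
    exact ⟨fun h' => absurd h'.1 h, fun h' => absurd h' noCircuit_not_mem⟩

theorem wellFormed_reduce (C : Circuit) : (reduce C).WellFormed := by
  unfold reduce
  split_ifs with h
  · exact wellFormed_build C h
  · exact wellFormed_build _ _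

theorem fourMonomials_reduce (C : Circuit) : (reduce C).FourMonomialsUnitCoeffs := by
  unfold reduce
  split_ifs with h
  · exact fourMonomials_build C h
  · exact fourMonomials_build _ _

/-- The instructions writing the numbers at the start of the instance. -/
def headerOps : List Op :=
  refOps ([(.len, 1)], 5) ++ (.emit (encodeNat 2 ++ encodeNat 1) ::
    (refOps ([(.len, 1)], 4) ++ refOps ([(.len, 1)], 7)))

/-- The numbers at the start of the instance. -/
def header (n : ℕ) : List Sym :=
  encodeNat (n + 5) ++ (encodeNat 2 ++ encodeNat 1) ++ encodeNat (n + 4) ++ encodeNat (n + 7)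

theorem runOps_headerOps (n b c : ℕ) (w : List Sym) :
    runOps headerOps ⟨w, [], vals n b c 0 0 0 0 0⟩ =
      ⟨w, header n, vals n b c 0 0 0 0 0⟩ := by
  simp only [headerOps, runOps_append, runOps_refOps, runOps, Op.run, refVal, emit, vals, header,
    List.map_cons, List.map_nil, List.sum_cons, List.sum_nil, one_mul, add_zero, List.nil_append]

/-- The program reading the circuit. -/
def inputCmd : Cmd Stk :=
  .seq readCmd <| .seq (opsCmd headerOps) <| .seq gatesCmd <| .seq outputsCmd <|
    .seq (whileCmd .check [.dec .check 1, .dec .outs 4]) <| opsCmd [.dec .outs 6]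

/-- The part of the instance that is written while the circuit is read. -/
def inputOut (C : Circuit) : List Sym :=
  header C.numInputs ++ C.gates.flatMap encodeGate ++ (nots C.outputs 0).flatMap encodeGate

/-- The length of the encoding of a circuit. -/
def circuitSize (C : Circuit) : ℕ := (encodeCircuit C).length

theorem circuitSize_eq (C : Circuit) : circuitSize C = C.numInputs + 1 +
    ((C.gates.flatMap encodeGate).length + ((C.outputs.flatMap encodeNat).length + 1 + 1)) := by
  simp [circuitSize, encodeCircuit, encodeNat]
  omega

theorem length_le_gates (l : List Gate) : l.length ≤ (l.flatMap encodeGate).length := by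
  rw [← countP_gates]
  exact List.countP_le_length

theorem length_le_outputs (l : List ℕ) : l.length ≤ (l.flatMap encodeNat).length := by
  induction l with
  | nil => exact le_rfl
  | cons x l ih => simp [encodeNat] at ih ⊢; omega

theorem le_outputs {l : List ℕ} {x : ℕ} (h : x ∈ l) : x ≤ (l.flatMap encodeNat).length := by
  induction l with
  | nil => simp at h
  | cons y l ih =>
    rw [List.flatMap_cons, List.length_append]
    rcases List.mem_cons.1 h with rfl | h
    · simp [encodeNat]; omega
    · exact (ih h).trans (Nat.le_add_left _ _)

theorem Fast.of_within {ι : Type} {size : ι → ℕ} {c : Cmd Stk} {m m' : ι → Mem} (K : ℕ)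
    (h : ∀ a, Within c ((m a).tapes 0) ((m' a).tapes 0) (K * (size a + 1) ^ 2))
    (h' : Small size m') : Fast size c m m' := fun _ => ⟨h', K, h⟩

theorem fast_outputsCmd : Fast circuitSize outputsCmd
    (fun C => ⟨C.outputs.flatMap encodeNat ++ [.fin],
      header C.numInputs ++ C.gates.flatMap encodeGate,
      vals C.numInputs C.numInputs C.numInputs 0 C.gates.length 0 0 0⟩)
    (fun C => ⟨[], inputOut C, vals C.numInputs C.numInputs C.numInputs C.outputs.length
      (C.gates.length + C.outputs.length) 0 0 0⟩) := by
  obtain ⟨K, hK⟩ := exists_within_outputCmd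
  refine Fast.of_within (2 * K + 2) (fun C => ?_) (small_vals 5 fun C => ?_)
  · have h1 := circuitSize_eq C
    have h2 := length_le_gates C.gates
    have h3 := length_le_outputs C.outputs
    have h := (within_outputs_loop (B := circuitSize C) (K := K * (circuitSize C + 1))
      (fun x j n b c u w o => hK x j n b c u _ w o) C.outputs []
      (header C.numInputs ++ C.gates.flatMap encodeGate) 0 C.numInputs C.numInputs C.numInputs
      C.gates.length (fun x hx => by have := le_outputs hx; omega) (by omega) (by omega)
      (by omega) (by omega) (by omega)).seq (within_pop_inp _ 0)
    rw [zero_add] at h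
    refine h.mono ?_
    have h4 : C.outputs.length ≤ circuitSize C := by omega
    calc C.outputs.length * (K * (circuitSize C + 1) + 1) + 1 + 1
        ≤ circuitSize C * (K * (circuitSize C + 1) + 1) + 1 + 1 := by gcongr
      _ ≤ (2 * K + 2) * (circuitSize C + 1) ^ 2 :=
        le_of_le_of_eq (Nat.le_add_right _ ((K * (circuitSize C + 1) * (circuitSize C + 2)) +
          (2 * circuitSize C ^ 2 + 3 * circuitSize C))) (by ring)
  · have h1 := circuitSize_eq C
    have h2 := length_le_gates C.gates
    have h3 := length_le_outputs C.outputs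
    omega

theorem le_square {x y K : ℕ} (h : x ≤ K * (y + 1)) : x ≤ K * (y + 1) ^ 2 :=
  h.trans (Nat.mul_le_mul_left _ (Nat.le_self_pow two_ne_zero _))

/-- The truncated difference left in `.outs` equals `1` exactly if the number of outputs is `4 * N +
7`, so two zero tests decide the format afterwards. -/
theorem fast_inputCmd : Fast circuitSize inputCmd
    (fun C => ⟨encodeCircuit C, [], vals 0 0 0 0 0 0 0 0⟩)
    (fun C => ⟨[], inputOut C, vals C.numInputs C.numInputs 0
      (C.outputs.length - 4 * C.numInputs - 6) (C.gates.length + C.outputs.length) 0 0 0⟩) := by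
  refine Fast.seq (m' := fun C => ⟨C.gates.flatMap encodeGate ++ .fin ::
    (C.outputs.flatMap encodeNat ++ [.fin]), [],
      vals C.numInputs C.numInputs C.numInputs 0 0 0 0 0⟩) (Fast.of_within 4 (fun C =>
    (within_readCmd _ _).mono (le_square ?_))
        (small_vals (n := Circuit.numInputs) (b := Circuit.numInputs)
      (c := Circuit.numInputs) 3 fun C => ?_)) ?_
  · have h1 := circuitSize_eq C
    omega
  · have h1 := circuitSize_eq C
    omega
  refine (fast_opsCmd _ _ _ fun C => runOps_headerOps _ _ _ _).seq ?_
  refine Fast.seq (m' := fun C => ⟨C.outputs.flatMap encodeNat ++ [.fin],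
    header C.numInputs ++ C.gates.flatMap encodeGate,
    vals C.numInputs C.numInputs C.numInputs 0 C.gates.length 0 0 0⟩) (Fast.of_within 4 (fun C =>
    (within_gatesCmd _ _ _ _ _ _).mono (le_square ?_))
        (small_vals (n := Circuit.numInputs) (b := Circuit.numInputs)
      (c := Circuit.numInputs) (w := fun C : Circuit => C.gates.length) 4 fun C => ?_)) ?_
  · have h1 := circuitSize_eq C
    omega
  · have h1 := circuitSize_eq C
    have h2 := length_le_gates C.gates
    omega
  refine fast_outputsCmd.seq ?_
  refine Fast.seq (m' := fun C => ⟨[], inputOut C, vals C.numInputs C.numInputs 0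
      (C.outputs.length - 4 * C.numInputs) (C.gates.length + C.outputs.length) 0 0 0⟩) ?_
    (fast_opsCmd _ _ _ fun C => by simp [runOps, Op.run, vals])
  have h := fast_whileCmd (size := circuitSize) .check [.dec .check 1, .dec .outs 4]
    (fun C => C.numInputs) (fun C i => ⟨[], inputOut C, vals C.numInputs C.numInputs
      (C.numInputs - i) (C.outputs.length - 4 * i) (C.gates.length + C.outputs.length) 0 0 0⟩)
    (fun C => by have h1 := circuitSize_eq C; omega) (fun C i hi => by simp only [vals]; omega)
    (fun C => by simp [vals]) (fun C i hi => by
      simp [runOps, Op.run, vals, Nat.sub_sub, Nat.mul_succ])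
  simpa using h

/-- The program replacing the output by a fixed instance. -/
noncomputable def rejectCmd : Cmd Stk :=
  .seq (clearCmd .acc) (emitCmd (encodeQuad (build noCircuit length_noCircuit)))

/-- The program checking the number of outputs and completing the instance. -/
noncomputable def decideCmd : Cmd Stk :=
  .ite (.ctr .outs) isTick (.seq (.pop (.ctr .outs)) (.ite (.ctr .outs) isTick rejectCmd writeCmd))
    rejectCmd

theorem within_rejectCmd (o : List Sym) (v : Ctr → ℕ) :
    Within rejectCmd (tapes 0 ⟨[], o, v⟩)
        (tapes 0 ⟨[], encodeQuad (build noCircuit length_noCircuit), v⟩)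
      (2 * o.length + 2 + (encodeQuad (build noCircuit length_noCircuit)).length) := by
  have h1 := within_clearCmd .acc (tapes 0 ⟨[], o, v⟩)
  have e : Function.update (tapes 0 ⟨[], o, v⟩) .acc [] = tapes 0 ⟨[], [], v⟩ := by
    funext k
    cases k <;> simp [tapes]
  rw [e] at h1
  refine (h1.seq (within_emitCmd _ _ _)).mono ?_
  simp only [tapes, List.length_reverse]
  omega

theorem encodeQuad_build (C : Circuit) (h : C.outputs.length = 4 * C.numInputs + 7) :
    encodeQuad (build C h) = inputOut C ++ ((ctrlGates C.numInputs
      (C.gates.length + C.outputs.length) ++ (scanAll C.numInputs (C.gates.length +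
        C.outputs.length) C.numInputs ++ synth outFun)).flatMap encodeGate ++ .fin ::
          (([0, 1, 2, 3, 4, 5, 6, 7, 8] ++ (nodeWires C.numInputs ++
            ([9, 10, 11, 12, 13] ++ nodeWires C.numInputs))).flatMap encodeNat ++ [.fin])) := by
  simp only [encodeQuad, encodeCircuit, build, allGates, allOutputs, inputOut, header,
    List.flatMap_append, List.append_assoc, add_assoc]

theorem exists_within_decideCmd : ∃ K, ∀ C : Circuit, ∃ v,
    Within (.seq inputCmd decideCmd) (tapes 0 ⟨encodeCircuit C, [], vals 0 0 0 0 0 0 0 0⟩)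
      (tapes 0 ⟨[], encodeQuad (reduce C), v⟩) (K * (circuitSize C + 1) ^ 2) := by
  obtain ⟨-, K, hK⟩ := fast_inputCmd (small_vals (n := fun _ => 0) 0 fun C => by simp)
  -- The writing phase is only started on circuits with outputs of the right length, hence the index
  -- type is a subtype.
  obtain ⟨-, K', hK'⟩ := fast_writeCmd
    (ι := {C : Circuit // C.outputs.length = 4 * C.numInputs + 7}) (size := fun C => circuitSize C)
    (fun C => C.1.numInputs) (fun C => C.1.gates.length + C.1.outputs.length)
    (fun C => inputOut C) (fun C => by have := circuitSize_eq C; omega)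
    (small_vals (ι := {C : Circuit // C.outputs.length = 4 * C.numInputs + 7})
      (n := fun C => C.1.numInputs) (b := fun C => C.1.numInputs)
      (w := fun C => C.1.gates.length + C.1.outputs.length) 4 fun C => by
        have h1 := circuitSize_eq C
        have h2 := length_le_gates C.1.gates
        have h3 := length_le_outputs C.1.outputs
        omega)
  beta_reduce at hK hK'
  -- One `K` pays for reading and two for erasing what was written if the circuit is rejected; `K'`
  -- pays for completing the instance, and the last summand for the fixed instance and the tests.
  refine ⟨3 * K + K' + ((encodeQuad (build noCircuit length_noCircuit)).length + 5), fun C => ?_⟩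
  have hpos : 1 ≤ (circuitSize C + 1) ^ 2 := Nat.one_le_pow _ _ (Nat.succ_pos _)
  generalize hR : (encodeQuad (build noCircuit length_noCircuit)).length = R
  have hR' : R + 5 ≤ (R + 5) * (circuitSize C + 1) ^ 2 := Nat.le_mul_of_pos_right _ hpos
  -- The partial output starts empty, so it is no longer than the time spent on it.
  have hlen : (inputOut C).length ≤ K * (circuitSize C + 1) ^ 2 := by
    obtain ⟨t, ht, hr⟩ := hK C
    have := hr.length_le .acc
    simp only [tapes, List.length_reverse, List.length_nil, zero_add] at this
    exact this.trans ht
  by_cases h : C.outputs.length = 4 * C.numInputs + 7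
  · have e : C.outputs.length - 4 * C.numInputs - 6 = 1 := by omega
    have h1 := hK C
    have h2 := within_pop_ctr ⟨[], inputOut C, vals C.numInputs C.numInputs 0 1
      (C.gates.length + C.outputs.length) 0 0 0⟩ 0 .outs
    rw [set_outs] at h2
    rw [e] at h1
    refine ⟨vals C.numInputs 0 0 0 (C.gates.length + C.outputs.length +
      C.numInputs * (scanSize + 2)) (C.numInputs * scanSize) 0 0, ?_⟩
    rw [reduce, dif_pos h, encodeQuad_build]
    refine (h1.seq (Within.iteTrue rfl (h2.seq (Within.iteFalse rfl (hK' ⟨C, h⟩))))).mono ?_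
    rw [add_mul, add_mul, mul_assoc]
    dsimp only
    omega
  · refine ⟨vals C.numInputs C.numInputs 0 (C.outputs.length - 4 * C.numInputs - 6 - 1)
      (C.gates.length + C.outputs.length) 0 0 0, ?_⟩
    rw [reduce, dif_neg h]
    have h1 := hK C
    cases e : C.outputs.length - 4 * C.numInputs - 6 with
    | zero =>
      rw [e] at h1
      refine (h1.seq (Within.iteFalse rfl (within_rejectCmd _ _))).mono ?_
      rw [add_mul, add_mul, mul_assoc, hR]
      omega
    | succ x =>
      obtain ⟨y, rfl⟩ : ∃ y, x = y + 1 := ⟨x - 1, by omega⟩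
      have h2 := within_pop_ctr ⟨[], inputOut C, vals C.numInputs C.numInputs 0 (y + 1 + 1)
        (C.gates.length + C.outputs.length) 0 0 0⟩ 0 .outs
      rw [set_outs] at h2
      rw [e] at h1
      refine (h1.seq (Within.iteTrue rfl (h2.seq
        (Within.iteTrue rfl (within_rejectCmd _ _))))).mono ?_
      rw [add_mul, add_mul, mul_assoc, hR]
      omega

theorem computable_reduce : Nonempty (Turing.TM2ComputableInPolyTime circuitEncoding.encode
    quadEncoding.encode reduce) := by
  obtain ⟨K, hK⟩ := exists_within_decideCmd
  refine Cmd.computableInPolyTime (.seq (.seq inputCmd decideCmd) finishCmd) .inp .out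
    -- With `n` the input length and `T = K * (n + 1) ^ 2` the time so far, all stacks have length
    -- at most `n + T`. The total is `T + 18 * (n + T) + 10`, hence at most `(19 * K + 28) * (n + 1)
    -- ^ 2`.
    (Polynomial.C (19 * K + 28) * (Polynomial.X + 1) ^ 2) fun C => ?_
  obtain ⟨v, hv⟩ := hK C
  have e : tapes 0 ⟨encodeCircuit C, [], vals 0 0 0 0 0 0 0 0⟩ = single .inp (encodeCircuit C) := by
    funext k
    rcases k with _ | _ | _ | _ | c
    · rfl
    · rfl
    · rfl
    · rfl
    · cases c <;> rfl
  have hB : ∀ k, (tapes 0 ⟨[], encodeQuad (reduce C), v⟩ k).length ≤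
      circuitSize C + K * (circuitSize C + 1) ^ 2 := by
    intro k
    obtain ⟨t, ht, hr⟩ := hv
    refine (hr.length_le k).trans (Nat.add_le_add ?_ ht)
    rw [e, single]
    split_ifs
    · exact le_rfl
    · exact Nat.zero_le _
  have h := hv.seq (within_finishCmd _ _ _ hB)
  rw [e] at h
  refine h.mono ?_
  change _ ≤ Polynomial.eval (circuitSize C) _
  simp only [Polynomial.eval_mul, Polynomial.eval_C, Polynomial.eval_pow, Polynomial.eval_add,
    Polynomial.eval_X, Polynomial.eval_one]
  have h1 : circuitSize C + 1 ≤ (circuitSize C + 1) ^ 2 := Nat.le_self_pow two_ne_zero _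
  rw [add_mul, mul_assoc]
  omega

end SuccReals

theorem mainTheorem6 :
    ∃ f : SuccReals.Circuit → SuccReals.QuadInstance,
      SuccReals.IsPolyTimeReduction SuccReals.circuitEncoding SuccReals.quadEncoding
        SuccReals.SuccETR SuccReals.SuccQUAD f ∧
      ∀ C : SuccReals.Circuit, (f C).WellFormed ∧ (f C).FourMonomialsUnitCoeffs :=
  ⟨SuccReals.reduce, ⟨SuccReals.computable_reduce, SuccReals.reduce_mem_iff⟩,
    fun C => ⟨SuccReals.wellFormed_reduce C, SuccReals.fourMonomials_reduce C⟩⟩
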